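/- **Setting.** Let $k\ge 1$, let $S_k$ be the set of symmetric positive definite real $k\times k$ matrices, and for $\theta=(\mu,\Sigma,\nu)\in\mathbb R^k\times S_k\times(0,\infty)$ let $P^{(n)}_\theta$ be the joint law of $n$ i.i.d. observations $X_1,\dots,X_n$ with the $k$-variate Student $t$ density $$f_\theta(x)=\frac{\Gamma(\frac{\nu+k}2)}{(\pi\nu)^{k/2}\Gamma(\frac\nu2)}|\Sigma|^{-1/2}\bigl(1+(x-\mu)'\Sigma^{-1}(x-\mu)/\nu\bigr)^{-(\nu+k)/2}.$$ Write $\mathcal L^{(2)}_\theta=D_{\mathrm{vech}(\Sigma)}\log f_\theta$ and $\mathcal L^{(3)}_\theta=D_\nu\log f_\theta$, where $\mathrm{vech}(\Sigma)$ is the vector of the entries $\Sigma_{ij}$, $i\le j$. Put $\Delta^{(n)}_j(\theta)=n^{-1/2}\sum_{i=1}^n\mathcal L^{(j)}_\theta(X_i)$, $j=2,3$. Let $\Gamma_{22}(\theta),\Gamma_{23}(\theta),\Gamma_{33}(\theta)$ be the blocks of the covariance matrix of $(\mathcal L^{(2)}_\theta(X_1),\mathcal L^{(3)}_\theta(X_1))$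 under $P^{(1)}_\theta$. Define the efficient central sequence and the efficient information for $\nu$ by $$\Delta_3^{(n)*}=\Delta^{(n)}_3-\Gamma_{23}'\Gamma_{22}^{-1}\Delta_2^{(n)},\qquad \Gamma_{33}^*=\Gamma_{33}-\Gamma_{23}'\Gamma_{22}^{-1}\Gamma_{23}.$$ Fix $\nu_0>0$ and $\alpha\in(0,1)$. Let $\hat\mu^{(n)}$ (with values in $\mathbb R^k$) and $\hat\Sigma^{(n)}$ (with values in the symmetric $k\times k$ matrices) be measurable functions of $X_1,\dots,X_n$ such that * (root-$n$ consistency) $n^{1/2}(\hat\mu^{(n)}-\mu,\hat\Sigma^{(n)}-\Sigma)=O_P(1)$ under $P^{(n)}_{(\mu,\Sigma,\nu_0)}$ for all $\mu\in\mathbb R^k$, $\Sigma\in S_k$; * (local asymptotic discreteness) for all $\mu\in\mathbb R^k$, $\Sigma\in S_k$ and $M>0$, the number of possible values of $(\hat\mu^{(n)},\hat\Sigma^{(n)})$ in the ball of radius $Mn^{-1/2}$ centred at $(\mu,\Sigma)$ is bounded as $n\to\infty$. Let $Q^{(n)}_{\nu_0}=\Delta_3^{(n)*}(\hat\mu^{(n)},\hat\Sigma^{(n)},\nu_0)\big/\sqrt{\Gamma_{33}^*(\hat\mu^{(n)},\hat\Sigma^{(n)},\nu_0)}$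 (set to $0$ if $\hat\Sigma^{(n)}\notin S_k$), and let $\phi^{(n)}_{\nu_0}=\mathbf 1\{|Q^{(n)}_{\nu_0}|>z_{\alpha/2}\}$, with $z_{\alpha/2}$ the upper $\alpha/2$-quantile of $\mathcal N(0,1)$. **Theorem.** 1. For all $\mu\in\mathbb R^k$, $\Sigma\in S_k$: $Q^{(n)}_{\nu_0}\to\mathcal N(0,1)$ in distribution under $P^{(n)}_{(\mu,\Sigma,\nu_0)}$. 2. For all $\mu\in\mathbb R^k$, $\Sigma\in S_k$ and every real sequence $\tau_3^{(n)}\to\tau_3\in\mathbb R$ with $\nu_0+n^{-1/2}\tau_3^{(n)}>0$ for all $n$: $Q^{(n)}_{\nu_0}\to\mathcal N\bigl(\tau_3\sqrt{\Gamma_{33}^*(\mu,\Sigma,\nu_0)},1\bigr)$ in distribution under $P^{(n)}_{(\mu,\Sigma,\nu_0+n^{-1/2}\tau_3^{(n)})}$. 3. The tests $\phi^{(n)}_{\nu_0}$ have asymptotic level $\alpha$: for all $\mu\in\mathbb R^k$, $\Sigma\in S_k$, $E_{(\mu,\Sigma,\nu_0)}[\phi^{(n)}_{\nu_0}]\to\alpha$.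 They are locally and asymptotically maximin for $\mathcal H_0:\nu=\nu_0$ against $\mathcal H_1:\nu\ne\nu_0$, with $\mu,\Sigma$ unspecified. That is, let $\mathcal C_\alpha$ be the class of all sequences of (possibly randomized) tests $\psi^{(n)}$ with $\limsup_n E_{(\mu,\Sigma,\nu_0)}[\psi^{(n)}]\le\alpha$ for all $\mu\in\mathbb R^k$, $\Sigma\in S_k$. For $\theta=(\mu,\Sigma,\nu_0)$ with $\Sigma\in S_k$ and for $c\ge0$, $M>0$, let $\mathcal H_1^{(n)}(\theta;c,M)$ be the set of $\theta'=(\mu',\Sigma',\nu')\in\mathbb R^k\times S_k\times(0,\infty)$ with $\nu'\ne\nu_0$, $|\nu'-\nu_0|\ge cn^{-1/2}$ and $\|\theta'-\theta\|_\infty\le Mn^{-1/2}$. Then $(\phi^{(n)}_{\nu_0})\in\mathcal C_\alpha$ and, for all such $\theta$ and $c$, $$\lim_{M\to\infty}\liminf_{n\to\infty}\inf_{\theta'\in\mathcal H_1^{(n)}(\theta;c,M)}E_{\theta'}[\phi^{(n)}_{\nu_0}]\;\ge\;\sup_{\psi\in\mathcal C_\alpha}\lim_{M\to\infty}\limsup_{n\to\infty}\inf_{\theta'\in\mathcal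 H_1^{(n)}(\theta;c,M)}E_{\theta'}[\psi^{(n)}].$$ -/

import Mathlib

open MeasureTheory ProbabilityTheory Filter Topology Matrix
open scoped ENNReal

/-- Parameters `(μ, S, ν)` of the `k`-variate Student `t` family: location, scatter, tail weight. -/
structure StudentParam (k : ℕ) where
  loc : Fin k → ℝ
  scatter : Matrix (Fin k) (Fin k) ℝ
  tail : ℝ

/-- Samples `(x₁, …, xₙ)` of `n` points of `ℝᵏ`. -/
abbrev Sample (k n : ℕ) : Type := Fin n → Fin k → ℝ

namespace StudentT

noncomputable section

variable {k : ℕ}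

/-- The normalizing constant `c_{ν,k} = Γ((ν+k)/2) / ((πν)^{k/2} Γ(ν/2))`. -/
def normConst (k : ℕ) (ν : ℝ) : ℝ :=
  Real.Gamma ((ν + k) / 2) / ((Real.pi * ν) ^ ((k : ℝ) / 2) * Real.Gamma (ν / 2))

/-- `(x - μ)' S⁻¹ (x - μ)`, which is `‖S^{-1/2} (x - μ)‖²` for positive definite `S`. -/
def mahalanobisSq (θ : StudentParam k) (x : Fin k → ℝ) : ℝ :=
  (x - θ.loc) ⬝ᵥ (θ.scatter⁻¹ *ᵥ (x - θ.loc))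

/-- The `k`-variate Student `t` density. -/
def density (θ : StudentParam k) (x : Fin k → ℝ) : ℝ :=
  normConst k θ.tail * θ.scatter.det ^ (-(1 / 2) : ℝ) *
    (1 + mahalanobisSq θ x / θ.tail) ^ (-((θ.tail + k) / 2))

/-- The `k`-variate Student `t` distribution. -/
def law (θ : StudentParam k) : Measure (Fin k → ℝ) :=
  volume.withDensity fun x => ENNReal.ofReal (density θ x)

/-- The joint distribution of `n` independent observations with distribution `law θ`. -/
def sampleLaw (θ : StudentParam k) (n : ℕ) : Measure (Sample k n) :=
  Measure.pi fun _ => law θ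

/-- Positions of the entries of a symmetric matrix kept by the half-vectorization `vech`. -/
abbrev VechIdx (k : ℕ) : Type := {p : Fin k × Fin k // p.1 ≤ p.2}

/-- The symmetric matrix whose `vech` is the unit vector at position `p`. -/
def vechBasis (p : VechIdx k) : Matrix (Fin k) (Fin k) ℝ :=
  Matrix.of fun i j => if (i, j) = p.1 ∨ (j, i) = p.1 then 1 else 0

/-- The score for `vech S`: the partial derivatives of the log-density in the coordinates of
`vech S`. -/
def scoreScatter (θ : StudentParam k) (p : VechIdx k) (x : Fin k → ℝ) : ℝ :=
  deriv (fun t : ℝ =>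
    Real.log (density { θ with scatter := θ.scatter + t • vechBasis p } x)) 0

/-- The score for `ν`. -/
def scoreTail (θ : StudentParam k) (x : Fin k → ℝ) : ℝ :=
  deriv (fun v : ℝ => Real.log (density { θ with tail := v } x)) θ.tail

/-- The scatter block of the Fisher information (covariance matrix of the score). -/
def info22 (θ : StudentParam k) : Matrix (VechIdx k) (VechIdx k) ℝ :=
  Matrix.of fun p q => cov[scoreScatter θ p, scoreScatter θ q; law θ]

/-- The scatter-tail block of the Fisher information. -/
def info23 (θ : StudentParam k) : VechIdx k → ℝ :=
  fun p => cov[scoreScatter θ p, scoreTail θ; law θ]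

/-- The tail block of the Fisher information. -/
def info33 (θ : StudentParam k) : ℝ := cov[scoreTail θ, scoreTail θ; law θ]

/-- The efficient Fisher information `Γ₃₃* = Γ₃₃ - Γ₂₃' Γ₂₂⁻¹ Γ₂₃` for tail weight. -/
def effInfo (θ : StudentParam k) : ℝ :=
  info33 θ - info23 θ ⬝ᵥ ((info22 θ)⁻¹ *ᵥ info23 θ)

/-- The scatter part `Δ₂` of the central sequence. -/
def central2 (θ : StudentParam k) {n : ℕ} (x : Sample k n) : VechIdx k → ℝ :=
  fun p => (√(n : ℝ))⁻¹ * ∑ i, scoreScatter θ p (x i)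

/-- The tail part `Δ₃` of the central sequence. -/
def central3 (θ : StudentParam k) {n : ℕ} (x : Sample k n) : ℝ :=
  (√(n : ℝ))⁻¹ * ∑ i, scoreTail θ (x i)

/-- The efficient central sequence `Δ₃* = Δ₃ - Γ₂₃' Γ₂₂⁻¹ Δ₂` for tail weight. -/
def effCentral (θ : StudentParam k) {n : ℕ} (x : Sample k n) : ℝ :=
  central3 θ x - info23 θ ⬝ᵥ ((info22 θ)⁻¹ *ᵥ central2 θ x)

/-- `(μ', S')` lies in the ball of radius `M n^{-1/2}` around `(μ, S)` (maximum norm). -/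
def InBall (n : ℕ) (M : ℝ) (μ : Fin k → ℝ) (S : Matrix (Fin k) (Fin k) ℝ)
    (μ' : Fin k → ℝ) (S' : Matrix (Fin k) (Fin k) ℝ) : Prop :=
  (∀ i, √(n : ℝ) * |μ' i - μ i| ≤ M) ∧ ∀ i j, √(n : ℝ) * |S' i j - S i j| ≤ M

/-- A sequence of estimators of `(μ, S)`: measurable, the scatter part with symmetric values.
The values of the scatter part need not be positive definite for every sample. -/
structure IsEstimator (muHat : ∀ n, Sample k n → Fin k → ℝ)
    (sHat : ∀ n, Sample k n → Matrix (Fin k) (Fin k) ℝ) : Prop where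
  measurable_loc : ∀ n, Measurable (muHat n)
  measurable_scatter : ∀ n i j, Measurable fun x => sHat n x i j
  symm : ∀ n x, (sHat n x).IsSymm

/-- Root-`n` consistency of the estimators of `(μ, S)` in the model with tail weight `ν₀`:
`n^{1/2}(μ̂ - μ, Ŝ - S) = O_P(1)` for all `(μ, S)`. -/
def RootNConsistent (ν₀ : ℝ) (muHat : ∀ n, Sample k n → Fin k → ℝ)
    (sHat : ∀ n, Sample k n → Matrix (Fin k) (Fin k) ℝ) : Prop :=
  ∀ (μ : Fin k → ℝ) (S : Matrix (Fin k) (Fin k) ℝ), S.PosDef →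
    ∀ ε : ℝ, 0 < ε → ∃ M : ℝ, ∀ᶠ n : ℕ in atTop,
      sampleLaw ⟨μ, S, ν₀⟩ n {x | ¬ InBall n M μ S (muHat n x) (sHat n x)} ≤ ENNReal.ofReal ε

/-- Local asymptotic discreteness: the number of possible values of the estimator in balls with
`O(n^{-1/2})` radius around any `(μ, S)` stays bounded as `n → ∞`. -/
def LocallyDiscrete (muHat : ∀ n, Sample k n → Fin k → ℝ)
    (sHat : ∀ n, Sample k n → Matrix (Fin k) (Fin k) ℝ) : Prop :=
  ∀ (μ : Fin k → ℝ) (S : Matrix (Fin k) (Fin k) ℝ), S.PosDef →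
    ∀ M : ℝ, ∃ N : ℕ, ∀ᶠ n : ℕ in atTop,
      {v ∈ Set.range fun x => (muHat n x, sHat n x) | InBall n M μ S v.1 v.2}.encard ≤ N

open Classical in
/-- The test statistic `Q_{ν₀}`; by convention it is `0` on samples where the scatter estimate is
not positive definite. -/
def testStat (ν₀ : ℝ) (muHat : ∀ n, Sample k n → Fin k → ℝ)
    (sHat : ∀ n, Sample k n → Matrix (Fin k) (Fin k) ℝ) (n : ℕ) (x : Sample k n) : ℝ :=
  if (sHat n x).PosDef then
    effCentral ⟨muHat n x, sHat n x, ν₀⟩ x / √(effInfo ⟨muHat n x, sHat n x, ν₀⟩)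
  else 0

/-- The upper `p`-quantile of the standard normal distribution. -/
def upperQuantile (p : ℝ) : ℝ :=
  sInf {t : ℝ | gaussianReal 0 1 (Set.Ioi t) ≤ ENNReal.ofReal p}

open Classical in
/-- The two-sided test: reject if `|Q_{ν₀}|` exceeds the upper `α/2` normal quantile. -/
def twoSidedTest (ν₀ α : ℝ) (muHat : ∀ n, Sample k n → Fin k → ℝ)
    (sHat : ∀ n, Sample k n → Matrix (Fin k) (Fin k) ℝ) (n : ℕ) (x : Sample k n) : ℝ :=
  if upperQuantile (α / 2) < |testStat ν₀ muHat sHat n x| then 1 else 0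

/-- Convergence in distribution of `T n`, under the probability measures `P n`, to the normal
distribution with mean `m` and variance `1`. -/
def AsympNormal (T : ∀ n, Sample k n → ℝ) (P : ∀ n, Measure (Sample k n)) (m : ℝ) : Prop :=
  ∃ _ : ∀ n, IsProbabilityMeasure (P n),
    TendstoInDistribution T atTop (id : ℝ → ℝ) P (gaussianReal m 1)

/-- The null hypothesis `ν = ν₀`, location and scatter unspecified. -/
def nullHyp (k : ℕ) (ν₀ : ℝ) : Set (StudentParam k) :=
  {θ | θ.scatter.PosDef ∧ θ.tail = ν₀}

/-- The two-sided alternative `0 < ν ≠ ν₀`, location and scatter unspecified. -/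
def altHyp (k : ℕ) (ν₀ : ℝ) : Set (StudentParam k) :=
  {θ | θ.scatter.PosDef ∧ 0 < θ.tail ∧ θ.tail ≠ ν₀}

/-- The alternatives within `M n^{-1/2}` of the null parameter `θ` whose tail weight is at distance
at least `c n^{-1/2}` from that of `θ`. -/
def localAlt (θ : StudentParam k) (c M : ℝ) (n : ℕ) : Set (StudentParam k) :=
  {θ' ∈ altHyp k θ.tail | InBall n M θ.loc θ.scatter θ'.loc θ'.scatter ∧
    c ≤ √(n : ℝ) * |θ'.tail - θ.tail| ∧ √(n : ℝ) * |θ'.tail - θ.tail| ≤ M}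

/-- The expectation of the (possibly randomized) test `φ` under `P`. -/
def power {n : ℕ} (φ : Sample k n → ℝ) (P : Measure (Sample k n)) : ℝ≥0∞ :=
  ∫⁻ x, ENNReal.ofReal (φ x) ∂P

/-- Sequences of (possibly randomized) tests of asymptotic level `α` for `ν = ν₀`. -/
structure HasAsympLevel (ν₀ α : ℝ) (φ : ∀ n, Sample k n → ℝ) : Prop where
  measurable : ∀ n, Measurable (φ n)
  mem_Icc : ∀ n x, φ n x ∈ Set.Icc (0 : ℝ) 1
  level : ∀ θ ∈ nullHyp k ν₀,
    limsup (fun n => power (φ n) (sampleLaw θ n)) atTop ≤ ENNReal.ofReal α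

/-- Local asymptotic maximinity for `ν = ν₀` against `ν ≠ ν₀` at asymptotic level `α`. At every
null parameter `θ` and for every separation `c ≥ 0`, the asymptotic minimal power over the local
alternatives is at least that of any other sequence of tests of asymptotic level `α`. The minimal
power decreases in the radius `M` of the local neighbourhood, so `⨅ M` is the limit `M → ∞`. -/
structure LocallyAsympMaximin (ν₀ α : ℝ) (φ : ∀ n, Sample k n → ℝ) : Prop where
  level : HasAsympLevel ν₀ α φ
  maximin : ∀ θ ∈ nullHyp k ν₀, ∀ c : ℝ, 0 ≤ c →
    ⨆ (ψ : ∀ n, Sample k n → ℝ) (_ : HasAsympLevel ν₀ α ψ), ⨅ M : ℝ,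
        limsup (fun n => ⨅ θ' ∈ localAlt θ c M n, power (ψ n) (sampleLaw θ' n)) atTop
      ≤ ⨅ M : ℝ,
        liminf (fun n => ⨅ θ' ∈ localAlt θ c M n, power (φ n) (sampleLaw θ' n)) atTop

end

end StudentT

/-! The Student family is equivariant under the affine maps `y ↦ b + A y`, so local questions at (μ,
S, ν) with S = A Aᵀ pull back to (0, 1, ν) (`exists_pull`). There the log-likelihood ratio of a
displacement of size d agrees with its linear part `linScore` up to O(d²), uniformly in the
observation (`exists_logRatio_bound`): the only unbounded term, log(1 + |y|²/ν), enters exactly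
linearly. All scores are dominated by W = 1 + log(1 + |y|²/ν), and exp(εW) is integrable for ε <
ν/2, so each expansion can be integrated with explicit remainders (`exists_bounds`).

The standard law is invariant under reflections and permutations of coordinates. The tail score is
radial, hence uncorrelated with the location scores, and its projection on the scatter scores is a
multiple of the one radial scatter score, that of the direction T = 1. The residual `effScore` is
orthogonal to all nuisance scores (`integral_effScore_mul_linScore`) and not degenerate
(`effVar_pos`). Solving the normal equations turns Δ₃* into a normalized sum of efficient scores and
Γ₃₃* into `effVar`, which depends on k and ν only (`effCentral_eq`, `effInfo_eq`).

For the limit laws, the characteristic function of one efficient score is expanded directly under a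
nearby parameter. Orthogonality leaves only the tail displacement in the mean, and the n-th power
converges to the characteristic function of a shifted normal law
(`IsLocalSeq.tendsto_charFun_scoreSum`). Replacing the parameter by a deterministic one at distance
M n^{-1/2} with the same tail weight changes the score sum by O(n^{-1/2}) in L². Root-n consistency
and discreteness reduce the estimator to boundedly many such values, so estimation is negligible
under the null (`tendsto_testStat_sub`). The likelihood ratios of local alternatives are bounded in
L², so this negligibility persists under them (`IsLocalSeq.contiguous`).

For maximinity, a compactness argument bounds the minimal power of the two-sided test from below by
the power of the normal test at shift c√Γ₃₃* (`le_liminf_power`). Conversely, the minimal power of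
any test is at most its average power at the two points ±c' n^{-1/2}, c' > c, of the least favorable
path. Neyman–Pearson duality bounds this average through an integral of the two likelihood ratios
(`integral_mul_add_integral_mul_le`), whose limit is computed in a normal shift model
(`tendsto_integral_deficit`, `integral_limitDeficit`). There the symmetric mixture is increasing in
|w|, so the two-sided test is the optimal one; letting c' decrease to c closes the gap
(`iInf_limsup_power_le`). -/

namespace StudentT

noncomputable section

variable {k : ℕ}

/-! ### Affine equivariance and normalization of the Student density -/

/-- The image of a parameter under the affine change of variable `y ↦ b + A y`. -/
def push (A : Matrix (Fin k) (Fin k) ℝ) (b : Fin k → ℝ) (θ : StudentParam k) : StudentParam k :=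
  ⟨b + A *ᵥ θ.loc, A * θ.scatter * Aᵀ, θ.tail⟩

/-- Positivity in the C⋆-algebra of matrices gives S = b⋆b, and A = bᵀ. Any such factor serves for
the transport to the standard parameter; no symmetric square root is needed. -/
lemma exists_mul_transpose_eq {S : Matrix (Fin k) (Fin k) ℝ} (hS : S.PosDef) :
    ∃ A : Matrix (Fin k) (Fin k) ℝ, A.det ≠ 0 ∧ A * Aᵀ = S := by
  open scoped MatrixOrder in
  obtain ⟨b, hb⟩ := CStarAlgebra.nonneg_iff_eq_star_mul_self.mp hS.posSemidef.nonneg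
  have h : bᵀ * bᵀᵀ = S := by
    rw [hb, Matrix.transpose_transpose, Matrix.star_eq_conjTranspose,
      Matrix.conjTranspose_eq_transpose_of_trivial]
  refine ⟨bᵀ, fun h0 => ?_, h⟩
  have := hS.det_pos
  rw [← h, Matrix.det_mul, h0] at this
  simp at this

lemma mahalanobisSq_push {A : Matrix (Fin k) (Fin k) ℝ} (hA : A.det ≠ 0) (b : Fin k → ℝ)
    (θ : StudentParam k) (y : Fin k → ℝ) :
    mahalanobisSq (push A b θ) (b + A *ᵥ y) = mahalanobisSq θ y := by
  have hu : IsUnit A.det := isUnit_iff_ne_zero.mpr hA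
  have h1 : b + A *ᵥ y - (b + A *ᵥ θ.loc) = A *ᵥ (y - θ.loc) := by
    rw [Matrix.mulVec_sub]; abel
  have h2 : (A * θ.scatter * Aᵀ)⁻¹ *ᵥ (A *ᵥ (y - θ.loc))
      = (Aᵀ)⁻¹ *ᵥ (θ.scatter⁻¹ *ᵥ (y - θ.loc)) := by
    rw [Matrix.mul_inv_rev, Matrix.mul_inv_rev, Matrix.mulVec_mulVec, Matrix.mulVec_mulVec,
      Matrix.mul_assoc, Matrix.mul_assoc, Matrix.nonsing_inv_mul _ hu, Matrix.mul_one]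
  simp only [mahalanobisSq, push, h1, h2]
  rw [Matrix.dotProduct_mulVec, Matrix.vecMul_mulVec, ← Matrix.dotProduct_mulVec,
    Matrix.mul_nonsing_inv _ (by rwa [Matrix.det_transpose]),
    Matrix.one_mulVec]

lemma mahalanobisSq_nonneg {θ : StudentParam k} (hS : θ.scatter.PosDef) (x : Fin k → ℝ) :
    0 ≤ mahalanobisSq θ x := by
  have := hS.inv.posSemidef.dotProduct_mulVec_nonneg (x - θ.loc)
  simpa [mahalanobisSq] using this

lemma posDef_push {A : Matrix (Fin k) (Fin k) ℝ} (hA : A.det ≠ 0)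
    {S : Matrix (Fin k) (Fin k) ℝ} (hS : S.PosDef) : (A * S * Aᵀ).PosDef := by
  have := hS.mul_mul_conjTranspose_same (B := A) (Matrix.vecMul_injective_iff_isUnit.mpr
    ((Matrix.isUnit_iff_isUnit_det _).mpr (isUnit_iff_ne_zero.mpr hA)))
  rwa [Matrix.conjTranspose_eq_transpose_of_trivial] at this

/-- The Mahalanobis norm is invariant, so only the determinant factor changes. It cancels the
Jacobian in `law_push` and disappears from likelihood ratios. -/
lemma density_push {A : Matrix (Fin k) (Fin k) ℝ} (hA : A.det ≠ 0) (b : Fin k → ℝ)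
    {θ : StudentParam k} (hS : θ.scatter.PosDef) (y : Fin k → ℝ) :
    density (push A b θ) (b + A *ᵥ y) = |A.det|⁻¹ * density θ y := by
  have h1 : (A * θ.scatter * Aᵀ).det ^ (-(1 / 2) : ℝ)
      = |A.det|⁻¹ * θ.scatter.det ^ (-(1 / 2) : ℝ) := by
    rw [Matrix.det_mul, Matrix.det_mul, Matrix.det_transpose,
      show A.det * θ.scatter.det * A.det = |A.det| ^ 2 * θ.scatter.det by rw [sq_abs]; ring,
      Real.mul_rpow (by positivity) hS.det_pos.le, ← Real.rpow_natCast,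
      ← Real.rpow_mul (abs_nonneg _)]
    norm_num [Real.rpow_neg_one]
  rw [density, mahalanobisSq_push hA]
  simp only [push, h1, density]
  ring

lemma continuous_mahalanobisSq (θ : StudentParam k) : Continuous (mahalanobisSq θ) := by
  unfold mahalanobisSq
  fun_prop

lemma measurable_density (θ : StudentParam k) : Measurable (density θ) := by
  have := (continuous_mahalanobisSq θ).measurable
  unfold density
  fun_prop

lemma normConst_pos (k : ℕ) {ν : ℝ} (hν : 0 < ν) : 0 < normConst k ν := by
  unfold normConst
  have := Real.Gamma_pos_of_pos (show 0 < (ν + k) / 2 by positivity)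
  have := Real.Gamma_pos_of_pos (show 0 < ν / 2 by positivity)
  positivity

lemma density_pos {θ : StudentParam k} (hS : θ.scatter.PosDef) (hν : 0 < θ.tail)
    (x : Fin k → ℝ) : 0 < density θ x := by
  have := normConst_pos k hν
  have := hS.det_pos
  have := mahalanobisSq_nonneg hS x
  unfold density
  positivity

lemma lintegral_comp_affine {A : Matrix (Fin k) (Fin k) ℝ} (hA : A.det ≠ 0) (b : Fin k → ℝ)
    {F : (Fin k → ℝ) → ℝ≥0∞} (hF : Measurable F) :
    ∫⁻ x, F x = ENNReal.ofReal |A.det| * ∫⁻ y, F (b + A *ᵥ y) := by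
  have h1 : ∫⁻ y, F (b + A *ᵥ y) = ∫⁻ x, F (b + x) ∂(Measure.map (toLin' A) volume) := by
    rw [lintegral_map (by fun_prop)
      (LinearMap.continuous_of_finiteDimensional (toLin' A)).measurable]
    rfl
  rw [h1, Real.map_matrix_volume_pi_eq_smul_volume_pi hA, lintegral_smul_measure,
    lintegral_add_left_eq_self, smul_eq_mul, ← mul_assoc, ← ENNReal.ofReal_mul (abs_nonneg _),
    abs_inv, mul_inv_cancel₀ (abs_ne_zero.mpr hA)]
  simp

lemma law_push {A : Matrix (Fin k) (Fin k) ℝ} (hA : A.det ≠ 0) (b : Fin k → ℝ)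
    {θ : StudentParam k} (hS : θ.scatter.PosDef) :
    law (push A b θ) = (law θ).map fun y => b + A *ᵥ y := by
  have hm : Measurable fun y => b + A *ᵥ y := by fun_prop
  have hd : ∀ θ : StudentParam k, Measurable fun x => ENNReal.ofReal (density θ x) :=
    fun θ => (measurable_density θ).ennreal_ofReal
  refine Measure.ext_of_lintegral _ fun F hF => ?_
  rw [lintegral_map hF hm, law, law, lintegral_withDensity_eq_lintegral_mul _ (hd _) hF,
    lintegral_withDensity_eq_lintegral_mul _ (hd _) (show Measurable fun y => F (b + A *ᵥ y) from
      hF.comp hm),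
    lintegral_comp_affine hA b ((hd _).mul hF), ← lintegral_const_mul]
  · refine lintegral_congr fun y => ?_
    simp only [Pi.mul_apply]
    rw [density_push hA b hS, ← mul_assoc, ← ENNReal.ofReal_mul (abs_nonneg _), ← mul_assoc,
      mul_inv_cancel₀ (abs_ne_zero.mpr hA), one_mul]
  · exact ((hd _).mul hF).comp hm

lemma lintegral_exp_neg_mul_dotProduct {b : ℝ} (hb : 0 < b) :
    ∫⁻ y : Fin k → ℝ, ENNReal.ofReal (Real.exp (-b * (y ⬝ᵥ y)))
      = ENNReal.ofReal ((Real.pi / b) ^ ((k : ℝ) / 2)) := by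
  have h1 : (fun y : Fin k → ℝ => Real.exp (-b * (y ⬝ᵥ y)))
      = fun y => ∏ i, Real.exp (-b * (y i) ^ 2) := by
    funext y
    rw [← Real.exp_sum, ← Finset.mul_sum]
    simp [dotProduct, sq]
  have hint : Integrable (fun y : Fin k → ℝ => Real.exp (-b * (y ⬝ᵥ y))) := by
    rw [h1]
    exact Integrable.fintype_prod (f := fun _ (x : ℝ) => Real.exp (-b * x ^ 2))
      fun _ => integrable_exp_neg_mul_sq hb
  rw [← ofReal_integral_eq_lintegral_ofReal hint (ae_of_all _ fun _ => (Real.exp_pos _).le), h1,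
    integral_fintype_prod_volume_eq_pow (fun x : ℝ => Real.exp (-b * x ^ 2)), integral_gaussian,
    Real.sqrt_eq_rpow, ← Real.rpow_natCast, ← Real.rpow_mul (by positivity)]
  congr 2
  simp; ring

lemma mahalanobisSq_std (ν : ℝ) (y : Fin k → ℝ) : mahalanobisSq ⟨0, 1, ν⟩ y = y ⬝ᵥ y := by
  simp [mahalanobisSq]

lemma setLIntegral_gammaPDF_Ioi {a r : ℝ} (ha : 0 < a) (hr : 0 < r) :
    ∫⁻ x in Set.Ioi (0 : ℝ), gammaPDF a r x = 1 := by
  have h := lintegral_add_compl (μ := volume) (gammaPDF a r) (measurableSet_Ici (a := (0 : ℝ)))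
  rw [lintegral_gammaPDF_eq_one ha hr, Set.compl_Ici, lintegral_gammaPDF_of_nonpos le_rfl,
    add_zero] at h
  rw [setLIntegral_congr Ioi_ae_eq_Ici, h]

/-- The Student law is a Gamma mixture of normal laws. The power of 1 + |y|²/ν is written through
the total mass of a Gamma density with that rate; after Tonelli the inner integral is Gaussian and
what remains is the Gamma(ν/2, 1) density. -/
lemma lintegral_density_std {ν : ℝ} (hν : 0 < ν) :
    ∫⁻ y : Fin k → ℝ, ENNReal.ofReal (density ⟨0, 1, ν⟩ y) = 1 := by
  set a : ℝ := (ν + k) / 2 with ha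
  have ha0 : 0 < a := by positivity
  have hG := Real.Gamma_pos_of_pos ha0
  have hG2 := Real.Gamma_pos_of_pos (show 0 < ν / 2 by positivity)
  have hN := normConst_pos k hν
  have hq : ∀ y : Fin k → ℝ, 0 ≤ y ⬝ᵥ y := fun y => by
    simpa using dotProduct_star_self_nonneg y
  have h1 : ∀ y : Fin k → ℝ, ENNReal.ofReal (density ⟨0, 1, ν⟩ y)
      = ∫⁻ x in Set.Ioi (0 : ℝ), ENNReal.ofReal (normConst k ν / Real.Gamma a * x ^ (a - 1) *
          Real.exp (-x)) * ENNReal.ofReal (Real.exp (-(x / ν) * (y ⬝ᵥ y))) := by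
    intro y
    have hr : 0 < 1 + (y ⬝ᵥ y) / ν := by have := hq y; positivity
    have h2 := setLIntegral_gammaPDF_Ioi ha0 hr
    rw [← mul_one (ENNReal.ofReal _), ← h2, ← lintegral_const_mul' _ _ ENNReal.ofReal_ne_top]
    refine setLIntegral_congr_fun measurableSet_Ioi fun x hx => ?_
    have hx' : (0 : ℝ) < x := hx
    simp only [gammaPDF, gammaPDFReal, if_pos hx'.le]
    rw [← ENNReal.ofReal_mul (density_pos Matrix.PosDef.one hν y).le,
      ← ENNReal.ofReal_mul (by positivity)]
    congr 1
    rw [density, mahalanobisSq_std]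
    simp only [Matrix.det_one, Real.one_rpow, mul_one, ← ha]
    rw [Real.rpow_neg hr.le,
      show -((1 + y ⬝ᵥ y / ν) * x) = -x + -(x / ν) * (y ⬝ᵥ y) by ring, Real.exp_add]
    have : (1 + y ⬝ᵥ y / ν) ^ a ≠ 0 := (Real.rpow_pos_of_pos hr a).ne'
    generalize (1 + y ⬝ᵥ y / ν) ^ a = z at this ⊢
    field_simp
  simp_rw [h1]
  rw [lintegral_lintegral_swap]
  · have h4 : ∀ x ∈ Set.Ioi (0 : ℝ), ∫⁻ y : Fin k → ℝ,
        ENNReal.ofReal (normConst k ν / Real.Gamma a * x ^ (a - 1) *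
          Real.exp (-x)) * ENNReal.ofReal (Real.exp (-(x / ν) * (y ⬝ᵥ y)))
        = gammaPDF (ν / 2) 1 x := by
      intro x hx
      have hx' : (0 : ℝ) < x := hx
      rw [lintegral_const_mul' _ _ ENNReal.ofReal_ne_top,
        lintegral_exp_neg_mul_dotProduct (by positivity), ← ENNReal.ofReal_mul (by positivity),
        gammaPDF, gammaPDFReal, if_pos hx'.le]
      congr 1
      rw [show Real.pi / (x / ν) = (Real.pi * ν) / x by field_simp,
        Real.div_rpow (by positivity) hx'.le, normConst, ← ha,
        show a - 1 = (ν / 2 - 1) + (k : ℝ) / 2 by rw [ha]; ring, Real.rpow_add hx']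
      have h5 : x ^ ((k : ℝ) / 2) ≠ 0 := (Real.rpow_pos_of_pos hx' _).ne'
      have h6 : (Real.pi * ν) ^ ((k : ℝ) / 2) ≠ 0 :=
        (Real.rpow_pos_of_pos (by positivity) _).ne'
      simp only [Real.one_rpow, one_mul]
      field_simp
    rw [setLIntegral_congr_fun measurableSet_Ioi h4,
      setLIntegral_gammaPDF_Ioi (show 0 < ν / 2 by positivity) one_pos]
  · refine Measurable.aemeasurable ?_
    simp only [Function.uncurry_def, dotProduct]
    fun_prop

lemma push_std {A S : Matrix (Fin k) (Fin k) ℝ} (hAS : A * Aᵀ = S) (b : Fin k → ℝ) (ν : ℝ) :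
    push A b ⟨0, 1, ν⟩ = ⟨b, S, ν⟩ := by
  simp [push, hAS]

lemma isProbabilityMeasure_law {θ : StudentParam k} (hS : θ.scatter.PosDef) (hν : 0 < θ.tail) :
    IsProbabilityMeasure (law θ) := by
  have h0 : IsProbabilityMeasure (law (⟨0, 1, θ.tail⟩ : StudentParam k)) :=
    ⟨by rw [law, withDensity_apply _ MeasurableSet.univ, Measure.restrict_univ,
      lintegral_density_std hν]⟩
  obtain ⟨A, hA, hAS⟩ := exists_mul_transpose_eq hS
  have : law θ = _ := law_push hA θ.loc (θ := ⟨0, 1, θ.tail⟩) Matrix.PosDef.one ▸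
    congrArg law (push_std hAS θ.loc θ.tail).symm
  rw [this]
  exact Measure.isProbabilityMeasure_map (by fun_prop)

/-! ### Second-order bounds near the standard parameter -/

/-- First-order Taylor expansion with quadratic remainder. -/
lemma exists_taylor_one_bound {E : Type*} [NormedAddCommGroup E] [NormedSpace ℝ E] {f : E → ℝ}
    {x : E} (hf : ContDiffAt ℝ 2 f x) :
    ∃ C δ : ℝ, 0 ≤ C ∧ 0 < δ ∧ ∀ h, ‖h‖ ≤ δ → |f (x + h) - f x - fderiv ℝ f x h| ≤ C * ‖h‖ ^ 2 := by
  obtain ⟨K, t, ht, hK⟩ :=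
    (hf.fderiv_right (m := 1) (by norm_num)).exists_lipschitzOnWith
  have hd : ∀ᶠ y in 𝓝 x, DifferentiableAt ℝ f y :=
    (hf.eventually (by simp)).mono fun y hy => hy.differentiableAt (by simp)
  obtain ⟨δ, hδ, hball⟩ := Metric.nhds_basis_closedBall.mem_iff.mp (inter_mem ht hd)
  refine ⟨K, δ, K.2, hδ, fun h hh => ?_⟩
  have hsub : Metric.closedBall x ‖h‖ ⊆ Metric.closedBall x δ := Metric.closedBall_subset_closedBall hh
  have hx : x ∈ Metric.closedBall x ‖h‖ := Metric.mem_closedBall_self (norm_nonneg _)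
  have hxh : x + h ∈ Metric.closedBall x ‖h‖ := by simp
  have := (convex_closedBall x ‖h‖).norm_image_sub_le_of_norm_hasFDerivWithin_le' (𝕜 := ℝ)
    (f := f) (f' := fderiv ℝ f) (φ := fderiv ℝ f x) (C := K * ‖h‖)
    (fun y hy => (hball (hsub hy)).2.hasFDerivAt.hasFDerivWithinAt)
    (fun y hy => ?_) hx hxh
  · simpa [sq, mul_assoc] using this
  · refine (hK.norm_sub_le (hball (hsub hy)).1 (hball (hsub hx)).1).trans ?_
    gcongr
    simpa [dist_eq_norm] using hy

/-- The complex Gamma function is holomorphic on the right half-plane, and smoothness restricts to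
the real axis. -/
lemma contDiffAt_gamma {x : ℝ} (hx : 0 < x) : ContDiffAt ℝ 2 Real.Gamma x := by
  have h1 : AnalyticAt ℂ Complex.Gamma (x : ℂ) := by
    refine DifferentiableOn.analyticAt (s := {z : ℂ | 0 < z.re}) (fun z hz => ?_) ?_
    · refine (Complex.differentiableAt_Gamma z fun m h => ?_).differentiableWithinAt
      rw [h] at hz
      simp at hz
      linarith [(Nat.cast_nonneg m : (0 : ℝ) ≤ m)]
    · exact (isOpen_lt continuous_const Complex.continuous_re).mem_nhds (by simpa using hx)
  exact (h1.contDiffAt (n := 2)).real_of_complex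

lemma contDiffAt_log_normConst (k : ℕ) {ν : ℝ} (hν : 0 < ν) :
    ContDiffAt ℝ 2 (fun v => Real.log (normConst k v)) ν := by
  have h0 := normConst_pos k hν
  refine ContDiffAt.log ?_ h0.ne'
  unfold normConst
  have h1 := Real.Gamma_pos_of_pos (show 0 < ν / 2 by positivity)
  have hp : 0 < (Real.pi * ν) ^ ((k : ℝ) / 2) := Real.rpow_pos_of_pos (by positivity) _
  refine ContDiffAt.div ?_ (ContDiffAt.mul ?_ ?_) (by positivity)
  · exact (contDiffAt_gamma (show 0 < (ν + k) / 2 by positivity)).comp ν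
      (f := fun v : ℝ => (v + k) / 2) (by fun_prop)
  · exact ContDiffAt.rpow_const_of_ne (by fun_prop) (by positivity)
  · exact (contDiffAt_gamma (show 0 < ν / 2 by positivity)).comp ν
      (f := fun v : ℝ => v / 2) (by fun_prop)

lemma exists_log_normConst_bound (k : ℕ) {ν : ℝ} (hν : 0 < ν) :
    ∃ C δ : ℝ, 0 ≤ C ∧ 0 < δ ∧ ∀ t, |t| ≤ δ → |Real.log (normConst k (ν + t))
      - Real.log (normConst k ν) - t * deriv (fun v => Real.log (normConst k v)) ν|
      ≤ C * |t| ^ 2 := by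
  obtain ⟨C, δ, hC, hδ, h⟩ := exists_taylor_one_bound (contDiffAt_log_normConst k hν)
  refine ⟨C, δ, hC, hδ, fun t ht => ?_⟩
  have := h t ht
  rwa [fderiv_eq_smul_deriv, smul_eq_mul] at this

lemma hasDerivAt_det_one_add_smul (T : Matrix (Fin k) (Fin k) ℝ) :
    HasDerivAt (fun r : ℝ => (1 + r • T).det) T.trace 0 := by
  set p : Polynomial ℝ := (1 + (Polynomial.X : Polynomial ℝ) • T.map Polynomial.C).det.divX.divX
  have h : (fun r : ℝ => (1 + r • T).det)
      = fun r => 1 + T.trace * r + p.eval r * r ^ 2 := funext fun r => det_one_add_smul r T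
  rw [h]
  have h1 := (((hasDerivAt_id (0 : ℝ)).const_mul T.trace).const_add 1).add
    ((p.hasDerivAt 0).mul ((hasDerivAt_id (0 : ℝ)).pow 2))
  exact h1.congr_deriv (by simp)

lemma exists_log_det_bound (k : ℕ) :
    ∃ C δ : ℝ, 0 ≤ C ∧ 0 < δ ∧ ∀ (T : Matrix (Fin k) (Fin k) ℝ) (d : ℝ), d ≤ δ →
      0 ≤ d → (∀ i j, |T i j| ≤ d) → |Real.log (1 + T).det - T.trace| ≤ C * d ^ 2 := by
  set f : (Fin k → Fin k → ℝ) → ℝ := fun T => (1 + Matrix.of T).det with hf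
  have hf2 : ContDiff ℝ 2 f := by
    simp only [hf, Matrix.det_apply]
    refine ContDiff.sum fun σ _ => ContDiff.const_smul _ ?_
    refine contDiff_prod fun i _ => ?_
    simp only [Matrix.add_apply, Matrix.of_apply]
    fun_prop
  have hf0 : f 0 = 1 := by
    have : (Matrix.of (0 : Fin k → Fin k → ℝ)) = 0 := rfl
    simp [hf, this]
  -- Differentiability is clear for a polynomial, so the differential can be read off along the rays
  -- r ↦ r • T.
  have hfd : ∀ T : Fin k → Fin k → ℝ, fderiv ℝ f 0 T = (Matrix.of T).trace := by
    intro T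
    have h1 : HasDerivAt (fun r : ℝ => f (r • T)) (fderiv ℝ f 0 T) 0 := by
      have h2 : HasFDerivAt f (fderiv ℝ f 0) ((0 : ℝ) • T) := by
        rw [zero_smul]
        exact (hf2.differentiable (by simp)).differentiableAt.hasFDerivAt
      have h3 : HasDerivAt (fun r : ℝ => r • T) T 0 := by
        simpa using (hasDerivAt_id (0 : ℝ)).smul_const T
      exact h2.comp_hasDerivAt (0 : ℝ) h3
    exact h1.unique (hasDerivAt_det_one_add_smul (Matrix.of T))
  obtain ⟨C, δ, hC, hδ, h⟩ := exists_taylor_one_bound (f := fun T => Real.log (f T))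
    (x := 0) (hf2.contDiffAt.log (by rw [hf0]; norm_num))
  refine ⟨C, δ, hC, hδ, fun T d hd hd0 hT => ?_⟩
  set T' : Fin k → Fin k → ℝ := fun i j => T i j with hT'
  have hn : ‖T'‖ ≤ d := by
    refine (pi_norm_le_iff_of_nonneg hd0).mpr fun i => (pi_norm_le_iff_of_nonneg hd0).mpr fun j => ?_
    exact hT i j
  have h4 := h T' (hn.trans hd)
  rw [fderiv.log (hf2.differentiable (by simp)).differentiableAt (by rw [hf0]; norm_num), hf0] at h4
  simp only [zero_add, Real.log_one, sub_zero, inv_one, one_smul] at h4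
  rw [hfd] at h4
  refine h4.trans ?_
  gcongr

/-- A crude entrywise estimate in which k² counts the terms. With the identity matrix in the middle
it also serves for dot products. -/
lemma abs_bilin_le {a b : Fin k → ℝ} {M : Matrix (Fin k) (Fin k) ℝ} {α β γ : ℝ}
    (hα : 0 ≤ α) (hβ : 0 ≤ β)
    (ha : ∀ i, |a i| ≤ α) (hM : ∀ i j, |M i j| ≤ β) (hb : ∀ j, |b j| ≤ γ) :
    |a ⬝ᵥ M *ᵥ b| ≤ k ^ 2 * (α * β * γ) := by
  simp only [dotProduct, mulVec]
  refine (Finset.abs_sum_le_sum_abs _ _).trans ?_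
  calc ∑ i, |a i * ∑ j, M i j * b j| ≤ ∑ i : Fin k, ∑ j : Fin k, α * β * γ := by
        refine Finset.sum_le_sum fun i _ => ?_
        rw [abs_mul]
        calc |a i| * |∑ j, M i j * b j| ≤ α * ∑ j : Fin k, β * γ := by
              refine mul_le_mul (ha i) ?_ (abs_nonneg _) hα
              refine (Finset.abs_sum_le_sum_abs _ _).trans (Finset.sum_le_sum fun j _ => ?_)
              rw [abs_mul]
              exact mul_le_mul (hM i j) (hb j) (abs_nonneg _) hβ
          _ = _ := by rw [Finset.mul_sum]; simp only [mul_assoc]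
    _ = _ := by simp; ring

lemma dotProduct_self_nonneg' (y : Fin k → ℝ) : 0 ≤ y ⬝ᵥ y := by
  simpa using dotProduct_star_self_nonneg y

lemma sq_le_dotProduct_self (y : Fin k → ℝ) (i : Fin k) : y i ^ 2 ≤ y ⬝ᵥ y := by
  rw [dotProduct, sq]
  exact Finset.single_le_sum (f := fun j => y j * y j) (fun j _ => mul_self_nonneg _)
    (Finset.mem_univ i)

lemma abs_le_sqrt_one_add (y : Fin k → ℝ) (i : Fin k) : |y i| ≤ √(1 + y ⬝ᵥ y) :=
  Real.abs_le_sqrt (by linarith [sq_le_dotProduct_self y i])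

lemma abs_quadForm_le {M : Matrix (Fin k) (Fin k) ℝ} {β : ℝ} (hβ : 0 ≤ β)
    (hM : ∀ i j, |M i j| ≤ β) (y : Fin k → ℝ) : |y ⬝ᵥ M *ᵥ y| ≤ k ^ 2 * β * (y ⬝ᵥ y) := by
  have h : ∀ i, |y i| ≤ √(y ⬝ᵥ y) := fun i => Real.abs_le_sqrt (sq_le_dotProduct_self y i)
  refine (abs_bilin_le (Real.sqrt_nonneg _) hβ h hM h).trans (le_of_eq ?_)
  have := Real.mul_self_sqrt (dotProduct_self_nonneg' y)
  linear_combination (k ^ 2 * β) * this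

lemma posDef_one_add {T : Matrix (Fin k) (Fin k) ℝ} (hT : T.IsSymm) {d : ℝ} (hd : 0 ≤ d)
    (hd1 : k ^ 2 * d ≤ 1 / 2) (hTd : ∀ i j, |T i j| ≤ d) : (1 + T).PosDef := by
  refine Matrix.PosDef.of_dotProduct_mulVec_pos ?_ fun {x} hx => ?_
  · rw [Matrix.IsHermitian, Matrix.conjTranspose_eq_transpose_of_trivial, Matrix.transpose_add,
      Matrix.transpose_one, hT.eq]
  · have h1 := abs_le.mp (abs_quadForm_le hd hTd x)
    have h2 : 0 < x ⬝ᵥ x := by simpa using dotProduct_star_self_pos_iff.mpr hx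
    simp only [star_trivial, Matrix.add_mulVec, Matrix.one_mulVec, dotProduct_add]
    nlinarith

/-- The remainder of the Neumann series is (1 + T)⁻¹ T T, and continuity of inversion at 1 bounds
the entries of (1 + T)⁻¹ by 2 for small T. -/
lemma exists_inv_one_add_bound (k : ℕ) :
    ∃ C δ : ℝ, 0 ≤ C ∧ 0 < δ ∧ ∀ (T : Matrix (Fin k) (Fin k) ℝ) (d : ℝ), d ≤ δ →
      0 ≤ d → (∀ i j, |T i j| ≤ d) → ∀ i j, |((1 + T)⁻¹ - 1 + T) i j| ≤ C * d ^ 2 := by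
  have hcont : ∀ i j, ContinuousAt (fun T : Fin k → Fin k → ℝ => (1 + Matrix.of T)⁻¹ i j) 0 := by
    intro i j
    have h0 : (1 + Matrix.of (0 : Fin k → Fin k → ℝ)).det ≠ 0 := by
      have : (Matrix.of (0 : Fin k → Fin k → ℝ)) = 0 := rfl
      simp [this]
    have hc : Continuous fun T : Fin k → Fin k → ℝ => (1 + Matrix.of T) :=
      continuous_const.add continuous_id
    simp only [Matrix.inv_def, Ring.inverse_eq_inv, Matrix.smul_apply, smul_eq_mul]
    exact (hc.matrix_det.continuousAt.inv₀ h0).mul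
      (hc.matrix_adjugate.matrix_elem i j).continuousAt
  have hdet : ∀ᶠ T : Fin k → Fin k → ℝ in 𝓝 0, (1 + Matrix.of T).det ≠ 0 := by
    have hc : Continuous fun T : Fin k → Fin k → ℝ => (1 + Matrix.of T).det :=
      (continuous_const.add continuous_id).matrix_det
    refine hc.continuousAt.eventually_ne ?_
    have : (Matrix.of (0 : Fin k → Fin k → ℝ)) = 0 := rfl
    simp [this]
  have hb : ∀ᶠ T : Fin k → Fin k → ℝ in 𝓝 0, ∀ i j, |(1 + Matrix.of T)⁻¹ i j| ≤ 2 := by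
    rw [eventually_all]; intro i; rw [eventually_all]; intro j
    have h1 := (hcont i j).abs.eventually_lt (continuousAt_const (y := (2 : ℝ))) ?_
    · exact h1.mono fun T hT => hT.le
    · have : (Matrix.of (0 : Fin k → Fin k → ℝ)) = 0 := rfl
      simp only [this, add_zero, inv_one, Matrix.one_apply]
      split_ifs <;> norm_num
  obtain ⟨δ, hδ, hball⟩ := Metric.nhds_basis_closedBall.mem_iff.mp (inter_mem hdet hb)
  refine ⟨k ^ 2 * 2, δ, by positivity, hδ, fun T d hd hd0 hT i j => ?_⟩
  set T' : Fin k → Fin k → ℝ := fun i j => T i j with hT'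
  have hn : T' ∈ Metric.closedBall (0 : Fin k → Fin k → ℝ) δ := by
    rw [mem_closedBall_zero_iff]
    exact (pi_norm_le_iff_of_nonneg hδ.le).mpr fun i =>
      (pi_norm_le_iff_of_nonneg hδ.le).mpr fun j => (hT i j).trans hd
  obtain ⟨h1, h2⟩ := hball hn
  have h1' : IsUnit (1 + T).det := isUnit_iff_ne_zero.mpr h1
  have h3 : (1 + T)⁻¹ - 1 + T = (1 + T)⁻¹ * T * T := by
    have : (1 + T)⁻¹ * (1 + T) = 1 := Matrix.nonsing_inv_mul _ h1'
    have h4 : (1 + T)⁻¹ * T = 1 - (1 + T)⁻¹ := by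
      rw [eq_sub_iff_add_eq, add_comm]; rwa [mul_add, mul_one] at this
    rw [h4, sub_mul, one_mul, h4]; abel
  have h5 : ((1 + T)⁻¹ * T * T) i j
      = (fun l => (1 + T)⁻¹ i l) ⬝ᵥ T *ᵥ (fun l => T l j) := by
    rw [Matrix.mul_assoc]; rfl
  rw [h3, h5]
  refine (abs_bilin_le zero_le_two hd0 (h2 i) hT (fun l => hT l j)).trans (le_of_eq ?_)
  ring

/-! ### Expansion of the log-density at the standard parameter -/

/-- Displacements `(m, T, t)` of `(0, 1, ν)` bounded by `d` in the maximum norm. -/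
structure IsSmall (d : ℝ) (m : Fin k → ℝ) (T : Matrix (Fin k) (Fin k) ℝ) (t : ℝ) : Prop where
  nonneg : 0 ≤ d
  loc : ∀ i, |m i| ≤ d
  scatter : ∀ i j, |T i j| ≤ d
  symm : T.IsSymm
  tail : |t| ≤ d

/-- The linear part of `(ν + t + q) / (ν + |y|²) - 1`, where `q` is the squared Mahalanobis norm
for the displaced parameter. -/
def linRatio (ν : ℝ) (m : Fin k → ℝ) (T : Matrix (Fin k) (Fin k) ℝ) (t : ℝ) (y : Fin k → ℝ) : ℝ :=
  (t - y ⬝ᵥ T *ᵥ y - 2 * (m ⬝ᵥ y)) / (ν + y ⬝ᵥ y)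

/-- The score for tail weight as a function of the squared Mahalanobis norm. -/
def tailScore (k : ℕ) (ν r : ℝ) : ℝ :=
  deriv (fun v => Real.log (normConst k v)) ν - Real.log (1 + r / ν) / 2
    + (ν + k) / 2 * (r / (ν * (ν + r)))

/-- The score at the standard parameter in the direction `(m, T, t)`. -/
def linScore (ν : ℝ) (m : Fin k → ℝ) (T : Matrix (Fin k) (Fin k) ℝ) (t : ℝ) (y : Fin k → ℝ) : ℝ :=
  t * tailScore k ν (y ⬝ᵥ y)
    + (-(T.trace) / 2 + (ν + k) / 2 * ((y ⬝ᵥ T *ᵥ y) / (ν + y ⬝ᵥ y)))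
    + (ν + k) * ((m ⬝ᵥ y) / (ν + y ⬝ᵥ y))

lemma one_add_le_mul {ν r : ℝ} (hν : 0 < ν) (hr : 0 ≤ r) : 1 + r ≤ (1 + ν⁻¹) * (ν + r) := by
  have : (1 + ν⁻¹) * (ν + r) = 1 + r + ν + ν⁻¹ * r := by field_simp; ring
  rw [this]
  have : 0 ≤ ν⁻¹ * r := by positivity
  linarith

set_option maxHeartbeats 1000000 in
-- The displaced quadratic form grows no faster than 1 + |y|², and division by ν + |y|² absorbs this
-- growth. That is why both estimates are uniform in y.
lemma exists_ratio_bound (k : ℕ) {ν : ℝ} (hν : 0 < ν) :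
    ∃ C δ : ℝ, 0 ≤ C ∧ 0 < δ ∧ ∀ (m : Fin k → ℝ) (T : Matrix (Fin k) (Fin k) ℝ) (t d : ℝ),
      d ≤ δ → IsSmall d m T t → ∀ y : Fin k → ℝ,
      |(ν + t + mahalanobisSq ⟨m, 1 + T, ν + t⟩ y) / (ν + y ⬝ᵥ y) - 1 - linRatio ν m T t y|
        ≤ C * d ^ 2 ∧ |linRatio ν m T t y| ≤ C * d := by
  obtain ⟨C₁, δ₁, hC₁, hδ₁, hinv⟩ := exists_inv_one_add_bound k
  set K : ℝ := (k : ℝ) ^ 2 with hK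
  have hK0 : 0 ≤ K := by positivity
  refine ⟨(K * (4 + 4 * C₁) + (1 + 3 * K)) * (1 + ν⁻¹), min δ₁ 1, by positivity,
    lt_min hδ₁ one_pos, fun m T t d hd hs y => ?_⟩
  have hd0 := hs.nonneg
  have hd1 : d ≤ 1 := hd.trans (min_le_right _ _)
  have hdd : d ^ 2 ≤ d := by nlinarith
  have hR := hinv T d (hd.trans (min_le_left _ _)) hd0 hs.scatter
  set P := (1 + T)⁻¹ with hP
  set R := P - 1 + T with hRdef
  have hr0 := dotProduct_self_nonneg' y
  -- Since s ≥ 1 bounds every coordinate of y, terms of degree 0, 1 and 2 in y are all controlled by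
  -- s².
  set s := √(1 + y ⬝ᵥ y) with hsdef
  have hs2 : s ^ 2 = 1 + y ⬝ᵥ y := Real.sq_sqrt (by positivity)
  have hs1 : 1 ≤ s := by rw [hsdef]; exact Real.one_le_sqrt.mpr (by linarith)
  have hys : ∀ i, |y i| ≤ s := abs_le_sqrt_one_add y
  have hN : 0 < ν + y ⬝ᵥ y := by positivity
  have hsN : s ^ 2 ≤ (1 + ν⁻¹) * (ν + y ⬝ᵥ y) := hs2 ▸ one_add_le_mul hν hr0
  have h1le : ∀ i j, |(1 : Matrix (Fin k) (Fin k) ℝ) i j| ≤ 1 := by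
    intro i j; rw [Matrix.one_apply]; split_ifs <;> norm_num
  have hP1 : ∀ i j, |(P - 1) i j| ≤ (1 + C₁) * d := by
    intro i j
    have : (P - 1) i j = R i j - T i j := by simp [hRdef]
    rw [this]
    refine (abs_sub _ _).trans ?_
    have h1 := hR i j
    have h2 := hs.scatter i j
    have h3 := mul_le_mul_of_nonneg_left hdd hC₁
    linarith
  have hP2 : ∀ i j, |P i j| ≤ 2 + C₁ := by
    intro i j
    have : P i j = (P - 1) i j + (1 : Matrix (Fin k) (Fin k) ℝ) i j := by simp
    rw [this]
    refine (abs_add_le _ _).trans ?_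
    have h1 := hP1 i j
    have h2 := h1le i j
    have h3 := mul_le_mul_of_nonneg_left hd1 (show 0 ≤ 1 + C₁ by positivity)
    linarith
  have hC1d : 0 ≤ C₁ * d ^ 2 := by positivity
  have b1 := abs_le.mp (abs_bilin_le (zero_le_one.trans hs1) hC1d hys hR hys)
  have hP1' : 0 ≤ (1 + C₁) * d := by positivity
  have b2 := abs_le.mp (abs_bilin_le hd0 hP1' hs.loc hP1 hys)
  have b3 := abs_le.mp (abs_bilin_le (zero_le_one.trans hs1) hP1' hys hP1 hs.loc)
  have b4 := abs_le.mp (abs_bilin_le hd0 (by positivity) hs.loc hP2 hs.loc)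
  have b5 := abs_le.mp (abs_bilin_le (zero_le_one.trans hs1) hd0 hys hs.scatter hys)
  have b6 := abs_le.mp (abs_bilin_le hd0 zero_le_one hs.loc h1le hys)
  rw [Matrix.one_mulVec] at b6
  have htl := abs_le.mp hs.tail
  have key : ν + t + mahalanobisSq ⟨m, 1 + T, ν + t⟩ y - (ν + y ⬝ᵥ y)
      - (t - y ⬝ᵥ T *ᵥ y - 2 * (m ⬝ᵥ y))
      = y ⬝ᵥ R *ᵥ y - m ⬝ᵥ (P - 1) *ᵥ y - y ⬝ᵥ (P - 1) *ᵥ m + m ⬝ᵥ P *ᵥ m := by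
    simp only [mahalanobisSq, hRdef, ← hP, Matrix.add_mulVec, Matrix.sub_mulVec,
      Matrix.one_mulVec, Matrix.mulVec_sub, dotProduct_sub, sub_dotProduct, dotProduct_add]
    rw [dotProduct_comm y m]
    ring
  have hss : s ≤ s ^ 2 := by nlinarith
  have h1s : 1 ≤ s ^ 2 := by nlinarith
  rw [← hK] at b1 b2 b3 b4 b5 b6
  have e1 : |ν + t + mahalanobisSq ⟨m, 1 + T, ν + t⟩ y - (ν + y ⬝ᵥ y)
      - (t - y ⬝ᵥ T *ᵥ y - 2 * (m ⬝ᵥ y))| ≤ K * (4 + 4 * C₁) * d ^ 2 * s ^ 2 := by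
    rw [key, abs_le]
    have c1 : K * (s * (C₁ * d ^ 2) * s) = K * C₁ * d ^ 2 * s ^ 2 := by ring
    have c2 : K * (d * ((1 + C₁) * d) * s) ≤ K * (1 + C₁) * d ^ 2 * s ^ 2 := by
      have := mul_le_mul_of_nonneg_left hss (show 0 ≤ K * (1 + C₁) * d ^ 2 by positivity)
      linarith
    have c3 : K * (s * ((1 + C₁) * d) * d) = K * (d * ((1 + C₁) * d) * s) := by ring
    have c4 : K * (d * (2 + C₁) * d) ≤ K * (2 + C₁) * d ^ 2 * s ^ 2 := by
      have := mul_le_mul_of_nonneg_left h1s (show 0 ≤ K * (2 + C₁) * d ^ 2 by positivity)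
      linarith
    have c5 : K * (4 + 4 * C₁) * d ^ 2 * s ^ 2 = K * C₁ * d ^ 2 * s ^ 2
      + 2 * (K * (1 + C₁) * d ^ 2 * s ^ 2) + K * (2 + C₁) * d ^ 2 * s ^ 2 := by ring
    constructor <;> linarith [b1.1, b1.2, b2.1, b2.2, b3.1, b3.2, b4.1, b4.2]
  have e2 : |t - y ⬝ᵥ T *ᵥ y - 2 * (m ⬝ᵥ y)| ≤ (1 + 3 * K) * d * s ^ 2 := by
    rw [abs_le]
    have c1 : K * (s * d * s) = K * d * s ^ 2 := by ring
    have c2 : K * (d * 1 * s) ≤ K * d * s ^ 2 := by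
      have := mul_le_mul_of_nonneg_left hss (show 0 ≤ K * d by positivity)
      linarith
    have c3 : d ≤ d * s ^ 2 := le_mul_of_one_le_right hd0 h1s
    have c4 : (1 + 3 * K) * d * s ^ 2 = d * s ^ 2 + 3 * (K * d * s ^ 2) := by ring
    constructor <;> linarith [b5.1, b5.2, b6.1, b6.2, htl.1, htl.2]
  have f1 : (ν + t + mahalanobisSq ⟨m, 1 + T, ν + t⟩ y) / (ν + y ⬝ᵥ y) - 1 - linRatio ν m T t y
      = (ν + t + mahalanobisSq ⟨m, 1 + T, ν + t⟩ y - (ν + y ⬝ᵥ y)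
      - (t - y ⬝ᵥ T *ᵥ y - 2 * (m ⬝ᵥ y))) / (ν + y ⬝ᵥ y) := by
    rw [linRatio]; field_simp
  have hν' : 0 < ν⁻¹ := by positivity
  constructor
  · rw [f1, abs_div, abs_of_pos hN, div_le_iff₀ hN]
    refine e1.trans ?_
    calc K * (4 + 4 * C₁) * d ^ 2 * s ^ 2
        ≤ K * (4 + 4 * C₁) * d ^ 2 * ((1 + ν⁻¹) * (ν + y ⬝ᵥ y)) := by gcongr
      _ ≤ (K * (4 + 4 * C₁) + (1 + 3 * K)) * d ^ 2 * ((1 + ν⁻¹) * (ν + y ⬝ᵥ y)) := by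
          gcongr; linarith
      _ = _ := by ring
  · rw [linRatio, abs_div, abs_of_pos hN, div_le_iff₀ hN]
    refine e2.trans ?_
    calc (1 + 3 * K) * d * s ^ 2
        ≤ (1 + 3 * K) * d * ((1 + ν⁻¹) * (ν + y ⬝ᵥ y)) := by gcongr
      _ ≤ (K * (4 + 4 * C₁) + (1 + 3 * K)) * d * ((1 + ν⁻¹) * (ν + y ⬝ᵥ y)) := by
          have : 0 ≤ K * (4 + 4 * C₁) := by positivity
          refine mul_le_mul_of_nonneg_right (mul_le_mul_of_nonneg_right ?_ hd0) (by positivity)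
          linarith
      _ = _ := by ring

lemma abs_log_sub_le {x : ℝ} (hx : |x - 1| ≤ 1 / 2) :
    |Real.log x - (x - 1)| ≤ 2 * (x - 1) ^ 2 := by
  have h := abs_le.mp hx
  have hx0 : 0 < x := by linarith
  have h1 := Real.log_le_sub_one_of_pos hx0
  have h2 := Real.one_sub_inv_le_log_of_pos hx0
  have h3 : 1 - x⁻¹ - (x - 1) = -((x - 1) ^ 2 * x⁻¹) := by field_simp; ring
  have h4 : x⁻¹ ≤ 2 := by rw [inv_le_comm₀ hx0 two_pos]; linarith
  have h5 : (x - 1) ^ 2 * x⁻¹ ≤ (x - 1) ^ 2 * 2 := by gcongr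
  rw [abs_le]
  constructor <;> nlinarith [sq_nonneg (x - 1)]

lemma log_density {θ : StudentParam k} (hS : θ.scatter.PosDef) (hν : 0 < θ.tail)
    (x : Fin k → ℝ) : Real.log (density θ x) = Real.log (normConst k θ.tail)
      - Real.log θ.scatter.det / 2
      - (θ.tail + k) / 2 * Real.log (1 + mahalanobisSq θ x / θ.tail) := by
  have h1 := normConst_pos k hν
  have h2 := hS.det_pos
  have h3 : 0 < 1 + mahalanobisSq θ x / θ.tail := by
    have := mahalanobisSq_nonneg hS x; positivity
  rw [density, Real.log_mul (by positivity) (by positivity),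
    Real.log_mul h1.ne' (by positivity), Real.log_rpow h2, Real.log_rpow h3]
  ring

/-- The log-likelihood ratio of a displaced parameter against the standard one. -/
def logRatio (ν : ℝ) (m : Fin k → ℝ) (T : Matrix (Fin k) (Fin k) ℝ) (t : ℝ) (y : Fin k → ℝ) : ℝ :=
  Real.log (density ⟨m, 1 + T, ν + t⟩ y) - Real.log (density ⟨0, 1, ν⟩ y)

set_option maxHeartbeats 1000000 in
-- With ρ = (ν + t + q)/(ν + |y|²), one has log(1 + q/(ν + t)) = log ρ + log(1 + |y|²/ν) - log((ν +
-- t)/ν). The unbounded middle term contributes exactly -(t/2) log(1 + |y|²/ν), which is part of the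
-- tail score. Everything else is a smooth function of quantities within O(d) of their base values,
-- so the error carries no weight in y.
theorem exists_logRatio_bound (k : ℕ) {ν : ℝ} (hν : 0 < ν) :
    ∃ C δ : ℝ, 0 ≤ C ∧ 0 < δ ∧ ∀ (m : Fin k → ℝ) (T : Matrix (Fin k) (Fin k) ℝ) (t d : ℝ),
      d ≤ δ → IsSmall d m T t → (1 + T).PosDef ∧ 0 < ν + t ∧
      ∀ y : Fin k → ℝ, |logRatio ν m T t y - linScore ν m T t y| ≤ C * d ^ 2 ∧
        |(ν + t + mahalanobisSq ⟨m, 1 + T, ν + t⟩ y) / (ν + y ⬝ᵥ y) - 1| ≤ C * d := by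
  obtain ⟨C₁, δ₁, hC₁, hδ₁, hrat⟩ := exists_ratio_bound k hν
  obtain ⟨C₂, δ₂, hC₂, hδ₂, hdet⟩ := exists_log_det_bound k
  obtain ⟨C₃, δ₃, hC₃, hδ₃, hnc⟩ := exists_log_normConst_bound k hν
  -- The radius `δ₄` keeps 1 + T positive definite and `δ₅` gives |ρ - 1| ≤ 1/2. The bound ν/2 in
  -- the final radius plays the same role for (ν + t)/ν.
  set δ₄ : ℝ := 1 / (2 * ((k : ℝ) ^ 2 + 1)) with hδ₄
  set δ₅ : ℝ := 1 / (2 * (2 * C₁ + 1)) with hδ₅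
  have h4 : 0 < δ₄ := by positivity
  have h5 : 0 < δ₅ := by positivity
  set B : ℝ := C₃ + C₂ / 2 + (ν + k) / 2 * (C₁ + 8 * C₁ ^ 2 + 2 * ν⁻¹ ^ 2)
    + 1 / 2 * (2 * C₁ + 8 * C₁ ^ 2 + ν⁻¹ + 2 * ν⁻¹ ^ 2) with hB
  refine ⟨B + 2 * C₁, min (min δ₁ δ₂) (min (min δ₃ δ₄) (min (min δ₅ 1) (ν / 2))), by positivity,
    by positivity, fun m T t d hd hs => ?_⟩
  simp only [le_min_iff] at hd
  obtain ⟨⟨hd1, hd2⟩, ⟨hd3, hd4⟩, ⟨hd5, hd6⟩, hd7⟩ := hd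
  have hd0 := hs.nonneg
  have hdd : d ^ 2 ≤ d := by nlinarith
  have htl := abs_le.mp hs.tail
  have hPD : (1 + T).PosDef := by
    refine posDef_one_add hs.symm hd0 ?_ hs.scatter
    rw [hδ₄, le_div_iff₀ (by positivity)] at hd4
    nlinarith
  have hνt : 0 < ν + t := by linarith
  refine ⟨hPD, hνt, fun y => ?_⟩
  obtain ⟨r1, r2⟩ := hrat m T t d hd1 hs y
  have hdetb := hdet T d hd2 hd0 hs.scatter
  have hncb := hnc t (hs.tail.trans hd3)
  have ht2 : |t| ^ 2 ≤ d ^ 2 := by gcongr; exact hs.tail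
  have hr0 := dotProduct_self_nonneg' y
  have hN : 0 < ν + y ⬝ᵥ y := by positivity
  have hq := mahalanobisSq_nonneg (θ := ⟨m, 1 + T, ν + t⟩) hPD y
  set q := mahalanobisSq ⟨m, 1 + T, ν + t⟩ y with hqdef
  have hq' : 0 < ν + t + q := by linarith
  set ρ := (ν + t + q) / (ν + y ⬝ᵥ y) with hρ
  set e := linRatio ν m T t y with he
  have hC1d : C₁ * d ^ 2 ≤ C₁ * d := by gcongr
  have hρ1 : |ρ - 1| ≤ 2 * C₁ * d := by
    have : ρ - 1 = (ρ - 1 - e) + e := by ring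
    rw [this]
    exact (abs_add_le _ _).trans (by linarith)
  have hρ2 : |ρ - 1| ≤ 1 / 2 := by
    refine hρ1.trans ?_
    rw [hδ₅, le_div_iff₀ (by positivity)] at hd5
    nlinarith
  have hsqρ : (ρ - 1) ^ 2 ≤ 4 * C₁ ^ 2 * d ^ 2 := by
    have : (ρ - 1) ^ 2 ≤ (2 * C₁ * d) ^ 2 := by rw [← sq_abs]; gcongr
    linarith [this, show (2 * C₁ * d) ^ 2 = 4 * C₁ ^ 2 * d ^ 2 by ring]
  have l1 := abs_log_sub_le hρ2
  have hv : (ν + t) / ν - 1 = ν⁻¹ * t := by field_simp; ring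
  have hv1 : |(ν + t) / ν - 1| ≤ ν⁻¹ * d := by
    rw [hv, abs_mul, abs_of_pos (by positivity)]
    gcongr; exact hs.tail
  have hv2 : |(ν + t) / ν - 1| ≤ 1 / 2 := by
    refine hv1.trans ?_
    rw [inv_mul_le_iff₀ hν]; linarith
  have hsqv : ((ν + t) / ν - 1) ^ 2 ≤ ν⁻¹ ^ 2 * d ^ 2 := by
    have : ((ν + t) / ν - 1) ^ 2 ≤ (ν⁻¹ * d) ^ 2 := by rw [← sq_abs]; gcongr
    linarith [this, show (ν⁻¹ * d) ^ 2 = ν⁻¹ ^ 2 * d ^ 2 by ring]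
  have l2 := abs_log_sub_le hv2
  have hlogρ : Real.log ρ = Real.log (ν + t + q) - Real.log (ν + y ⬝ᵥ y) :=
    Real.log_div hq'.ne' hN.ne'
  have hlogv : Real.log ((ν + t) / ν) = Real.log (ν + t) - Real.log ν :=
    Real.log_div hνt.ne' hν.ne'
  have hla : Real.log (1 + q / (ν + t)) = Real.log (ν + t + q) - Real.log (ν + t) := by
    rw [← Real.log_div hq'.ne' hνt.ne']; congr 1; field_simp
  have hlb : Real.log (1 + y ⬝ᵥ y / ν) = Real.log (ν + y ⬝ᵥ y) - Real.log ν := by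
    rw [← Real.log_div hN.ne' hν.ne']; congr 1; field_simp
  -- The unbounded logarithms have cancelled here: each bracket is a Taylor remainder or, in the
  -- last line, a first-order quantity multiplied by t.
  have hkey : logRatio ν m T t y - linScore ν m T t y
      = (Real.log (normConst k (ν + t)) - Real.log (normConst k ν)
          - t * deriv (fun v => Real.log (normConst k v)) ν)
        - (Real.log (1 + T).det - T.trace) / 2
        - (ν + k) / 2 * ((Real.log ρ - (ρ - 1)) + (ρ - 1 - e)
            - (Real.log ((ν + t) / ν) - ((ν + t) / ν - 1)))
        - t / 2 * ((Real.log ρ - (ρ - 1)) + (ρ - 1)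
            - (Real.log ((ν + t) / ν) - ((ν + t) / ν - 1)) - ((ν + t) / ν - 1)) := by
    rw [logRatio, log_density (θ := ⟨m, 1 + T, ν + t⟩) hPD hνt,
      log_density (θ := ⟨0, 1, ν⟩) Matrix.PosDef.one hν, mahalanobisSq_std]
    simp only [← hqdef, linScore, tailScore, Matrix.det_one, Real.log_one, hla, hlb]
    have hN1 : y ⬝ᵥ y / (ν * (ν + y ⬝ᵥ y)) = ν⁻¹ - (ν + y ⬝ᵥ y)⁻¹ := by
      rw [inv_sub_inv hν.ne' hN.ne']; congr 1; ring
    rw [hlogρ, hlogv, he, linRatio, hv, hN1]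
    ring
  constructor
  · rw [hkey]
    have a1 := abs_le.mp hncb
    have a2 := abs_le.mp hdetb
    have aX : |(Real.log ρ - (ρ - 1)) + (ρ - 1 - e)
        - (Real.log ((ν + t) / ν) - ((ν + t) / ν - 1))|
        ≤ (C₁ + 8 * C₁ ^ 2 + 2 * ν⁻¹ ^ 2) * d ^ 2 := by
      refine (abs_sub _ _).trans ((add_le_add (abs_add_le _ _) le_rfl).trans ?_)
      linarith
    have aY : |(Real.log ρ - (ρ - 1)) + (ρ - 1)
        - (Real.log ((ν + t) / ν) - ((ν + t) / ν - 1)) - ((ν + t) / ν - 1)|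
        ≤ (2 * C₁ + 8 * C₁ ^ 2 + ν⁻¹ + 2 * ν⁻¹ ^ 2) * d := by
      refine (abs_sub _ _).trans ((add_le_add (abs_sub _ _) le_rfl).trans ?_)
      refine (add_le_add (add_le_add (abs_add_le _ _) le_rfl) le_rfl).trans ?_
      have : C₁ ^ 2 * d ^ 2 ≤ C₁ ^ 2 * d := by gcongr
      have : ν⁻¹ ^ 2 * d ^ 2 ≤ ν⁻¹ ^ 2 * d := by gcongr
      linarith
    have aX' : |(ν + k) / 2 * ((Real.log ρ - (ρ - 1)) + (ρ - 1 - e)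
        - (Real.log ((ν + t) / ν) - ((ν + t) / ν - 1)))|
        ≤ (ν + k) / 2 * ((C₁ + 8 * C₁ ^ 2 + 2 * ν⁻¹ ^ 2) * d ^ 2) := by
      rw [abs_mul, abs_of_pos (by positivity : 0 < (ν + k) / 2)]
      gcongr
    have aY' : |t / 2 * ((Real.log ρ - (ρ - 1)) + (ρ - 1)
        - (Real.log ((ν + t) / ν) - ((ν + t) / ν - 1)) - ((ν + t) / ν - 1))|
        ≤ d / 2 * ((2 * C₁ + 8 * C₁ ^ 2 + ν⁻¹ + 2 * ν⁻¹ ^ 2) * d) := by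
      rw [abs_mul, abs_div, abs_two]
      gcongr
      exact hs.tail
    have b1 := abs_le.mp aX'
    have b2 := abs_le.mp aY'
    have hc : C₃ * |t| ^ 2 ≤ C₃ * d ^ 2 := by gcongr
    have hBd : (B + 2 * C₁) * d ^ 2 = C₃ * d ^ 2 + C₂ * d ^ 2 / 2
        + (ν + k) / 2 * ((C₁ + 8 * C₁ ^ 2 + 2 * ν⁻¹ ^ 2) * d ^ 2)
        + d / 2 * ((2 * C₁ + 8 * C₁ ^ 2 + ν⁻¹ + 2 * ν⁻¹ ^ 2) * d) + 2 * C₁ * d ^ 2 := by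
      rw [hB]; ring
    have : 0 ≤ C₁ * d ^ 2 := by positivity
    rw [hBd, abs_le]
    constructor <;> linarith [a1.1, a1.2, a2.1, a2.2, b1.1, b1.2, b2.1, b2.2]
  · refine hρ1.trans ?_
    have : 0 ≤ B := by rw [hB]; positivity
    gcongr
    linarith

/-! ### Change of measure, moments and symmetry of the standard Student law -/

lemma law_eq_withDensity {θ θ' : StudentParam k} (hS : θ.scatter.PosDef) (hν : 0 < θ.tail) :
    law θ' = (law θ).withDensity fun x => ENNReal.ofReal (density θ' x / density θ x) := by
  have hd := fun θ : StudentParam k => (measurable_density θ).ennreal_ofReal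
  have hm : Measurable fun x => ENNReal.ofReal (density θ' x / density θ x) :=
    ((measurable_density θ').div (measurable_density θ)).ennreal_ofReal
  rw [law, law, ← withDensity_mul _ (hd θ) hm]
  congr 1
  funext x
  have := density_pos hS hν x
  rw [Pi.mul_apply, ← ENNReal.ofReal_mul this.le, mul_div_cancel₀ _ this.ne']

lemma volume_absolutelyContinuous_law {θ : StudentParam k} (hS : θ.scatter.PosDef)
    (hν : 0 < θ.tail) : volume ≪ law θ :=
  withDensity_absolutelyContinuous' (measurable_density θ).ennreal_ofReal.aemeasurable
    (ae_of_all _ fun x => by simpa using density_pos hS hν x)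

/-- The density is positive everywhere, so null sets of the law are Lebesgue null and a continuous
function vanishing almost everywhere vanishes identically. All nondegeneracy claims about the
information rest on this. -/
lemma eq_zero_of_integral_sq_eq_zero {θ : StudentParam k} (hS : θ.scatter.PosDef)
    (hν : 0 < θ.tail) {f : (Fin k → ℝ) → ℝ} (hf : Continuous f)
    (hint : Integrable (fun x => f x ^ 2) (law θ)) (h0 : ∫ x, f x ^ 2 ∂(law θ) = 0) (x : Fin k → ℝ) :
    f x = 0 := by
  rw [integral_eq_zero_iff_of_nonneg (fun x => sq_nonneg _) hint] at h0
  have h1 := (volume_absolutelyContinuous_law hS hν).ae_le h0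
  have h2 := ((hf.pow 2).ae_eq_iff_eq volume (continuous_const (y := (0 : ℝ)))).mp h1
  exact pow_eq_zero_iff two_ne_zero |>.mp (congrFun h2 x)

/-- The standard Student law. -/
def stdLaw (k : ℕ) (ν : ℝ) : Measure (Fin k → ℝ) := law ⟨0, 1, ν⟩

lemma isProbabilityMeasure_stdLaw (k : ℕ) {ν : ℝ} (hν : 0 < ν) :
    IsProbabilityMeasure (stdLaw k ν) :=
  isProbabilityMeasure_law (θ := ⟨0, 1, ν⟩) Matrix.PosDef.one hν

lemma law_eq_map {A S : Matrix (Fin k) (Fin k) ℝ} (hA : A.det ≠ 0) (hAS : A * Aᵀ = S)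
    (b : Fin k → ℝ) (ν : ℝ) : law ⟨b, S, ν⟩ = (stdLaw k ν).map fun y => b + A *ᵥ y := by
  rw [← push_std hAS b ν, law_push hA b (θ := ⟨0, 1, ν⟩) Matrix.PosDef.one, stdLaw]

/-- An orthogonal map fixes the parameter (0, 1, ν). Only coordinate reflections and transpositions
will be used. -/
lemma integral_comp_orthogonal {A : Matrix (Fin k) (Fin k) ℝ} (hA : A * Aᵀ = 1) (ν : ℝ)
    {F : (Fin k → ℝ) → ℝ} (hF : Measurable F) :
    ∫ y, F y ∂(stdLaw k ν) = ∫ y, F (A *ᵥ y) ∂(stdLaw k ν) := by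
  have hd : A.det ≠ 0 := by
    intro h0
    have := congrArg Matrix.det hA
    rw [Matrix.det_mul, h0] at this
    simp at this
  have h1 : stdLaw k ν = (stdLaw k ν).map fun y => (0 : Fin k → ℝ) + A *ᵥ y :=
    law_eq_map hd hA 0 ν
  conv_lhs => rw [h1]
  rw [integral_map (by fun_prop) hF.aestronglyMeasurable]
  simp

lemma dotProduct_mulVec_orthogonal {A : Matrix (Fin k) (Fin k) ℝ} (hA : A * Aᵀ = 1)
    (y : Fin k → ℝ) : (A *ᵥ y) ⬝ᵥ (A *ᵥ y) = y ⬝ᵥ y := by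
  have hA' : Aᵀ * A = 1 := mul_eq_one_comm.mp hA
  rw [Matrix.dotProduct_mulVec, Matrix.vecMul_mulVec, hA', Matrix.vecMul_one]

/-- The reflection of the `i`-th coordinate. -/
def signFlip (i : Fin k) : Matrix (Fin k) (Fin k) ℝ :=
  Matrix.diagonal fun j => if j = i then -1 else 1

lemma signFlip_orthogonal (i : Fin k) : signFlip i * (signFlip i)ᵀ = 1 := by
  rw [signFlip, Matrix.diagonal_transpose, Matrix.diagonal_mul_diagonal, ← Matrix.diagonal_one]
  congr 1
  funext j
  split_ifs <;> norm_num

lemma signFlip_mulVec (i j : Fin k) (y : Fin k → ℝ) :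
    (signFlip i *ᵥ y) j = (if j = i then -1 else 1) * y j := by
  rw [signFlip, Matrix.mulVec_diagonal]

lemma integral_radial_mul_coord {φ : ℝ → ℝ} (hφ : Measurable φ) (ν : ℝ) (i : Fin k) :
    ∫ y, φ (y ⬝ᵥ y) * y i ∂(stdLaw k ν) = 0 := by
  have h := integral_comp_orthogonal (signFlip_orthogonal i) ν
    (F := fun y => φ (y ⬝ᵥ y) * y i) (by simp only [dotProduct]; fun_prop)
  simp only [dotProduct_mulVec_orthogonal (signFlip_orthogonal i), signFlip_mulVec, if_true,
    mul_neg, neg_mul, one_mul, integral_neg] at h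
  linarith

lemma integral_radial_mul_coord_mul_coord {φ : ℝ → ℝ} (hφ : Measurable φ) (ν : ℝ) {i j : Fin k}
    (hij : i ≠ j) : ∫ y, φ (y ⬝ᵥ y) * (y i * y j) ∂(stdLaw k ν) = 0 := by
  have h := integral_comp_orthogonal (signFlip_orthogonal i) ν
    (F := fun y => φ (y ⬝ᵥ y) * (y i * y j)) (by simp only [dotProduct]; fun_prop)
  simp only [dotProduct_mulVec_orthogonal (signFlip_orthogonal i), signFlip_mulVec, if_true,
    if_neg hij.symm, mul_neg, neg_mul, one_mul, integral_neg] at h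
  linarith

lemma integral_radial_mul_sq {φ : ℝ → ℝ} (hφ : Measurable φ) (ν : ℝ) (i j : Fin k) :
    ∫ y, φ (y ⬝ᵥ y) * (y i * y i) ∂(stdLaw k ν)
      = ∫ y, φ (y ⬝ᵥ y) * (y j * y j) ∂(stdLaw k ν) := by
  set σ : Equiv.Perm (Fin k) := Equiv.swap i j
  have hA : σ.permMatrix ℝ * (σ.permMatrix ℝ)ᵀ = 1 := by
    rw [Matrix.transpose_permMatrix, ← Matrix.permMatrix_mul, inv_mul_cancel,
      Matrix.permMatrix_one]
  have h := integral_comp_orthogonal hA ν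
    (F := fun y => φ (y ⬝ᵥ y) * (y i * y i)) (by simp only [dotProduct]; fun_prop)
  rw [h]
  refine integral_congr_ae (ae_of_all _ fun y => ?_)
  have : (σ.permMatrix ℝ *ᵥ y) i = y j := by
    rw [Matrix.permMatrix_mulVec]; simp [σ]
  simp only [dotProduct_mulVec_orthogonal hA, this]

/-- Reflections kill the off-diagonal terms and transpositions equalize the diagonal ones, so only
the trace of T matters. Both sides are kept free of division by k. -/
lemma integral_radial_mul_quadForm {φ : ℝ → ℝ} (hφ : Measurable φ) {ν : ℝ}
    (hint : ∀ i j : Fin k, Integrable (fun y : Fin k → ℝ => φ (y ⬝ᵥ y) * (y i * y j)) (stdLaw k ν))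
    (T : Matrix (Fin k) (Fin k) ℝ) :
    k * ∫ y, φ (y ⬝ᵥ y) * (y ⬝ᵥ T *ᵥ y) ∂(stdLaw k ν)
      = T.trace * ∫ y, φ (y ⬝ᵥ y) * (y ⬝ᵥ y) ∂(stdLaw k ν) := by
  have expand : ∀ T : Matrix (Fin k) (Fin k) ℝ,
      ∫ y, φ (y ⬝ᵥ y) * (y ⬝ᵥ T *ᵥ y) ∂(stdLaw k ν)
        = ∑ i, T i i * ∫ y, φ (y ⬝ᵥ y) * (y i * y i) ∂(stdLaw k ν) := by
    intro T
    have h1 : ∀ y : Fin k → ℝ, φ (y ⬝ᵥ y) * (y ⬝ᵥ T *ᵥ y)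
        = ∑ i, ∑ j, T i j * (φ (y ⬝ᵥ y) * (y i * y j)) := by
      intro y
      simp only [dotProduct, mulVec, Finset.mul_sum]
      refine Finset.sum_congr rfl fun i _ => ?_
      exact Finset.sum_congr rfl fun j _ => by ring
    simp_rw [h1]
    have hi : ∀ i j, Integrable (fun y : Fin k → ℝ => T i j * (φ (y ⬝ᵥ y) * (y i * y j)))
        (stdLaw k ν) := fun i j => (hint i j).const_mul _
    rw [integral_finsetSum _ fun i _ => integrable_finsetSum _ fun j _ => hi i j]
    refine Finset.sum_congr rfl fun i _ => ?_
    rw [integral_finsetSum _ fun j _ => hi i j]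
    simp_rw [integral_const_mul]
    refine Finset.sum_eq_single i (fun j _ hji => ?_) (by simp)
    rw [integral_radial_mul_coord_mul_coord hφ ν hji.symm, mul_zero]
  have h2 := expand 1
  simp only [Matrix.one_mulVec, Matrix.one_apply_eq, one_mul] at h2
  rw [expand T, h2, Finset.mul_sum, Matrix.trace, Finset.sum_mul]
  refine Finset.sum_congr rfl fun i _ => ?_
  rw [Matrix.diag_apply, Finset.sum_congr rfl fun j _ => integral_radial_mul_sq hφ ν j i]
  simp
  ring

/-- The logarithmic weight dominating all scores at the standard parameter. -/
def logWeight (ν : ℝ) (y : Fin k → ℝ) : ℝ := 1 + Real.log (1 + y ⬝ᵥ y / ν)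

lemma one_le_logWeight {ν : ℝ} (hν : 0 < ν) (y : Fin k → ℝ) : 1 ≤ logWeight ν y := by
  have := dotProduct_self_nonneg' y
  have : 0 ≤ Real.log (1 + y ⬝ᵥ y / ν) := Real.log_nonneg (by
    have : 0 ≤ y ⬝ᵥ y / ν := by positivity
    linarith)
  rw [logWeight]; linarith

lemma integrable_density {θ : StudentParam k} (hS : θ.scatter.PosDef) (hν : 0 < θ.tail) :
    Integrable (density θ) := by
  have := isProbabilityMeasure_law hS hν
  refine ⟨(measurable_density θ).aestronglyMeasurable, ?_⟩
  rw [hasFiniteIntegral_iff_ofReal (ae_of_all _ fun x => (density_pos hS hν x).le)]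
  have h1 := measure_lt_top (law θ) Set.univ
  rwa [law, withDensity_apply _ MeasurableSet.univ, Measure.restrict_univ] at h1

/-- Multiplying the density by (1 + |y|²/ν)^ε lowers the tail weight by 2ε: up to a constant the
product is again a Student density, which is integrable. -/
lemma integrable_exp_logWeight (k : ℕ) {ν ε : ℝ} (hν : 0 < ν) (hε : ε < ν / 2) :
    Integrable (fun y : Fin k → ℝ => Real.exp (ε * logWeight ν y)) (stdLaw k ν) := by
  -- The scatter must be scaled by ν/ν' so that the ratio of Mahalanobis norm to tail weight is
  -- unchanged.
  set ν' : ℝ := ν - 2 * ε with hν'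
  have hν'0 : 0 < ν' := by linarith
  have hc : 0 < ν / ν' := by positivity
  set S : Matrix (Fin k) (Fin k) ℝ := (ν / ν') • 1 with hS
  have hSp : S.PosDef := Matrix.PosDef.one.smul hc
  have hi := integrable_density (θ := ⟨0, S, ν'⟩) hSp hν'0
  have hd0 := hSp.det_pos
  have hn0 := normConst_pos k hν'0
  rw [stdLaw, law, integrable_withDensity_iff (measurable_density _).ennreal_ofReal
    (ae_of_all _ fun _ => ENNReal.ofReal_lt_top)]
  refine (hi.const_mul (Real.exp ε * normConst k ν *
    (normConst k ν' * S.det ^ (-(1 / 2) : ℝ))⁻¹)).congr (ae_of_all _ fun y => ?_)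
  have hr : 0 < 1 + y ⬝ᵥ y / ν := by
    have := dotProduct_self_nonneg' y
    positivity
  have hq : mahalanobisSq ⟨0, S, ν'⟩ y / ν' = y ⬝ᵥ y / ν := by
    have hinv : S⁻¹ = (ν' / ν) • 1 := by
      refine Matrix.inv_eq_left_inv ?_
      rw [hS, Matrix.smul_mul, Matrix.one_mul, smul_smul]
      rw [show ν' / ν * (ν / ν') = 1 by field_simp, one_smul]
    simp only [mahalanobisSq, hinv, sub_zero, Matrix.smul_mulVec, Matrix.one_mulVec,
      dotProduct_smul, smul_eq_mul]
    field_simp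
  have hpos := density_pos (θ := ⟨0, 1, ν⟩) Matrix.PosDef.one hν y
  beta_reduce
  rw [ENNReal.toReal_ofReal hpos.le, density, density, mahalanobisSq_std]
  simp only [hq, Matrix.det_one, Real.one_rpow, mul_one]
  have h1 : Real.exp (ε * logWeight ν y) = Real.exp ε * (1 + y ⬝ᵥ y / ν) ^ ε := by
    rw [logWeight, Real.rpow_def_of_pos hr, ← Real.exp_add]; congr 1; ring
  have h2 : (1 + y ⬝ᵥ y / ν) ^ (-((ν' + k) / 2))
      = (1 + y ⬝ᵥ y / ν) ^ ε * (1 + y ⬝ᵥ y / ν) ^ (-((ν + k) / 2)) := by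
    rw [← Real.rpow_add hr]; congr 1; rw [hν']; ring
  rw [h1, h2]
  field_simp

/-- Half of the exponent c absorbs the power through x⁴/4! ≤ eˣ, with 24 = 4!; the other half
absorbs exp(bw). -/
lemma pow_mul_exp_le {c : ℝ} (hc : 0 < c) {w : ℝ} (hw : 1 ≤ w) {j : ℕ} (hj : j ≤ 4) {b : ℝ}
    (hb : b ≤ c / 2) : w ^ j * Real.exp (b * w) ≤ 24 * (2 / c) ^ 4 * Real.exp (c * w) := by
  have h1 : w ^ j ≤ w ^ 4 := pow_le_pow_right₀ hw hj
  have h2 := Real.pow_div_factorial_le_exp (c / 2 * w) (by positivity) 4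
  have h3 : w ^ 4 ≤ 24 * (2 / c) ^ 4 * Real.exp (c / 2 * w) := by
    have h4 : w ^ 4 = 24 * (2 / c) ^ 4 * ((c / 2 * w) ^ 4 / (Nat.factorial 4 : ℝ)) := by
      simp [Nat.factorial]; field_simp
    rw [h4]
    gcongr
  calc w ^ j * Real.exp (b * w)
      ≤ (24 * (2 / c) ^ 4 * Real.exp (c / 2 * w)) * Real.exp (c / 2 * w) := by
        gcongr
        exact h1.trans h3
    _ = _ := by rw [mul_assoc, ← Real.exp_add]; congr 2; ring

/-! ### The efficient score at the standard parameter -/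

/-- The score for the scale of the scatter, as a function of the squared Mahalanobis norm. -/
def radScore (k : ℕ) (ν r : ℝ) : ℝ := -(k / 2 : ℝ) + (ν + k) / 2 * (r / (ν + r))

/-- The coefficient of the projection of the tail score on the scale score. -/
def projCoef (k : ℕ) (ν : ℝ) : ℝ :=
  (∫ y, tailScore k ν (y ⬝ᵥ y) * radScore k ν (y ⬝ᵥ y) ∂(stdLaw k ν)) /
    ∫ y, radScore k ν (y ⬝ᵥ y) ^ 2 ∂(stdLaw k ν)

/-- The efficient score for tail weight, as a function of the squared Mahalanobis norm. -/
def effScore (k : ℕ) (ν r : ℝ) : ℝ := tailScore k ν r - projCoef k ν * radScore k ν r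

/-- The variance of the efficient score. -/
def effVar (k : ℕ) (ν : ℝ) : ℝ := ∫ y, effScore k ν (y ⬝ᵥ y) ^ 2 ∂(stdLaw k ν)

/-- The dominating weight. -/
def expWeight (ν : ℝ) (y : Fin k → ℝ) : ℝ := Real.exp (ν / 4 * logWeight ν y)

/-- The integral of the dominating weight. -/
def expWeightIntegral (k : ℕ) (ν : ℝ) : ℝ := ∫ y, expWeight ν y ∂(stdLaw k ν)

lemma expWeightIntegral_nonneg (k : ℕ) (ν : ℝ) : 0 ≤ expWeightIntegral k ν :=
  integral_nonneg fun _ => (Real.exp_pos _).le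

/-- The exponent ν/4 is safely below the critical ν/2. Remainders may then carry exponents up to ν/8
and powers of the weight up to the fourth. -/
lemma integrable_expWeight (k : ℕ) {ν : ℝ} (hν : 0 < ν) :
    Integrable (expWeight ν) (stdLaw k ν) :=
  integrable_exp_logWeight k hν (by linarith)

lemma integrable_of_le_expWeight {E : Type*} [NormedAddCommGroup E] {ν : ℝ} (hν : 0 < ν)
    {f : (Fin k → ℝ) → E} (hf : AEStronglyMeasurable f (stdLaw k ν)) {C : ℝ}
    (h : ∀ y, ‖f y‖ ≤ C * expWeight ν y) : Integrable f (stdLaw k ν) :=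
  ((integrable_expWeight k hν).const_mul C).mono' hf (ae_of_all _ h)

lemma norm_integral_le_expWeight {E : Type*} [NormedAddCommGroup E] [NormedSpace ℝ E] {ν : ℝ}
    (hν : 0 < ν) {f : (Fin k → ℝ) → E} {C : ℝ} (h : ∀ y, ‖f y‖ ≤ C * expWeight ν y) :
    ‖∫ y, f y ∂(stdLaw k ν)‖ ≤ C * expWeightIntegral k ν := by
  refine (norm_integral_le_of_norm_le ((integrable_expWeight k hν).const_mul C)
    (ae_of_all _ h)).trans (le_of_eq ?_)
  rw [integral_const_mul, expWeightIntegral]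

/-- The constant in the domination of powers of the logarithmic weight. -/
def powConst (ν : ℝ) : ℝ := 24 * (2 / (ν / 4)) ^ 4

lemma powConst_nonneg (ν : ℝ) : 0 ≤ powConst ν := by
  unfold powConst; positivity

lemma logWeight_pow_mul_exp_le {ν : ℝ} (hν : 0 < ν) {j : ℕ} (hj : j ≤ 4) {b : ℝ}
    (hb : b ≤ ν / 8) (y : Fin k → ℝ) :
    logWeight ν y ^ j * Real.exp (b * logWeight ν y) ≤ powConst ν * expWeight ν y :=
  pow_mul_exp_le (by positivity) (one_le_logWeight hν y) hj (by linarith)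

lemma logWeight_pow_le {ν : ℝ} (hν : 0 < ν) {j : ℕ} (hj : j ≤ 4) (y : Fin k → ℝ) :
    logWeight ν y ^ j ≤ powConst ν * expWeight ν y := by
  simpa using logWeight_pow_mul_exp_le hν hj (b := 0) (by positivity) y

lemma integrable_of_le_logWeight_pow {ν : ℝ} (hν : 0 < ν)
    {f : (Fin k → ℝ) → ℝ} (hf : Continuous f) {C : ℝ} (hC : 0 ≤ C) {j : ℕ} (hj : j ≤ 4)
    (h : ∀ y, |f y| ≤ C * logWeight ν y ^ j) : Integrable f (stdLaw k ν) := by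
  refine integrable_of_le_expWeight hν hf.aestronglyMeasurable (C := C * powConst ν) fun y => ?_
  rw [mul_assoc]
  exact (h y).trans (mul_le_mul_of_nonneg_left (logWeight_pow_le hν hj y) hC)

lemma continuousOn_tailScore (k : ℕ) {ν : ℝ} (hν : 0 < ν) :
    ContinuousOn (tailScore k ν) (Set.Ici 0) := by
  unfold tailScore
  refine ((continuousOn_const.sub (ContinuousOn.div_const (ContinuousOn.log (by fun_prop) ?_) _)).add
    (continuousOn_const.mul (ContinuousOn.div (by fun_prop) (by fun_prop) ?_)))
  · intro r hr
    have : (0 : ℝ) ≤ r := hr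
    positivity
  · intro r hr
    have : (0 : ℝ) ≤ r := hr
    positivity

lemma continuousOn_radScore (k : ℕ) {ν : ℝ} (hν : 0 < ν) :
    ContinuousOn (radScore k ν) (Set.Ici 0) := by
  unfold radScore
  refine continuousOn_const.add
    (continuousOn_const.mul (ContinuousOn.div (by fun_prop) (by fun_prop) ?_))
  intro r hr
  have : (0 : ℝ) ≤ r := hr
  positivity

lemma continuousOn_effScore (k : ℕ) {ν : ℝ} (hν : 0 < ν) :
    ContinuousOn (effScore k ν) (Set.Ici 0) :=
  (continuousOn_tailScore k hν).sub (continuousOn_const.mul (continuousOn_radScore k hν))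

lemma continuous_comp_dotProduct {f : ℝ → ℝ} (hf : ContinuousOn f (Set.Ici 0)) :
    Continuous fun y : Fin k → ℝ => f (y ⬝ᵥ y) :=
  hf.comp_continuous (by fun_prop) fun y => dotProduct_self_nonneg' y

lemma measurable_tailScore (k : ℕ) (ν : ℝ) : Measurable (tailScore k ν) := by
  unfold tailScore
  fun_prop

lemma measurable_radScore (k : ℕ) (ν : ℝ) : Measurable (radScore k ν) := by
  unfold radScore
  fun_prop

lemma measurable_effScore (k : ℕ) (ν : ℝ) : Measurable (effScore k ν) :=
  (measurable_tailScore k ν).sub ((measurable_radScore k ν).const_mul _)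

lemma continuous_linScore {ν : ℝ} (hν : 0 < ν) (m : Fin k → ℝ) (T : Matrix (Fin k) (Fin k) ℝ)
    (t : ℝ) : Continuous (linScore ν m T t) := by
  have h0 : ∀ y : Fin k → ℝ, ν + y ⬝ᵥ y ≠ 0 := fun y => by
    have := dotProduct_self_nonneg' y
    positivity
  have h1 := continuous_comp_dotProduct (k := k) (continuousOn_tailScore k hν)
  unfold linScore
  exact ((continuous_const.mul h1).add (continuous_const.add (continuous_const.mul
    (Continuous.div (by fun_prop) (by fun_prop) h0)))).add
    (continuous_const.mul (Continuous.div (by fun_prop) (by fun_prop) h0))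

lemma exists_tailScore_bound (k : ℕ) {ν : ℝ} (hν : 0 < ν) :
    ∃ C : ℝ, 0 ≤ C ∧ ∀ y : Fin k → ℝ, |tailScore k ν (y ⬝ᵥ y)| ≤ C * logWeight ν y := by
  set c := |deriv (fun v => Real.log (normConst k v)) ν|
  refine ⟨c + 1 + (ν + k) / 2 * ν⁻¹, by positivity, fun y => ?_⟩
  have hr := dotProduct_self_nonneg' y
  have hW := one_le_logWeight hν y
  have hL : 0 ≤ Real.log (1 + y ⬝ᵥ y / ν) := by rw [logWeight] at hW; linarith
  have h1 : |y ⬝ᵥ y / (ν * (ν + y ⬝ᵥ y))| ≤ ν⁻¹ := by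
    rw [abs_of_nonneg (by positivity), ← div_div, div_le_iff₀ (by positivity)]
    rw [div_eq_mul_inv, mul_comm]
    gcongr; linarith
  rw [tailScore]
  refine (abs_add_le _ _).trans ((add_le_add (abs_sub _ _) le_rfl).trans ?_)
  rw [abs_mul, abs_of_nonneg (show 0 ≤ (ν + k) / 2 by positivity),
    abs_of_nonneg (show 0 ≤ Real.log (1 + y ⬝ᵥ y / ν) / 2 by positivity)]
  have h2 : (ν + k) / 2 * |y ⬝ᵥ y / (ν * (ν + y ⬝ᵥ y))| ≤ (ν + k) / 2 * ν⁻¹ := by gcongr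
  have h3 : c ≤ c * logWeight ν y := le_mul_of_one_le_right (abs_nonneg _) hW
  have h4 : (ν + k) / 2 * ν⁻¹ ≤ (ν + k) / 2 * ν⁻¹ * logWeight ν y :=
    le_mul_of_one_le_right (by positivity) hW
  have h5 : Real.log (1 + y ⬝ᵥ y / ν) / 2 ≤ logWeight ν y := by rw [logWeight]; linarith
  calc _ ≤ c * logWeight ν y + logWeight ν y + (ν + k) / 2 * ν⁻¹ * logWeight ν y := by
        refine add_le_add (add_le_add h3 h5) (h2.trans h4)
    _ = _ := by ring

lemma abs_radScore_le (k : ℕ) {ν : ℝ} (hν : 0 < ν) {r : ℝ} (hr : 0 ≤ r) :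
    |radScore k ν r| ≤ ν + k := by
  have h1 : r / (ν + r) ≤ 1 := by rw [div_le_one (by positivity)]; linarith
  have h0 : 0 ≤ r / (ν + r) := by positivity
  have hk : (0 : ℝ) ≤ k := Nat.cast_nonneg k
  rw [radScore, abs_le]
  constructor <;> nlinarith

lemma exists_effScore_bound (k : ℕ) {ν : ℝ} (hν : 0 < ν) :
    ∃ C : ℝ, 0 ≤ C ∧ ∀ y : Fin k → ℝ, |effScore k ν (y ⬝ᵥ y)| ≤ C * logWeight ν y := by
  obtain ⟨C, hC, h⟩ := exists_tailScore_bound k hν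
  refine ⟨C + |projCoef k ν| * (ν + k), by positivity, fun y => ?_⟩
  rw [effScore]
  refine (abs_sub _ _).trans ?_
  rw [abs_mul, add_mul]
  refine add_le_add (h y) ?_
  refine le_trans ?_ (le_mul_of_one_le_right (by positivity) (one_le_logWeight hν y))
  gcongr
  exact abs_radScore_le k hν (dotProduct_self_nonneg' y)

lemma abs_trace_le {T : Matrix (Fin k) (Fin k) ℝ} {d : ℝ} (h : ∀ i j, |T i j| ≤ d) :
    |T.trace| ≤ k * d := by
  rw [Matrix.trace]
  refine (Finset.abs_sum_le_sum_abs _ _).trans ((Finset.sum_le_sum fun i _ => h i i).trans ?_)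
  simp

/-- Location and scatter scores are bounded because ν + |y|² dominates their numerators. Only the
tail score grows, and it does so logarithmically. -/
lemma exists_linScore_bound (k : ℕ) {ν : ℝ} (hν : 0 < ν) :
    ∃ C : ℝ, 0 ≤ C ∧ ∀ (m : Fin k → ℝ) (T : Matrix (Fin k) (Fin k) ℝ) (t d : ℝ),
      IsSmall d m T t → ∀ y : Fin k → ℝ, |linScore ν m T t y| ≤ C * d * logWeight ν y := by
  obtain ⟨C, hC, h⟩ := exists_tailScore_bound k hν
  set B : ℝ := k / 2 + (ν + k) / 2 * k ^ 2 + (ν + k) * (k ^ 2 * (1 + ν⁻¹)) with hB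
  refine ⟨C + B, by positivity, fun m T t d hs y => ?_⟩
  have hd0 := hs.nonneg
  have hr := dotProduct_self_nonneg' y
  have hN : 0 < ν + y ⬝ᵥ y := by positivity
  have hW := one_le_logWeight hν y
  have h1 : |t * tailScore k ν (y ⬝ᵥ y)| ≤ C * d * logWeight ν y := by
    rw [abs_mul]
    calc |t| * |tailScore k ν (y ⬝ᵥ y)| ≤ d * (C * logWeight ν y) :=
          mul_le_mul hs.tail (h y) (abs_nonneg _) hd0
      _ = _ := by ring
  have h2 : |-(T.trace) / 2| ≤ k / 2 * d := by
    rw [abs_div, abs_neg, abs_two]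
    have := abs_trace_le hs.scatter
    linarith
  have h3 : |(y ⬝ᵥ T *ᵥ y) / (ν + y ⬝ᵥ y)| ≤ k ^ 2 * d := by
    rw [abs_div, abs_of_pos hN, div_le_iff₀ hN]
    refine (abs_quadForm_le hd0 hs.scatter y).trans ?_
    gcongr; linarith
  have h4 : |(m ⬝ᵥ y) / (ν + y ⬝ᵥ y)| ≤ k ^ 2 * (1 + ν⁻¹) * d := by
    rw [abs_div, abs_of_pos hN, div_le_iff₀ hN]
    have h1le : ∀ i j, |(1 : Matrix (Fin k) (Fin k) ℝ) i j| ≤ 1 := by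
      intro i j; rw [Matrix.one_apply]; split_ifs <;> norm_num
    have h5 := abs_bilin_le hd0 zero_le_one hs.loc h1le (abs_le_sqrt_one_add y)
    rw [Matrix.one_mulVec] at h5
    have h6 : √(1 + y ⬝ᵥ y) ≤ (1 + ν⁻¹) * (ν + y ⬝ᵥ y) :=
      le_trans (Real.sqrt_le_iff.mpr ⟨by positivity, by nlinarith⟩) (one_add_le_mul hν hr)
    calc |m ⬝ᵥ y| ≤ k ^ 2 * (d * 1 * √(1 + y ⬝ᵥ y)) := h5
      _ ≤ k ^ 2 * (d * 1 * ((1 + ν⁻¹) * (ν + y ⬝ᵥ y))) := by gcongr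
      _ = _ := by ring
  have h7 : B * d ≤ B * d * logWeight ν y := le_mul_of_one_le_right (by positivity) hW
  rw [linScore]
  refine (abs_add_le _ _).trans ((add_le_add (abs_add_le _ _) le_rfl).trans ?_)
  refine (add_le_add (add_le_add h1 (abs_add_le _ _)) le_rfl).trans ?_
  rw [abs_mul, abs_mul, abs_of_nonneg (show 0 ≤ (ν + k) / 2 by positivity),
    abs_of_nonneg (show 0 ≤ (ν + k) by positivity)]
  calc _ ≤ C * d * logWeight ν y + (k / 2 * d + (ν + k) / 2 * (k ^ 2 * d))
        + (ν + k) * (k ^ 2 * (1 + ν⁻¹) * d) := by gcongr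
    _ = C * d * logWeight ν y + B * d := by rw [hB]; ring
    _ ≤ C * d * logWeight ν y + B * d * logWeight ν y := by gcongr
    _ = _ := by ring

/-! ### Exponential remainders and collected constants -/

lemma abs_exp_sub_sum_le (x : ℝ) (n : ℕ) :
    |Real.exp x - ∑ m ∈ Finset.range n, x ^ m / m.factorial| ≤ |x| ^ n * Real.exp |x| := by
  have := Complex.norm_exp_sub_sum_le_norm_mul_exp (x : ℂ) n
  rw [Complex.norm_real, Real.norm_eq_abs] at this
  rw [← Real.norm_eq_abs, ← Complex.norm_real]
  push_cast
  exact this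

lemma abs_exp_sub_one_le (x : ℝ) : |Real.exp x - 1| ≤ |x| * Real.exp |x| := by
  simpa using abs_exp_sub_sum_le x 1

lemma abs_exp_sub_one_sub_le (x : ℝ) : |Real.exp x - 1 - x| ≤ |x| ^ 2 * Real.exp |x| := by
  simpa [Finset.sum_range_succ, sub_sub] using abs_exp_sub_sum_le x 2

lemma abs_exp_sub_quadratic_le (x : ℝ) :
    |Real.exp x - 1 - x - x ^ 2 / 2| ≤ |x| ^ 3 * Real.exp |x| := by
  simpa [Finset.sum_range_succ, sub_sub, ← add_assoc] using abs_exp_sub_sum_le x 3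

/-- All pointwise bounds for the log-likelihood ratio `u` of a small displacement. -/
structure LogRatioBound (ν C d : ℝ) (m : Fin k → ℝ) (T : Matrix (Fin k) (Fin k) ℝ) (t : ℝ) :
    Prop where
  posDef : (1 + T).PosDef
  tail_pos : 0 < ν + t
  sub_le : ∀ y, |logRatio ν m T t y - linScore ν m T t y| ≤ C * d ^ 2
  lin_le : ∀ y, |linScore ν m T t y| ≤ C * d * logWeight ν y
  le : ∀ y, |logRatio ν m T t y| ≤ C * d * logWeight ν y
  ratio_le : ∀ y, |(ν + t + mahalanobisSq ⟨m, 1 + T, ν + t⟩ y) / (ν + y ⬝ᵥ y) - 1| ≤ C * d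

/-- One constant for all pointwise estimates. The condition Cδ ≤ ν/32 keeps the exponents that occur
later, such as 2Cd and C|σ| + Cd, within the budget ν/8; Cδ ≤ 1/2 is for the logarithm of the ratio
ρ. -/
theorem exists_bounds (k : ℕ) {ν : ℝ} (hν : 0 < ν) :
    ∃ C δ : ℝ, 1 ≤ C ∧ 0 < δ ∧ δ ≤ 1 ∧ C * δ ≤ ν / 32 ∧ C * δ ≤ 1 / 2 ∧
      (∀ y : Fin k → ℝ, |effScore k ν (y ⬝ᵥ y)| ≤ C * logWeight ν y) ∧
      ∀ (m : Fin k → ℝ) (T : Matrix (Fin k) (Fin k) ℝ) (t d : ℝ),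
      d ≤ δ → IsSmall d m T t → LogRatioBound ν C d m T t := by
  obtain ⟨C₁, δ₁, hC₁, hδ₁, h₁⟩ := exists_logRatio_bound k hν
  obtain ⟨C₂, hC₂, h₂⟩ := exists_linScore_bound k hν
  obtain ⟨C₃, hC₃, h₃⟩ := exists_effScore_bound k hν
  set C := C₁ + C₂ + C₃ + 1 with hC
  have hC0 : 0 < C := by positivity
  refine ⟨C, min (min δ₁ 1) (min (ν / 32 / C) (1 / 2 / C)), by linarith, by positivity,
    (min_le_left _ _).trans (min_le_right _ _), ?_, ?_, ?_, ?_⟩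
  · rw [← le_div_iff₀' hC0]; exact (min_le_right _ _).trans (min_le_left _ _)
  · rw [← le_div_iff₀' hC0]; exact (min_le_right _ _).trans (min_le_right _ _)
  · intro y
    have := one_le_logWeight hν y
    refine (h₃ y).trans ?_
    gcongr
    linarith
  · intro m T t d hd hs
    have hd0 := hs.nonneg
    have hd1 : d ≤ 1 := hd.trans ((min_le_left _ _).trans (min_le_right _ _))
    have hdd : d ^ 2 ≤ d := by nlinarith
    obtain ⟨hP, ht, h⟩ := h₁ m T t d (hd.trans ((min_le_left _ _).trans (min_le_left _ _))) hs
    refine ⟨hP, ht, fun y => (h y).1.trans ?_, fun y => (h₂ m T t d hs y).trans ?_, fun y => ?_,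
      fun y => (h y).2.trans ?_⟩
    · gcongr; linarith
    · have := one_le_logWeight hν y
      gcongr; linarith
    · have hW := one_le_logWeight hν y
      have e1 := (h y).1
      have e2 := h₂ m T t d hs y
      have : logRatio ν m T t y = (logRatio ν m T t y - linScore ν m T t y)
        + linScore ν m T t y := by ring
      rw [this]
      refine (abs_add_le _ _).trans ?_
      have e3 : C₁ * d ^ 2 ≤ C₁ * d * logWeight ν y := by
        calc C₁ * d ^ 2 ≤ C₁ * d := by gcongr
          _ ≤ C₁ * d * logWeight ν y := le_mul_of_one_le_right (by positivity) hW
      calc _ ≤ C₁ * d * logWeight ν y + C₂ * d * logWeight ν y := by linarith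
        _ = (C₁ + C₂) * d * logWeight ν y := by ring
        _ ≤ _ := by gcongr; linarith
    · gcongr; linarith

/-! ### Moments of the scores at the standard parameter -/

lemma measurable_logRatio (ν : ℝ) (m : Fin k → ℝ) (T : Matrix (Fin k) (Fin k) ℝ) (t : ℝ) :
    Measurable (logRatio ν m T t) :=
  (measurable_density _).log.sub (measurable_density _).log

lemma exp_logRatio {ν : ℝ} (hν : 0 < ν) {m : Fin k → ℝ} {T : Matrix (Fin k) (Fin k) ℝ} {t : ℝ}
    (hT : (1 + T).PosDef) (ht : 0 < ν + t) (y : Fin k → ℝ) :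
    Real.exp (logRatio ν m T t y) = density ⟨m, 1 + T, ν + t⟩ y / density ⟨0, 1, ν⟩ y := by
  rw [logRatio, Real.exp_sub, Real.exp_log (density_pos (θ := ⟨m, 1 + T, ν + t⟩) hT ht y),
    Real.exp_log (density_pos (θ := ⟨0, 1, ν⟩) Matrix.PosDef.one hν y)]

lemma integral_law_eq {E : Type*} [NormedAddCommGroup E] [NormedSpace ℝ E]
    {ν : ℝ} (hν : 0 < ν) {m : Fin k → ℝ} {T : Matrix (Fin k) (Fin k) ℝ} {t : ℝ}
    (hT : (1 + T).PosDef) (ht : 0 < ν + t) (F : (Fin k → ℝ) → E) :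
    ∫ y, F y ∂(law ⟨m, 1 + T, ν + t⟩)
      = ∫ y, Real.exp (logRatio ν m T t y) • F y ∂(stdLaw k ν) := by
  rw [law_eq_withDensity (θ := ⟨0, 1, ν⟩) (θ' := ⟨m, 1 + T, ν + t⟩) Matrix.PosDef.one hν,
    integral_withDensity_eq_integral_toReal_smul
      (show Measurable fun x => ENNReal.ofReal (density ⟨m, 1 + T, ν + t⟩ x / density ⟨0, 1, ν⟩ x)
        from ((measurable_density _).div (measurable_density _)).ennreal_ofReal)
      (ae_of_all _ fun _ => ENNReal.ofReal_lt_top), stdLaw]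
  refine integral_congr_ae (ae_of_all _ fun y => ?_)
  beta_reduce
  rw [← exp_logRatio hν hT ht, ENNReal.toReal_ofReal (Real.exp_pos _).le]

lemma integral_exp_logRatio {ν : ℝ} (hν : 0 < ν) {m : Fin k → ℝ}
    {T : Matrix (Fin k) (Fin k) ℝ} {t : ℝ} (hT : (1 + T).PosDef) (ht : 0 < ν + t) :
    ∫ y, Real.exp (logRatio ν m T t y) ∂(stdLaw k ν) = 1 := by
  have := isProbabilityMeasure_law (θ := ⟨m, 1 + T, ν + t⟩) hT ht
  have h := integral_law_eq (m := m) hν hT ht (fun _ => (1 : ℝ))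
  simpa using h.symm

lemma LogRatioBound.exp_abs_le {ν C d : ℝ} {m : Fin k → ℝ}
    {T : Matrix (Fin k) (Fin k) ℝ} {t : ℝ} (b : LogRatioBound ν C d m T t) (y : Fin k → ℝ) :
    Real.exp |logRatio ν m T t y| ≤ Real.exp (C * d * logWeight ν y) :=
  Real.exp_le_exp.mpr (b.le y)

lemma LogRatioBound.abs_exp_sub_one_le {ν C d : ℝ} (hd : 0 ≤ d) (hC : 1 ≤ C) (hν : 0 < ν)
    {m : Fin k → ℝ} {T : Matrix (Fin k) (Fin k) ℝ} {t : ℝ} (b : LogRatioBound ν C d m T t)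
    (y : Fin k → ℝ) : |Real.exp (logRatio ν m T t y) - 1|
      ≤ C * d * logWeight ν y * Real.exp (C * d * logWeight ν y) := by
  have hW := one_le_logWeight hν y
  refine (StudentT.abs_exp_sub_one_le _).trans ?_
  exact mul_le_mul (b.le y) (b.exp_abs_le y) (Real.exp_pos _).le (by positivity)

lemma LogRatioBound.abs_exp_sub_one_sub_lin_le {ν C d : ℝ} (hd : 0 ≤ d) (hC : 1 ≤ C) (hν : 0 < ν)
    {m : Fin k → ℝ} {T : Matrix (Fin k) (Fin k) ℝ} {t : ℝ} (b : LogRatioBound ν C d m T t)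
    (y : Fin k → ℝ) : |Real.exp (logRatio ν m T t y) - 1 - linScore ν m T t y|
      ≤ 2 * C ^ 2 * d ^ 2 * (logWeight ν y ^ 2 * Real.exp (C * d * logWeight ν y)) := by
  have hW := one_le_logWeight hν y
  have he : 1 ≤ Real.exp (C * d * logWeight ν y) := Real.one_le_exp (by positivity)
  have h1 : |logRatio ν m T t y| ^ 2 * Real.exp |logRatio ν m T t y|
      ≤ (C * d * logWeight ν y) ^ 2 * Real.exp (C * d * logWeight ν y) :=
    mul_le_mul (pow_le_pow_left₀ (abs_nonneg _) (b.le y) 2) (b.exp_abs_le y) (Real.exp_pos _).le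
      (by positivity)
  have h2 : C * d ^ 2 ≤ C ^ 2 * d ^ 2 * (logWeight ν y ^ 2 * Real.exp (C * d * logWeight ν y)) := by
    have : 1 ≤ logWeight ν y ^ 2 * Real.exp (C * d * logWeight ν y) :=
      one_le_mul_of_one_le_of_one_le (one_le_pow₀ hW) he
    refine le_trans ?_ (le_mul_of_one_le_right (by positivity) this)
    gcongr
    nlinarith
  have h3 : Real.exp (logRatio ν m T t y) - 1 - linScore ν m T t y
    = (Real.exp (logRatio ν m T t y) - 1 - logRatio ν m T t y)
      + (logRatio ν m T t y - linScore ν m T t y) := by ring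
  rw [h3]
  refine (abs_add_le _ _).trans ?_
  have := abs_exp_sub_one_sub_le (logRatio ν m T t y)
  have := b.sub_le y
  have e : (C * d * logWeight ν y) ^ 2 * Real.exp (C * d * logWeight ν y)
    = C ^ 2 * d ^ 2 * (logWeight ν y ^ 2 * Real.exp (C * d * logWeight ν y)) := by ring
  linarith

lemma LogRatioBound.integrable_exp {ν C d : ℝ} (hν : 0 < ν) (hCd : C * d ≤ ν / 32)
    {m : Fin k → ℝ} {T : Matrix (Fin k) (Fin k) ℝ} {t : ℝ} (b : LogRatioBound ν C d m T t) :
    Integrable (fun y => Real.exp (logRatio ν m T t y)) (stdLaw k ν) := by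
  refine integrable_of_le_expWeight hν (C := powConst ν)
    (measurable_logRatio ν m T t).exp.aestronglyMeasurable fun y => ?_
  rw [Real.norm_eq_abs, abs_of_pos (Real.exp_pos _)]
  refine le_trans ?_ (logWeight_pow_mul_exp_le hν (j := 0) (b := C * d) (by norm_num)
    (by linarith) y)
  rw [pow_zero, one_mul, Real.exp_le_exp]
  exact (le_abs_self _).trans (b.le y)

lemma exists_isSmall (m : Fin k → ℝ) {T : Matrix (Fin k) (Fin k) ℝ} (hT : T.IsSymm) (t : ℝ) :
    ∃ d, IsSmall d m T t := by
  refine ⟨∑ i, |m i| + ∑ i, ∑ j, |T i j| + |t|, by positivity, fun i => ?_, fun i j => ?_, hT, ?_⟩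
  · have h1 := Finset.single_le_sum (f := fun i => |m i|) (fun j _ => abs_nonneg _)
      (Finset.mem_univ i)
    have h2 : 0 ≤ ∑ i, ∑ j, |T i j| := by positivity
    linarith [abs_nonneg t]
  · have h1 := Finset.single_le_sum (f := fun i => ∑ j, |T i j|) (fun j _ => by positivity)
      (Finset.mem_univ i)
    have h2 := Finset.single_le_sum (f := fun j => |T i j|) (fun j _ => abs_nonneg _)
      (Finset.mem_univ j)
    have h3 : 0 ≤ ∑ i, |m i| := by positivity
    linarith [abs_nonneg t]
  · have h2 : 0 ≤ ∑ i, ∑ j, |T i j| := by positivity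
    have h3 : 0 ≤ ∑ i, |m i| := by positivity
    linarith

lemma integrable_linScore {ν : ℝ} (hν : 0 < ν) (m : Fin k → ℝ) {T : Matrix (Fin k) (Fin k) ℝ}
    (hT : T.IsSymm) (t : ℝ) : Integrable (linScore ν m T t) (stdLaw k ν) := by
  obtain ⟨C, hC, h⟩ := exists_linScore_bound k hν
  obtain ⟨d, hd⟩ := exists_isSmall m hT t
  refine integrable_of_le_logWeight_pow hν (continuous_linScore hν m T t) (j := 1)
    (C := C * d) (mul_nonneg hC hd.nonneg) (by norm_num) fun y => ?_
  rw [pow_one]; exact h m T t d hd y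

lemma linScore_smul (ν ε : ℝ) (m : Fin k → ℝ) (T : Matrix (Fin k) (Fin k) ℝ) (t : ℝ)
    (y : Fin k → ℝ) : linScore ν (ε • m) (ε • T) (ε * t) y = ε * linScore ν m T t y := by
  simp only [linScore, Matrix.trace_smul, Matrix.smul_mulVec, dotProduct_smul, smul_dotProduct,
    smul_eq_mul]
  ring

/-- The likelihood ratio of the displacement scaled by ε integrates to 1 and equals 1 + ε · score +
O(ε²) in L¹. Hence ε|I| ≤ Kε² for small ε, which forces I = 0 without differentiating under the
integral. -/
theorem integral_linScore {ν : ℝ} (hν : 0 < ν) (m : Fin k → ℝ) {T : Matrix (Fin k) (Fin k) ℝ}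
    (hT : T.IsSymm) (t : ℝ) : ∫ y, linScore ν m T t y ∂(stdLaw k ν) = 0 := by
  have := isProbabilityMeasure_stdLaw k hν
  obtain ⟨C, δ, hC, hδ, hδ1, hCδ, -, -, hb⟩ := exists_bounds k hν
  obtain ⟨D, hD⟩ := exists_isSmall m hT t
  have hD0 := hD.nonneg
  set I := ∫ y, linScore ν m T t y ∂(stdLaw k ν) with hI
  set K := 2 * C ^ 2 * D ^ 2 * powConst ν * expWeightIntegral k ν with hK
  have hK0 : 0 ≤ K := by
    have := powConst_nonneg ν
    have := expWeightIntegral_nonneg k ν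
    positivity
  have main : ∀ ε : ℝ, 0 < ε → ε * D ≤ δ → |I| ≤ K * ε := by
    intro ε hε hεD
    have hs : IsSmall (ε * D) (ε • m) (ε • T) (ε * t) := by
      refine ⟨by positivity, fun i => ?_, fun i j => ?_, hT.smul ε, ?_⟩
      · rw [Pi.smul_apply, smul_eq_mul, abs_mul, abs_of_pos hε]; gcongr; exact hD.loc i
      · rw [Matrix.smul_apply, smul_eq_mul, abs_mul, abs_of_pos hε]; gcongr; exact hD.scatter i j
      · rw [abs_mul, abs_of_pos hε]; gcongr; exact hD.tail
    have b := hb _ _ _ _ hεD hs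
    have hCd : C * (ε * D) ≤ ν / 32 := by
      refine le_trans ?_ hCδ; gcongr
    have h1 : ∫ y, (Real.exp (logRatio ν (ε • m) (ε • T) (ε * t) y) - 1
        - linScore ν (ε • m) (ε • T) (ε * t) y) ∂(stdLaw k ν) = - (ε * I) := by
      have i1 := b.integrable_exp hν hCd
      have i2 : Integrable (fun y => Real.exp (logRatio ν (ε • m) (ε • T) (ε * t) y) - 1)
        (stdLaw k ν) := i1.sub (integrable_const _)
      rw [integral_sub i2 (integrable_linScore hν _ (hT.smul ε) _), integral_sub i1 (integrable_const _), integral_exp_logRatio hν b.posDef b.tail_pos]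
      simp only [linScore_smul, integral_const_mul, ← hI]
      simp
    have h2 := norm_integral_le_expWeight (k := k) hν
      (f := fun y => Real.exp (logRatio ν (ε • m) (ε • T) (ε * t) y) - 1
        - linScore ν (ε • m) (ε • T) (ε * t) y)
      (C := 2 * C ^ 2 * (ε * D) ^ 2 * powConst ν) fun y => by
        rw [mul_assoc]
        refine (b.abs_exp_sub_one_sub_lin_le hs.nonneg hC hν y).trans
          (mul_le_mul_of_nonneg_left (logWeight_pow_mul_exp_le hν (by norm_num) (by linarith) y)
            (by positivity))
    rw [h1, norm_neg, Real.norm_eq_abs, abs_mul, abs_of_pos hε] at h2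
    have h3 : ε * |I| ≤ ε * (K * ε) := by
      refine h2.trans (le_of_eq ?_); rw [hK]; ring
    exact le_of_mul_le_mul_left h3 hε
  have hlim : Tendsto (fun ε : ℝ => K * ε) (𝓝[>] 0) (𝓝 0) := by
    have : Tendsto (fun ε : ℝ => K * ε) (𝓝 0) (𝓝 (K * 0)) := by
      exact (continuous_const.mul continuous_id).tendsto 0
    rw [mul_zero] at this
    exact this.mono_left nhdsWithin_le_nhds
  have hev : ∀ᶠ ε : ℝ in 𝓝[>] 0, |I| ≤ K * ε := by
    have h0 : ∀ᶠ ε : ℝ in 𝓝 (0 : ℝ), ε * D < δ := by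
      refine (continuous_id.mul continuous_const).continuousAt.eventually_lt
        continuousAt_const (by simpa using hδ)
    filter_upwards [self_mem_nhdsWithin, nhdsWithin_le_nhds h0] with ε h1 h2
    exact main ε h1 h2.le
  exact abs_nonpos_iff.mp (ge_of_tendsto hlim hev)

lemma linScore_tail (ν : ℝ) (y : Fin k → ℝ) :
    linScore ν 0 (0 : Matrix (Fin k) (Fin k) ℝ) 1 y = tailScore k ν (y ⬝ᵥ y) := by
  simp [linScore]

/-- Pure scaling of the scatter has a radial score. It is the score on which the tail score is
projected. -/
lemma linScore_one (ν : ℝ) (y : Fin k → ℝ) :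
    linScore ν 0 (1 : Matrix (Fin k) (Fin k) ℝ) 0 y = radScore k ν (y ⬝ᵥ y) := by
  simp [linScore, radScore]
  ring

lemma linScore_add (ν : ℝ) (m : Fin k → ℝ) (T : Matrix (Fin k) (Fin k) ℝ) (t : ℝ)
    (y : Fin k → ℝ) : linScore ν m T t y = t * tailScore k ν (y ⬝ᵥ y) + linScore ν 0 T 0 y
      + linScore ν m 0 0 y := by
  simp [linScore]

lemma integral_tailScore {ν : ℝ} (hν : 0 < ν) :
    ∫ y : Fin k → ℝ, tailScore k ν (y ⬝ᵥ y) ∂(stdLaw k ν) = 0 := by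
  have := integral_linScore (k := k) hν 0 (T := 0) Matrix.isSymm_zero 1
  simpa only [linScore_tail] using this

lemma integral_radScore {ν : ℝ} (hν : 0 < ν) :
    ∫ y : Fin k → ℝ, radScore k ν (y ⬝ᵥ y) ∂(stdLaw k ν) = 0 := by
  have := integral_linScore (k := k) hν 0 (T := 1) Matrix.isSymm_one 0
  simpa only [linScore_one] using this

lemma memLp_tailScore (k : ℕ) {ν : ℝ} (hν : 0 < ν) :
    MemLp (fun y : Fin k → ℝ => tailScore k ν (y ⬝ᵥ y)) 2 (stdLaw k ν) := by
  obtain ⟨C, hC, h⟩ := exists_tailScore_bound k hν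
  have hc := continuous_comp_dotProduct (k := k) (continuousOn_tailScore k hν)
  rw [memLp_two_iff_integrable_sq hc.aestronglyMeasurable]
  refine integrable_of_le_logWeight_pow hν (hc.pow 2) (C := C ^ 2) (by positivity) (j := 2)
    (by norm_num) fun y => ?_
  rw [abs_pow, ← mul_pow]
  exact pow_le_pow_left₀ (abs_nonneg _) (h y) 2

lemma memLp_radScore (k : ℕ) {ν : ℝ} (hν : 0 < ν) :
    MemLp (fun y : Fin k → ℝ => radScore k ν (y ⬝ᵥ y)) 2 (stdLaw k ν) := by
  have := isProbabilityMeasure_stdLaw k hν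
  exact MemLp.of_bound
    (continuous_comp_dotProduct (continuousOn_radScore k hν)).aestronglyMeasurable (ν + k)
    (ae_of_all _ fun y => abs_radScore_le k hν (dotProduct_self_nonneg' y))

lemma memLp_effScore (k : ℕ) {ν : ℝ} (hν : 0 < ν) :
    MemLp (fun y : Fin k → ℝ => effScore k ν (y ⬝ᵥ y)) 2 (stdLaw k ν) :=
  (memLp_tailScore k hν).sub ((memLp_radScore k hν).const_mul _)

lemma memLp_linScore {ν : ℝ} (hν : 0 < ν) (m : Fin k → ℝ) {T : Matrix (Fin k) (Fin k) ℝ}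
    (hT : T.IsSymm) (t : ℝ) : MemLp (linScore ν m T t) 2 (stdLaw k ν) := by
  obtain ⟨C, hC, h⟩ := exists_linScore_bound k hν
  obtain ⟨d, hd⟩ := exists_isSmall m hT t
  have hc := continuous_linScore hν m T t
  rw [memLp_two_iff_integrable_sq hc.aestronglyMeasurable]
  refine integrable_of_le_logWeight_pow hν (hc.pow 2) (C := (C * d) ^ 2) (by positivity) (j := 2)
    (by norm_num) fun y => ?_
  rw [abs_pow, ← mul_pow]
  exact pow_le_pow_left₀ (abs_nonneg _) (h m T t d hd y) 2

lemma integral_effScore (k : ℕ) {ν : ℝ} (hν : 0 < ν) :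
    ∫ y : Fin k → ℝ, effScore k ν (y ⬝ᵥ y) ∂(stdLaw k ν) = 0 := by
  have := isProbabilityMeasure_stdLaw k hν
  simp only [effScore]
  rw [integral_sub ((memLp_tailScore k hν).integrable one_le_two)
    (((memLp_radScore k hν).integrable one_le_two).const_mul _), integral_const_mul,
    integral_tailScore hν, integral_radScore hν]
  simp

/-- At the origin the score equals -k/2, which is nonzero because k ≥ 1. -/
lemma integral_radScore_sq_pos (hk : 1 ≤ k) {ν : ℝ} (hν : 0 < ν) :
    0 < ∫ y : Fin k → ℝ, radScore k ν (y ⬝ᵥ y) ^ 2 ∂(stdLaw k ν) := by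
  refine lt_of_le_of_ne (integral_nonneg fun y => sq_nonneg _) fun h => ?_
  have := eq_zero_of_integral_sq_eq_zero (θ := ⟨0, 1, ν⟩) Matrix.PosDef.one hν
    (continuous_comp_dotProduct (continuousOn_radScore k hν))
    (memLp_radScore k hν).integrable_sq h.symm 0
  simp [radScore] at this
  omega

lemma integral_effScore_mul_radScore (hk : 1 ≤ k) {ν : ℝ} (hν : 0 < ν) :
    ∫ y : Fin k → ℝ, effScore k ν (y ⬝ᵥ y) * radScore k ν (y ⬝ᵥ y) ∂(stdLaw k ν) = 0 := by
  have hp := integral_radScore_sq_pos hk hν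
  have h1 : ∀ y : Fin k → ℝ, effScore k ν (y ⬝ᵥ y) * radScore k ν (y ⬝ᵥ y)
      = tailScore k ν (y ⬝ᵥ y) * radScore k ν (y ⬝ᵥ y)
        - projCoef k ν * radScore k ν (y ⬝ᵥ y) ^ 2 := fun y => by rw [effScore]; ring
  simp_rw [h1]
  have i1 : Integrable (fun y : Fin k → ℝ => tailScore k ν (y ⬝ᵥ y) * radScore k ν (y ⬝ᵥ y))
    (stdLaw k ν) := (memLp_tailScore k hν).integrable_mul (memLp_radScore k hν)
  rw [integral_sub i1 ((memLp_radScore k hν).integrable_sq.const_mul _), integral_const_mul, projCoef,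
    div_mul_cancel₀ _ hp.ne', sub_self]

lemma integral_effScore_mul_tailScore (hk : 1 ≤ k) {ν : ℝ} (hν : 0 < ν) :
    ∫ y : Fin k → ℝ, effScore k ν (y ⬝ᵥ y) * tailScore k ν (y ⬝ᵥ y) ∂(stdLaw k ν)
      = effVar k ν := by
  have h1 : ∀ y : Fin k → ℝ, effScore k ν (y ⬝ᵥ y) * tailScore k ν (y ⬝ᵥ y)
      = effScore k ν (y ⬝ᵥ y) ^ 2
        + projCoef k ν * (effScore k ν (y ⬝ᵥ y) * radScore k ν (y ⬝ᵥ y)) := fun y => by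
    rw [effScore]; ring
  simp_rw [h1]
  have i1 : Integrable (fun y : Fin k → ℝ => effScore k ν (y ⬝ᵥ y) * radScore k ν (y ⬝ᵥ y))
    (stdLaw k ν) := (memLp_effScore k hν).integrable_mul (memLp_radScore k hν)
  rw [integral_add (memLp_effScore k hν).integrable_sq (i1.const_mul _),
    integral_const_mul, integral_effScore_mul_radScore hk hν, effVar]
  simp

/-- The tail score contains an unbounded logarithm while its remaining terms and the radial score
are bounded. No multiple of the latter can therefore cancel it. -/
lemma effVar_pos (hk : 1 ≤ k) {ν : ℝ} (hν : 0 < ν) : 0 < effVar k ν := by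
  refine lt_of_le_of_ne (integral_nonneg fun y => sq_nonneg _) fun h => ?_
  have h0 := eq_zero_of_integral_sq_eq_zero (θ := ⟨0, 1, ν⟩) Matrix.PosDef.one hν
    (continuous_comp_dotProduct (k := k) (continuousOn_effScore k hν))
    (memLp_effScore k hν).integrable_sq h.symm
  set c := |deriv (fun v => Real.log (normConst k v)) ν| + (ν + k) / 2 * ν⁻¹
    + |projCoef k ν| * (ν + k) with hc
  have hlog : ∀ r : ℝ, 0 ≤ r → Real.log (1 + r / ν) ≤ 2 * c := by
    intro r hr
    -- Any vector of squared norm r would do; its existence for every r ≥ 0 requires k ≥ 1.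
    set y : Fin k → ℝ := Pi.single ⟨0, hk⟩ (√r) with hy
    have hyy : y ⬝ᵥ y = r := by rw [hy]; simp [Real.mul_self_sqrt hr]
    have h1 := h0 y
    rw [hyy, effScore, tailScore] at h1
    have h2 : r / (ν * (ν + r)) ≤ ν⁻¹ := by
      rw [← div_div, div_le_iff₀ (by positivity), div_eq_mul_inv, mul_comm]
      gcongr; linarith
    have h3 : (ν + k) / 2 * (r / (ν * (ν + r))) ≤ (ν + k) / 2 * ν⁻¹ := by gcongr
    have h4 : |projCoef k ν * radScore k ν r| ≤ |projCoef k ν| * (ν + k) := by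
      rw [abs_mul]; gcongr; exact abs_radScore_le k hν hr
    have h5 := (abs_le.mp h4).1
    have h6 := le_abs_self (deriv (fun v => Real.log (normConst k v)) ν)
    rw [hc]
    linarith
  -- This r makes log(1 + r/ν) at least 2c + 1, beyond the supposed bound 2c.
  have h1 := hlog (ν * Real.exp (2 * c + 1)) (by positivity)
  have h2 : Real.exp (2 * c + 1) ≤ 1 + ν * Real.exp (2 * c + 1) / ν := by
    rw [mul_div_cancel_left₀ _ hν.ne']; linarith
  have h3 := Real.log_le_log (Real.exp_pos _) h2
  rw [Real.log_exp] at h3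
  linarith

/-- Reflections remove the location part. For the scatter part the covariance is tr T times a factor
independent of T, and that factor vanishes because the direction T = 1 gives the radial score, to
which the efficient score is orthogonal by construction. Only the tail component survives. -/
theorem integral_effScore_mul_linScore (hk : 1 ≤ k) {ν : ℝ} (hν : 0 < ν) (m : Fin k → ℝ)
    {T : Matrix (Fin k) (Fin k) ℝ} (hT : T.IsSymm) (t : ℝ) :
    ∫ y, effScore k ν (y ⬝ᵥ y) * linScore ν m T t y ∂(stdLaw k ν) = t * effVar k ν := by
  have := isProbabilityMeasure_stdLaw k hν
  have hk0 : (k : ℝ) ≠ 0 := by positivity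
  have hg := memLp_effScore k hν
  have hgm := measurable_effScore k ν
  have hgi := hg.integrable one_le_two
  have hbd : ∀ i j, Integrable (fun y : Fin k → ℝ =>
      effScore k ν (y ⬝ᵥ y) / (ν + y ⬝ᵥ y) * (y i * y j)) (stdLaw k ν) := by
    intro i j
    refine hgi.mono (by simp only [dotProduct]; fun_prop) (ae_of_all _ fun y => ?_)
    have hr := dotProduct_self_nonneg' y
    have hN : 0 < ν + y ⬝ᵥ y := by positivity
    rw [norm_mul, norm_div, Real.norm_eq_abs, Real.norm_eq_abs (ν + _), abs_of_pos hN,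
      div_mul_eq_mul_div, div_le_iff₀ hN, Real.norm_eq_abs]
    gcongr
    rw [abs_mul]
    have h1 := Real.abs_le_sqrt (sq_le_dotProduct_self y i)
    have h2 := Real.abs_le_sqrt (sq_le_dotProduct_self y j)
    calc |y i| * |y j| ≤ √(y ⬝ᵥ y) * √(y ⬝ᵥ y) := by gcongr
      _ = y ⬝ᵥ y := Real.mul_self_sqrt hr
      _ ≤ _ := by linarith
  have hquad := integral_radial_mul_quadForm (φ := fun r => effScore k ν r / (ν + r))
    (by fun_prop) hbd
  have hgr := integral_effScore_mul_radScore hk hν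
  have hg0 := integral_effScore k hν
  have hqi : ∀ T : Matrix (Fin k) (Fin k) ℝ, T.IsSymm → Integrable (fun y : Fin k → ℝ =>
      effScore k ν (y ⬝ᵥ y) / (ν + y ⬝ᵥ y) * (y ⬝ᵥ T *ᵥ y)) (stdLaw k ν) := by
    intro T _
    have h1 : ∀ y : Fin k → ℝ, effScore k ν (y ⬝ᵥ y) / (ν + y ⬝ᵥ y) * (y ⬝ᵥ T *ᵥ y)
        = ∑ i, ∑ j, T i j * (effScore k ν (y ⬝ᵥ y) / (ν + y ⬝ᵥ y) * (y i * y j)) := by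
      intro y
      simp only [dotProduct, mulVec, Finset.mul_sum]
      exact Finset.sum_congr rfl fun i _ => Finset.sum_congr rfl fun j _ => by ring
    simp_rw [h1]
    exact integrable_finsetSum _ fun i _ => integrable_finsetSum _ fun j _ =>
      (hbd i j).const_mul _
  have hTint : ∀ T : Matrix (Fin k) (Fin k) ℝ, T.IsSymm →
      k * ∫ y, effScore k ν (y ⬝ᵥ y) * linScore ν 0 T 0 y ∂(stdLaw k ν)
        = T.trace * ((ν + k) / 2 * ∫ y : Fin k → ℝ, effScore k ν (y ⬝ᵥ y) / (ν + y ⬝ᵥ y) *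
            (y ⬝ᵥ y) ∂(stdLaw k ν)) := by
    intro T hT
    have h1 : ∀ y : Fin k → ℝ, effScore k ν (y ⬝ᵥ y) * linScore ν 0 T 0 y
        = -(T.trace) / 2 * effScore k ν (y ⬝ᵥ y)
          + (ν + k) / 2 * (effScore k ν (y ⬝ᵥ y) / (ν + y ⬝ᵥ y) * (y ⬝ᵥ T *ᵥ y)) := by
      intro y; simp only [linScore, zero_mul, zero_dotProduct, zero_div, mul_zero]; ring
    simp_rw [h1]
    rw [integral_add (hgi.const_mul _) ((hqi T hT).const_mul _), integral_const_mul,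
      integral_const_mul, hg0]
    linear_combination (ν + k) / 2 * hquad T
  -- The case T = 1 determines the common factor; nonvanishing of the trace k is what makes it zero.
  have hone := hTint 1 Matrix.isSymm_one
  simp only [linScore_one, hgr, mul_zero, Matrix.trace_one, Fintype.card_fin] at hone
  have hrad : (ν + k) / 2 * ∫ y : Fin k → ℝ, effScore k ν (y ⬝ᵥ y) / (ν + y ⬝ᵥ y) *
      (y ⬝ᵥ y) ∂(stdLaw k ν) = 0 := by
    rcases mul_eq_zero.mp hone.symm with h | h
    · exact absurd h hk0
    · exact h
  have hT0 : ∫ y, effScore k ν (y ⬝ᵥ y) * linScore ν 0 T 0 y ∂(stdLaw k ν) = 0 := by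
    have := hTint T hT
    rw [hrad, mul_zero] at this
    exact (mul_eq_zero.mp this).resolve_left hk0
  have hm0 : ∫ y, effScore k ν (y ⬝ᵥ y) * linScore ν m 0 0 y ∂(stdLaw k ν) = 0 := by
    have hci : ∀ i, Integrable (fun y : Fin k → ℝ =>
        effScore k ν (y ⬝ᵥ y) / (ν + y ⬝ᵥ y) * y i) (stdLaw k ν) := by
      intro i
      refine (hgi.const_mul (1 + ν⁻¹)).mono (by simp only [dotProduct]; fun_prop)
        (ae_of_all _ fun y => ?_)
      have hr := dotProduct_self_nonneg' y
      have hN : 0 < ν + y ⬝ᵥ y := by positivity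
      rw [norm_mul, norm_div, Real.norm_eq_abs, Real.norm_eq_abs (ν + _), abs_of_pos hN,
        div_mul_eq_mul_div, div_le_iff₀ hN, Real.norm_eq_abs, norm_mul, Real.norm_eq_abs,
        Real.norm_eq_abs, abs_of_pos (show 0 < 1 + ν⁻¹ by positivity)]
      have h1 := abs_le_sqrt_one_add y i
      have h6 : √(1 + y ⬝ᵥ y) ≤ (1 + ν⁻¹) * (ν + y ⬝ᵥ y) :=
        le_trans (Real.sqrt_le_iff.mpr ⟨by positivity, by nlinarith⟩) (one_add_le_mul hν hr)
      calc |effScore k ν (y ⬝ᵥ y)| * |y i|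
          ≤ |effScore k ν (y ⬝ᵥ y)| * ((1 + ν⁻¹) * (ν + y ⬝ᵥ y)) := by
            gcongr; exact h1.trans h6
        _ = _ := by ring
    have h1 : ∀ y : Fin k → ℝ, effScore k ν (y ⬝ᵥ y) * linScore ν m 0 0 y
        = ∑ i, (ν + k) * m i * (effScore k ν (y ⬝ᵥ y) / (ν + y ⬝ᵥ y) * y i) := by
      intro y
      simp only [linScore, zero_mul, Matrix.trace_zero, Matrix.zero_mulVec, dotProduct_zero,
        neg_zero, zero_div, mul_zero, add_zero, zero_add]
      rw [show m ⬝ᵥ y = ∑ i, m i * y i from rfl, Finset.sum_div, Finset.mul_sum, Finset.mul_sum]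
      exact Finset.sum_congr rfl fun i _ => by ring
    simp_rw [h1]
    rw [integral_finsetSum _ fun i _ => (hci i).const_mul _]
    refine Finset.sum_eq_zero fun i _ => ?_
    rw [integral_const_mul,
      integral_radial_mul_coord (φ := fun r => effScore k ν r / (ν + r)) (by fun_prop), mul_zero]
  have hsplit : ∀ y : Fin k → ℝ, effScore k ν (y ⬝ᵥ y) * linScore ν m T t y
      = t * (effScore k ν (y ⬝ᵥ y) * tailScore k ν (y ⬝ᵥ y))
        + effScore k ν (y ⬝ᵥ y) * linScore ν 0 T 0 y
        + effScore k ν (y ⬝ᵥ y) * linScore ν m 0 0 y := by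
    intro y; rw [linScore_add ν m T t y]; ring
  simp_rw [hsplit]
  have i1 := (hg.integrable_mul (memLp_tailScore k hν)).const_mul t
  have i2 := hg.integrable_mul (memLp_linScore hν (0 : Fin k → ℝ) hT 0)
  have i3 := hg.integrable_mul (memLp_linScore hν m (T := 0) Matrix.isSymm_zero 0)
  have e1 := integral_add (i1.add i2) i3
  have e2 := integral_add i1 i2
  simp only [Pi.add_apply, Pi.mul_apply] at e1 e2
  rw [e1, e2, integral_const_mul, integral_effScore_mul_tailScore hk hν, hT0, hm0]
  ring

section

/-! ### Integrated expansions at the standard parameter -/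

/-- With z = iσg the comparison term keeps eᵘ, whose integral is exactly 1, together with z(1 + ℓ)
and z²/2. The remainder has three pieces: the cubic Taylor error of e^z times eᵘ, z times the
second-order error of eᵘ, and z²/2 times eᵘ - 1. -/
lemma norm_charFun_remainder_le {g u ℓ σ C d W : ℝ} (hC : 1 ≤ C) (hd : 0 ≤ d) (hW : 1 ≤ W)
    (hg : |g| ≤ C * W) (hu : |u| ≤ C * d * W)
    (h1 : |Real.exp u - 1| ≤ C * d * W * Real.exp (C * d * W))
    (h2 : |Real.exp u - 1 - ℓ| ≤ 2 * C ^ 2 * d ^ 2 * (W ^ 2 * Real.exp (C * d * W))) :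
    ‖Complex.exp ((σ * g : ℝ) * Complex.I) * Real.exp u
      - (Real.exp u + (σ : ℂ) * Complex.I * ((g + g * ℓ : ℝ) : ℂ)
          - ((σ ^ 2 / 2 * g ^ 2 : ℝ) : ℂ))‖
      ≤ 2 * C ^ 3 * (|σ| * d ^ 2 + σ ^ 2 * d + |σ| ^ 3)
          * (W ^ 3 * Real.exp ((C * |σ| + C * d) * W)) := by
  set z : ℂ := ((σ * g : ℝ) : ℂ) * Complex.I with hz
  have hzn : ‖z‖ ≤ |σ| * (C * W) := by
    rw [hz, norm_mul, Complex.norm_I, mul_one, Complex.norm_real, Real.norm_eq_abs, abs_mul]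
    gcongr
  have hz2 : z ^ 2 = -((σ ^ 2 * g ^ 2 : ℝ) : ℂ) := by
    rw [hz, mul_pow, Complex.I_sq]; push_cast; ring
  have key : Complex.exp z * Real.exp u
      - (Real.exp u + (σ : ℂ) * Complex.I * ((g + g * ℓ : ℝ) : ℂ)
          - ((σ ^ 2 / 2 * g ^ 2 : ℝ) : ℂ))
      = (Complex.exp z - ∑ m ∈ Finset.range 3, z ^ m / (m.factorial : ℂ)) * (Real.exp u : ℝ)
        + z * ((Real.exp u - 1 - ℓ : ℝ) : ℂ)
        - ((σ ^ 2 * g ^ 2 / 2 * (Real.exp u - 1) : ℝ) : ℂ) := by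
    simp only [Finset.sum_range_succ, Finset.sum_range_zero, Nat.factorial, pow_zero, pow_one, hz2]
    rw [hz]
    push_cast
    ring
  have hE1 : Real.exp u ≤ Real.exp (C * d * W) :=
    Real.exp_le_exp.mpr ((le_abs_self _).trans hu)
  have hF : Real.exp ‖z‖ ≤ Real.exp (|σ| * (C * W)) := Real.exp_le_exp.mpr hzn
  have hprod : Real.exp (|σ| * (C * W)) * Real.exp (C * d * W)
      = Real.exp ((C * |σ| + C * d) * W) := by rw [← Real.exp_add]; congr 1; ring
  have hle : Real.exp (C * d * W) ≤ Real.exp ((C * |σ| + C * d) * W) := by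
    refine Real.exp_le_exp.mpr ?_
    have : 0 ≤ C * |σ| * W := by positivity
    linarith
  set E := Real.exp ((C * |σ| + C * d) * W) with hE
  have hE0 : 0 < E := Real.exp_pos _
  have b1 : ‖(Complex.exp z - ∑ m ∈ Finset.range 3, z ^ m / (m.factorial : ℂ)) * (Real.exp u : ℝ)‖
      ≤ C ^ 3 * |σ| ^ 3 * (W ^ 3 * E) := by
    rw [norm_mul, Complex.norm_real, Real.norm_eq_abs, abs_of_pos (Real.exp_pos _)]
    calc _ ≤ (‖z‖ ^ 3 * Real.exp ‖z‖) * Real.exp (C * d * W) := by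
          gcongr; exact Complex.norm_exp_sub_sum_le_norm_mul_exp z 3
      _ ≤ ((|σ| * (C * W)) ^ 3 * Real.exp (|σ| * (C * W))) * Real.exp (C * d * W) := by gcongr
      _ = C ^ 3 * |σ| ^ 3 * (W ^ 3 * E) := by rw [← hprod]; ring
  have b2 : ‖z * ((Real.exp u - 1 - ℓ : ℝ) : ℂ)‖ ≤ 2 * C ^ 3 * (|σ| * d ^ 2) * (W ^ 3 * E) := by
    rw [norm_mul, Complex.norm_real, Real.norm_eq_abs]
    calc _ ≤ (|σ| * (C * W)) * (2 * C ^ 2 * d ^ 2 * (W ^ 2 * Real.exp (C * d * W))) := by gcongr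
      _ ≤ (|σ| * (C * W)) * (2 * C ^ 2 * d ^ 2 * (W ^ 2 * E)) := by gcongr
      _ = _ := by ring
  have b3 : ‖((σ ^ 2 * g ^ 2 / 2 * (Real.exp u - 1) : ℝ) : ℂ)‖
      ≤ C ^ 3 * (σ ^ 2 * d) * (W ^ 3 * E) := by
    rw [Complex.norm_real, Real.norm_eq_abs, abs_mul, abs_of_nonneg (by positivity)]
    have hg2 : g ^ 2 ≤ (C * W) ^ 2 := by rw [← sq_abs]; gcongr
    calc _ ≤ (σ ^ 2 * (C * W) ^ 2 / 2) * (C * d * W * E) := by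
          gcongr
          exact h1.trans (by gcongr)
      _ = 1 / 2 * (C ^ 3 * (σ ^ 2 * d) * (W ^ 3 * E)) := by ring
      _ ≤ _ := by
          have : 0 ≤ C ^ 3 * (σ ^ 2 * d) * (W ^ 3 * E) := by positivity
          linarith
  rw [key]
  refine (norm_sub_le _ _).trans ((add_le_add (norm_add_le _ _) le_rfl).trans ?_)
  have p1 : 0 ≤ C ^ 3 * |σ| ^ 3 * (W ^ 3 * E) := by positivity
  have p2 : 0 ≤ C ^ 3 * (σ ^ 2 * d) * (W ^ 3 * E) := by positivity
  calc _ ≤ C ^ 3 * |σ| ^ 3 * (W ^ 3 * E) + 2 * C ^ 3 * (|σ| * d ^ 2) * (W ^ 3 * E)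
        + C ^ 3 * (σ ^ 2 * d) * (W ^ 3 * E) := add_le_add (add_le_add b1 b2) b3
    _ ≤ 2 * (C ^ 3 * |σ| ^ 3 * (W ^ 3 * E)) + 2 * C ^ 3 * (|σ| * d ^ 2) * (W ^ 3 * E)
        + 2 * (C ^ 3 * (σ ^ 2 * d) * (W ^ 3 * E)) := by linarith
    _ = _ := by ring

section Integrated

variable {ν C d : ℝ} {m : Fin k → ℝ} {T : Matrix (Fin k) (Fin k) ℝ} {t : ℝ}

/-- The mean of the efficient score under the displaced law is, to first order, its covariance with
the displacement's score. By orthogonality this is t · `effVar`, free of the location and scatter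
displacements. The shift under local alternatives is thus obtained directly, without a joint limit
with the likelihood ratio. -/
theorem LogRatioBound.norm_charFun_sub_le (hk : 1 ≤ k) (hν : 0 < ν) (hC : 1 ≤ C) (hd : 0 ≤ d)
    (hCd : C * d ≤ ν / 32) (hT : T.IsSymm)
    (hg : ∀ y : Fin k → ℝ, |effScore k ν (y ⬝ᵥ y)| ≤ C * logWeight ν y)
    (b : LogRatioBound ν C d m T t) {σ : ℝ} (hσ : C * |σ| ≤ ν / 32) :
    ‖∫ y, Complex.exp ((σ * effScore k ν (y ⬝ᵥ y) : ℝ) * Complex.I) ∂(law ⟨m, 1 + T, ν + t⟩)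
      - (1 + (σ : ℂ) * Complex.I * ((t * effVar k ν : ℝ) : ℂ)
          - ((σ ^ 2 / 2 * effVar k ν : ℝ) : ℂ))‖
      ≤ 2 * C ^ 3 * (|σ| * d ^ 2 + σ ^ 2 * d + |σ| ^ 3) * powConst ν * expWeightIntegral k ν := by
  have := isProbabilityMeasure_stdLaw k hν
  have hgL := memLp_effScore k hν
  have hgi := hgL.integrable one_le_two
  have hlL := memLp_linScore hν m hT t
  have hgl : Integrable (fun y : Fin k → ℝ => effScore k ν (y ⬝ᵥ y) * linScore ν m T t y)
    (stdLaw k ν) := hgL.integrable_mul hlL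
  have hue := b.integrable_exp hν hCd
  have hgm : Measurable fun y : Fin k → ℝ => effScore k ν (y ⬝ᵥ y) :=
    (continuous_comp_dotProduct (continuousOn_effScore k hν)).measurable
  have i1 : Integrable (fun y : Fin k → ℝ =>
      effScore k ν (y ⬝ᵥ y) + effScore k ν (y ⬝ᵥ y) * linScore ν m T t y) (stdLaw k ν) :=
    hgi.add hgl
  have i2 : Integrable (fun y : Fin k → ℝ => σ ^ 2 / 2 * effScore k ν (y ⬝ᵥ y) ^ 2)
      (stdLaw k ν) := hgL.integrable_sq.const_mul _
  have j1 : Integrable (fun y : Fin k → ℝ => (Real.exp (logRatio ν m T t y) : ℂ))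
      (stdLaw k ν) := hue.ofReal
  have j2 : Integrable (fun y : Fin k → ℝ => (σ : ℂ) * Complex.I *
      ((effScore k ν (y ⬝ᵥ y) + effScore k ν (y ⬝ᵥ y) * linScore ν m T t y : ℝ) : ℂ))
      (stdLaw k ν) := i1.ofReal.const_mul _
  have j3 : Integrable (fun y : Fin k → ℝ => ((σ ^ 2 / 2 * effScore k ν (y ⬝ᵥ y) ^ 2 : ℝ) : ℂ))
      (stdLaw k ν) := i2.ofReal
  have j12 : Integrable (fun y : Fin k → ℝ => (Real.exp (logRatio ν m T t y) : ℂ)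
      + (σ : ℂ) * Complex.I *
      ((effScore k ν (y ⬝ᵥ y) + effScore k ν (y ⬝ᵥ y) * linScore ν m T t y : ℝ) : ℂ))
      (stdLaw k ν) := j1.add j2
  have hmain : (1 + (σ : ℂ) * Complex.I * ((t * effVar k ν : ℝ) : ℂ)
          - ((σ ^ 2 / 2 * effVar k ν : ℝ) : ℂ))
      = ∫ y : Fin k → ℝ, ((Real.exp (logRatio ν m T t y) : ℂ) + (σ : ℂ) * Complex.I *
        ((effScore k ν (y ⬝ᵥ y) + effScore k ν (y ⬝ᵥ y) * linScore ν m T t y : ℝ) : ℂ)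
        - ((σ ^ 2 / 2 * effScore k ν (y ⬝ᵥ y) ^ 2 : ℝ) : ℂ)) ∂(stdLaw k ν) := by
    rw [integral_sub j12 j3, integral_add j1 j2, integral_const_mul, integral_complex_ofReal,
      integral_complex_ofReal, integral_complex_ofReal, integral_exp_logRatio hν b.posDef b.tail_pos,
      integral_add hgi hgl, integral_const_mul, integral_effScore k hν,
      integral_effScore_mul_linScore hk hν m hT t, zero_add, effVar, Complex.ofReal_one]
  have hexpi : Integrable (fun y : Fin k → ℝ =>
      Complex.exp ((σ * effScore k ν (y ⬝ᵥ y) : ℝ) * Complex.I) * Real.exp (logRatio ν m T t y))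
      (stdLaw k ν) := by
    refine hue.ofReal.bdd_mul (c := 1) ?_ (ae_of_all _ fun y => ?_)
    · exact (Complex.measurable_exp.comp
        ((Complex.measurable_ofReal.comp (hgm.const_mul σ)).mul_const _)).aestronglyMeasurable
    · rw [Complex.norm_exp_ofReal_mul_I]
  rw [integral_law_eq hν b.posDef b.tail_pos, hmain]
  have hsm : ∀ y : Fin k → ℝ, Real.exp (logRatio ν m T t y) •
      Complex.exp ((σ * effScore k ν (y ⬝ᵥ y) : ℝ) * Complex.I)
      = Complex.exp ((σ * effScore k ν (y ⬝ᵥ y) : ℝ) * Complex.I)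
        * Real.exp (logRatio ν m T t y) := fun y => by
    rw [Complex.real_smul, mul_comm]
  simp_rw [hsm]
  have j123 : Integrable (fun y : Fin k → ℝ => (Real.exp (logRatio ν m T t y) : ℂ)
      + (σ : ℂ) * Complex.I *
      ((effScore k ν (y ⬝ᵥ y) + effScore k ν (y ⬝ᵥ y) * linScore ν m T t y : ℝ) : ℂ)
      - ((σ ^ 2 / 2 * effScore k ν (y ⬝ᵥ y) ^ 2 : ℝ) : ℂ)) (stdLaw k ν) := j12.sub j3
  rw [← integral_sub hexpi j123]
  refine norm_integral_le_expWeight hν fun y => ?_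
  refine (norm_charFun_remainder_le hC hd (one_le_logWeight hν y) (hg y) (b.le y)
    (b.abs_exp_sub_one_le hd hC hν y) (b.abs_exp_sub_one_sub_lin_le hd hC hν y)).trans ?_
  rw [mul_assoc _ (powConst ν)]
  refine mul_le_mul_of_nonneg_left (logWeight_pow_mul_exp_le hν (by norm_num) (by linarith) y) ?_
  positivity

theorem LogRatioBound.integrable_exp_sq (hν : 0 < ν)
    (hCd : C * d ≤ ν / 32) (b : LogRatioBound ν C d m T t) :
    Integrable (fun y => Real.exp (logRatio ν m T t y) ^ 2) (stdLaw k ν) := by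
  refine integrable_of_le_expWeight hν (C := powConst ν)
    ((measurable_logRatio ν m T t).exp.pow_const 2).aestronglyMeasurable fun y => ?_
  rw [Real.norm_eq_abs, abs_of_pos (by positivity), ← Real.exp_nat_mul]
  refine le_trans ?_ (logWeight_pow_mul_exp_le hν (j := 0) (b := 2 * (C * d)) (by norm_num)
    (by linarith) y)
  rw [pow_zero, one_mul, Real.exp_le_exp]
  have := (le_abs_self _).trans (b.le y)
  push_cast
  linarith

/-- Since the ratio has mean 1, the excess over 1 is the χ²-divergence ∫(eᵘ - 1)², of order d². For
n observations and d of order n^{-1/2} this keeps the product ratio bounded in L². -/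
theorem LogRatioBound.integral_exp_sq_le (hν : 0 < ν) (hC : 1 ≤ C) (hd : 0 ≤ d)
    (hCd : C * d ≤ ν / 32) (b : LogRatioBound ν C d m T t) :
    ∫ y, Real.exp (logRatio ν m T t y) ^ 2 ∂(stdLaw k ν)
      ≤ 1 + C ^ 2 * d ^ 2 * powConst ν * expWeightIntegral k ν := by
  have := isProbabilityMeasure_stdLaw k hν
  have hue := b.integrable_exp hν hCd
  have hu2 := b.integrable_exp_sq hν hCd
  have h1 : ∫ y, (Real.exp (logRatio ν m T t y) - 1) ^ 2 ∂(stdLaw k ν)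
      = ∫ y, Real.exp (logRatio ν m T t y) ^ 2 ∂(stdLaw k ν) - 1 := by
    have e : ∀ y, (Real.exp (logRatio ν m T t y) - 1) ^ 2
        = Real.exp (logRatio ν m T t y) ^ 2 - (2 * Real.exp (logRatio ν m T t y) - 1) :=
      fun y => by ring
    have i1 : Integrable (fun y => 2 * Real.exp (logRatio ν m T t y) - 1) (stdLaw k ν) :=
      (hue.const_mul 2).sub (integrable_const _)
    simp_rw [e]
    rw [integral_sub hu2 i1, integral_sub (hue.const_mul 2) (integrable_const _),
      integral_const_mul, integral_exp_logRatio hν b.posDef b.tail_pos]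
    simp
    norm_num
  have h2 := norm_integral_le_expWeight (k := k) hν
    (f := fun y => (Real.exp (logRatio ν m T t y) - 1) ^ 2)
    (C := C ^ 2 * d ^ 2 * powConst ν) fun y => by
      rw [mul_assoc, Real.norm_eq_abs, abs_pow]
      have hW := one_le_logWeight hν y
      calc |Real.exp (logRatio ν m T t y) - 1| ^ 2
          ≤ (C * d * logWeight ν y * Real.exp (C * d * logWeight ν y)) ^ 2 :=
            pow_le_pow_left₀ (abs_nonneg _) (b.abs_exp_sub_one_le hd hC hν y) 2
        _ = C ^ 2 * d ^ 2 * (logWeight ν y ^ 2 * Real.exp ((2 * (C * d)) * logWeight ν y)) := by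
            rw [mul_pow _ (Real.exp _), ← Real.exp_nat_mul]; push_cast; ring_nf
        _ ≤ _ := mul_le_mul_of_nonneg_left
            (logWeight_pow_mul_exp_le hν (by norm_num) (by linarith) y) (by positivity)
  rw [h1, Real.norm_eq_abs] at h2
  have := (le_abs_self _).trans h2
  linarith

/-- The efficient score depends on r only through log(ν + r) and r/(ν + r), whose increments are
controlled by the ratio ρ alone, however large r is. -/
lemma abs_effScore_sub_le (k : ℕ) (hν : 0 < ν) {r r' : ℝ} (hr : 0 ≤ r) (hr' : 0 ≤ r')
    {a : ℝ} (ha : |(ν + r') / (ν + r) - 1| ≤ a) (ha2 : a ≤ 1 / 2) :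
    |effScore k ν r' - effScore k ν r|
      ≤ (1 + (ν + k) / ν + |projCoef k ν| * (ν + k)) * a := by
  have hN : 0 < ν + r := by positivity
  have hN' : 0 < ν + r' := by positivity
  set ρ := (ν + r') / (ν + r) with hρ
  have hρ0 : 0 < ρ := by positivity
  have ha0 : 0 ≤ a := (abs_nonneg _).trans ha
  have hab := abs_le.mp ha
  have hlog : Real.log (1 + r' / ν) - Real.log (1 + r / ν) = Real.log ρ := by
    rw [← Real.log_div (by positivity) (by positivity), hρ]
    congr 1
    field_simp
  have hfr : r' / (ν + r') - r / (ν + r) = ν / (ν + r) * (1 - ρ⁻¹) := by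
    rw [hρ]; field_simp; ring
  have hL : |Real.log ρ| ≤ 2 * a := by
    have h1 := abs_log_sub_le (ha.trans ha2)
    have h2 : (ρ - 1) ^ 2 ≤ a * (1 / 2) := by
      rw [← sq_abs, sq]; exact mul_le_mul ha (ha.trans ha2) (abs_nonneg _) ha0
    have h3 := abs_le.mp h1
    rw [abs_le]; constructor <;> linarith
  have hinv : |1 - ρ⁻¹| ≤ 2 * a := by
    have : 1 - ρ⁻¹ = (ρ - 1) * ρ⁻¹ := by field_simp
    rw [this, abs_mul, abs_of_pos (inv_pos.mpr hρ0), mul_comm]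
    have : ρ⁻¹ ≤ 2 := by rw [inv_le_comm₀ hρ0 two_pos]; linarith
    gcongr
  have hF : |r' / (ν + r') - r / (ν + r)| ≤ 2 * a := by
    rw [hfr, abs_mul, abs_of_pos (by positivity)]
    have : ν / (ν + r) ≤ 1 := by rw [div_le_one hN]; linarith
    calc ν / (ν + r) * |1 - ρ⁻¹| ≤ 1 * (2 * a) := by gcongr
      _ = _ := one_mul _
  have key : effScore k ν r' - effScore k ν r = -(Real.log ρ / 2)
      + (ν + k) / (2 * ν) * (r' / (ν + r') - r / (ν + r))
      - projCoef k ν * ((ν + k) / 2 * (r' / (ν + r') - r / (ν + r))) := by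
    rw [← hlog]
    simp only [effScore, tailScore, radScore]
    field_simp
    ring
  rw [key]
  refine (abs_sub _ _).trans ((add_le_add (abs_add_le _ _) le_rfl).trans ?_)
  rw [abs_neg, abs_div, abs_two, abs_mul, abs_mul, abs_mul,
    abs_of_nonneg (show 0 ≤ (ν + k) / (2 * ν) by positivity),
    abs_of_nonneg (show 0 ≤ (ν + k) / 2 by positivity)]
  calc _ ≤ 2 * a / 2 + (ν + k) / (2 * ν) * (2 * a)
        + |projCoef k ν| * ((ν + k) / 2 * (2 * a)) := by gcongr
    _ = _ := by field_simp

lemma integral_comp_mahalanobisSq {θ : StudentParam k} (hS : θ.scatter.PosDef)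
    {F : ℝ → ℝ} (hF : Measurable F) :
    ∫ x, F (mahalanobisSq θ x) ∂(law θ) = ∫ y : Fin k → ℝ, F (y ⬝ᵥ y) ∂(stdLaw k θ.tail) := by
  obtain ⟨A, hA, hAS⟩ := exists_mul_transpose_eq hS
  have h1 : law θ = (stdLaw k θ.tail).map fun y => θ.loc + A *ᵥ y :=
    law_eq_map hA hAS θ.loc θ.tail
  have hm : Measurable fun x => F (mahalanobisSq θ x) :=
    hF.comp (continuous_mahalanobisSq θ).measurable
  rw [h1, integral_map (by fun_prop) hm.aestronglyMeasurable]
  refine integral_congr_ae (ae_of_all _ fun y => ?_)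
  have h2 := mahalanobisSq_push hA θ.loc ⟨0, 1, θ.tail⟩ y
  rw [push_std hAS, mahalanobisSq_std] at h2
  beta_reduce
  rw [← h2]

theorem LogRatioBound.abs_effScore_sub_le (hν : 0 < ν) (hCd : C * d ≤ 1 / 2)
    (b : LogRatioBound ν C d m T 0) (y : Fin k → ℝ) :
    |effScore k ν (mahalanobisSq ⟨m, 1 + T, ν⟩ y) - effScore k ν (y ⬝ᵥ y)|
      ≤ (1 + (ν + k) / ν + |projCoef k ν| * (ν + k)) * (C * d) := by
  have h := b.ratio_le y
  rw [add_zero] at h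
  exact StudentT.abs_effScore_sub_le k hν (dotProduct_self_nonneg' y)
    (mahalanobisSq_nonneg (θ := ⟨m, 1 + T, ν⟩) b.posDef y) h hCd

/-- The efficient score is insensitive to nuisance errors to first order. Pointwise its change g' -
g is only O(d), but g' is centered under the displaced law, g under the standard one, and g is
orthogonal to the nuisance score ℓ. The mean change is therefore the integral of -g(eᵘ - 1 - ℓ) -
(g' - g)(eᵘ - 1), which is O(d²). -/
theorem LogRatioBound.abs_integral_effScore_sub_le (hk : 1 ≤ k) (hν : 0 < ν) (hC : 1 ≤ C)
    (hd : 0 ≤ d) (hCd : C * d ≤ ν / 32) (hCd2 : C * d ≤ 1 / 2) (hT : T.IsSymm)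
    (hg : ∀ y : Fin k → ℝ, |effScore k ν (y ⬝ᵥ y)| ≤ C * logWeight ν y)
    (b : LogRatioBound ν C d m T 0) :
    |∫ y, (effScore k ν (mahalanobisSq ⟨m, 1 + T, ν⟩ y) - effScore k ν (y ⬝ᵥ y)) ∂(stdLaw k ν)|
      ≤ (2 * C ^ 3 + (1 + (ν + k) / ν + |projCoef k ν| * (ν + k)) * C ^ 2) * d ^ 2
        * powConst ν * expWeightIntegral k ν := by
  have := isProbabilityMeasure_stdLaw k hν
  set B := 1 + (ν + k) / ν + |projCoef k ν| * (ν + k) with hB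
  have hB0 : 0 ≤ B := by positivity
  have hgL := memLp_effScore k hν
  have hgi := hgL.integrable one_le_two
  have hgl : Integrable (fun y : Fin k → ℝ => effScore k ν (y ⬝ᵥ y) * linScore ν m T 0 y)
    (stdLaw k ν) := hgL.integrable_mul (memLp_linScore hν m hT 0)
  have hue := b.integrable_exp hν hCd
  set g' : (Fin k → ℝ) → ℝ := fun y => effScore k ν (mahalanobisSq ⟨m, 1 + T, ν⟩ y) with hg'
  have hg'm : Measurable g' :=
    (measurable_effScore k ν).comp (continuous_mahalanobisSq _).measurable
  have hDb : ∀ y, |g' y - effScore k ν (y ⬝ᵥ y)| ≤ B * (C * d) := fun y =>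
    b.abs_effScore_sub_le hν hCd2 y
  have hDi : Integrable (fun y => g' y - effScore k ν (y ⬝ᵥ y)) (stdLaw k ν) :=
    Integrable.of_bound (hg'm.aestronglyMeasurable.sub hgi.1) _ (ae_of_all _ hDb)
  -- The displaced score is integrated under its own law, where it has the distribution of the
  -- standard one.
  have hzero : ∫ y, Real.exp (logRatio ν m T 0 y) * g' y ∂(stdLaw k ν) = 0 := by
    have h1 := integral_law_eq hν b.posDef b.tail_pos (m := m) g'
    have h2 := integral_comp_mahalanobisSq (θ := ⟨m, 1 + T, ν + 0⟩) b.posDef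
      (measurable_effScore k ν)
    simp only [add_zero] at h1 h2
    simp only [smul_eq_mul] at h1
    rw [← h1, hg', h2, integral_effScore k hν]
  have hgb : ∀ y : Fin k → ℝ, ‖Real.exp (logRatio ν m T 0 y) * g' y‖
      ≤ (C + B * C * d) * powConst ν * expWeight ν y := by
    intro y
    have hW := one_le_logWeight hν y
    rw [norm_mul, Real.norm_eq_abs, Real.norm_eq_abs, abs_of_pos (Real.exp_pos _)]
    have h1 : |g' y| ≤ (C + B * C * d) * logWeight ν y := by
      have : g' y = effScore k ν (y ⬝ᵥ y) + (g' y - effScore k ν (y ⬝ᵥ y)) := by ring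
      rw [this]
      refine (abs_add_le _ _).trans ?_
      have h3 : B * (C * d) ≤ B * (C * d) * logWeight ν y :=
        le_mul_of_one_le_right (by positivity) hW
      have h4 := hg y
      have h5 := hDb y
      linarith
    have h2 : Real.exp (logRatio ν m T 0 y) ≤ Real.exp (C * d * logWeight ν y) :=
      Real.exp_le_exp.mpr ((le_abs_self _).trans (b.le y))
    have h3 := logWeight_pow_mul_exp_le (k := k) hν (j := 1) (b := C * d) (by norm_num)
      (by linarith) y
    calc _ ≤ Real.exp (C * d * logWeight ν y) * ((C + B * C * d) * logWeight ν y) := by gcongr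
      _ = (C + B * C * d) * (logWeight ν y ^ 1 * Real.exp (C * d * logWeight ν y)) := by ring
      _ ≤ (C + B * C * d) * (powConst ν * expWeight ν y) := by gcongr
      _ = _ := by ring
  have hgei : Integrable (fun y => Real.exp (logRatio ν m T 0 y) * g' y) (stdLaw k ν) :=
    integrable_of_le_expWeight hν
      ((measurable_logRatio ν m T 0).exp.mul hg'm).aestronglyMeasurable hgb
  have i3 : Integrable (fun y : Fin k → ℝ => effScore k ν (y ⬝ᵥ y)
      + effScore k ν (y ⬝ᵥ y) * linScore ν m T 0 y) (stdLaw k ν) := hgi.add hgl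
  have i4 : Integrable (fun y : Fin k → ℝ => g' y - effScore k ν (y ⬝ᵥ y)
      - Real.exp (logRatio ν m T 0 y) * g' y) (stdLaw k ν) := hDi.sub hgei
  have hrew : ∫ y, (g' y - effScore k ν (y ⬝ᵥ y)) ∂(stdLaw k ν)
      = ∫ y, (g' y - effScore k ν (y ⬝ᵥ y) - Real.exp (logRatio ν m T 0 y) * g' y
        + (effScore k ν (y ⬝ᵥ y) + effScore k ν (y ⬝ᵥ y) * linScore ν m T 0 y)) ∂(stdLaw k ν) := by
    rw [integral_add i4 i3, integral_sub hDi hgei, hzero, integral_add hgi hgl,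
      integral_effScore k hν, integral_effScore_mul_linScore hk hν m hT 0]
    ring
  rw [hrew, ← Real.norm_eq_abs]
  refine norm_integral_le_expWeight hν fun y => ?_
  have hW := one_le_logWeight hν y
  have key : g' y - effScore k ν (y ⬝ᵥ y) - Real.exp (logRatio ν m T 0 y) * g' y
      + (effScore k ν (y ⬝ᵥ y) + effScore k ν (y ⬝ᵥ y) * linScore ν m T 0 y)
      = -(effScore k ν (y ⬝ᵥ y) * (Real.exp (logRatio ν m T 0 y) - 1 - linScore ν m T 0 y))
        - (g' y - effScore k ν (y ⬝ᵥ y)) * (Real.exp (logRatio ν m T 0 y) - 1) := by ring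
  rw [key, Real.norm_eq_abs]
  refine (abs_sub _ _).trans ?_
  rw [abs_neg, abs_mul, abs_mul]
  have h3 := logWeight_pow_mul_exp_le (k := k) hν (j := 3) (b := C * d) (by norm_num)
      (by linarith) y
  have h1 := logWeight_pow_mul_exp_le (k := k) hν (j := 1) (b := C * d) (by norm_num)
      (by linarith) y
  calc _ ≤ C * logWeight ν y * (2 * C ^ 2 * d ^ 2 * (logWeight ν y ^ 2 *
          Real.exp (C * d * logWeight ν y)))
        + B * (C * d) * (C * d * logWeight ν y * Real.exp (C * d * logWeight ν y)) := by
        refine add_le_add (mul_le_mul (hg y) (b.abs_exp_sub_one_sub_lin_le hd hC hν y)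
          (abs_nonneg _) (by positivity)) (mul_le_mul (hDb y) (b.abs_exp_sub_one_le hd hC hν y)
          (abs_nonneg _) (by positivity))
    _ = 2 * C ^ 3 * d ^ 2 * (logWeight ν y ^ 3 * Real.exp (C * d * logWeight ν y))
        + B * C ^ 2 * d ^ 2 * (logWeight ν y ^ 1 * Real.exp (C * d * logWeight ν y)) := by ring
    _ ≤ 2 * C ^ 3 * d ^ 2 * (powConst ν * expWeight ν y)
        + B * C ^ 2 * d ^ 2 * (powConst ν * expWeight ν y) := by gcongr
    _ = _ := by ring

lemma linScore_leastFavorable (ν a : ℝ) (y : Fin k → ℝ) :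
    linScore ν 0 ((-(projCoef k ν * a)) • (1 : Matrix (Fin k) (Fin k) ℝ)) a y
      = a * effScore k ν (y ⬝ᵥ y) := by
  simp only [linScore, effScore, radScore, Matrix.trace_smul, Matrix.trace_one, Fintype.card_fin,
    Matrix.smul_mulVec, Matrix.one_mulVec, dotProduct_smul, smul_eq_mul, zero_dotProduct]
  ring

/-- Subtracting eᵘ - 1, whose integral is zero, turns u + ℓ²/2 into third-order remainders: the
cubic Taylor error of eᵘ and (u - ℓ)(u + ℓ)/2. -/
theorem LogRatioBound.abs_integral_logRatio_le (hν : 0 < ν) (hC : 1 ≤ C)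
    (hd : 0 ≤ d) (hCd : C * d ≤ ν / 32) (hT : T.IsSymm)
    (b : LogRatioBound ν C d m T t) :
    |∫ y, logRatio ν m T t y ∂(stdLaw k ν) + (∫ y, linScore ν m T t y ^ 2 ∂(stdLaw k ν)) / 2|
      ≤ 2 * C ^ 3 * d ^ 3 * powConst ν * expWeightIntegral k ν := by
  have := isProbabilityMeasure_stdLaw k hν
  have hue := b.integrable_exp hν hCd
  have hui : Integrable (logRatio ν m T t) (stdLaw k ν) := by
    refine integrable_of_le_expWeight hν (C := C * d * powConst ν)
      (measurable_logRatio ν m T t).aestronglyMeasurable fun y => ?_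
    rw [mul_assoc]
    refine (b.le y).trans (mul_le_mul_of_nonneg_left ?_ (by positivity))
    simpa using logWeight_pow_le (k := k) hν (j := 1) (by norm_num) y
  have hl2 : Integrable (fun y => linScore ν m T t y ^ 2 / 2) (stdLaw k ν) :=
    (memLp_linScore hν m hT t).integrable_sq.div_const 2
  have i1 : Integrable (fun y => logRatio ν m T t y + linScore ν m T t y ^ 2 / 2) (stdLaw k ν) :=
    hui.add hl2
  have i2 : Integrable (fun y => Real.exp (logRatio ν m T t y) - 1) (stdLaw k ν) :=
    hue.sub (integrable_const _)
  have hrew : ∫ y, logRatio ν m T t y ∂(stdLaw k ν)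
      + (∫ y, linScore ν m T t y ^ 2 ∂(stdLaw k ν)) / 2
      = ∫ y, (logRatio ν m T t y + linScore ν m T t y ^ 2 / 2
        - (Real.exp (logRatio ν m T t y) - 1)) ∂(stdLaw k ν) := by
    rw [integral_sub i1 i2, integral_add hui hl2, integral_sub hue (integrable_const _),
      integral_exp_logRatio hν b.posDef b.tail_pos, integral_div]
    simp
  rw [hrew, ← Real.norm_eq_abs]
  refine norm_integral_le_expWeight hν fun y => ?_
  have hW := one_le_logWeight hν y
  set u := logRatio ν m T t y with hu
  set ℓ := linScore ν m T t y with hℓ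
  have he : 1 ≤ Real.exp (C * d * logWeight ν y) := Real.one_le_exp (by positivity)
  have key : u + ℓ ^ 2 / 2 - (Real.exp u - 1)
    = -(Real.exp u - 1 - u - u ^ 2 / 2) - (u - ℓ) * (u + ℓ) / 2 := by ring
  rw [key, Real.norm_eq_abs]
  refine (abs_sub _ _).trans ?_
  rw [abs_neg, abs_div, abs_two, abs_mul]
  have h1 : |Real.exp u - 1 - u - u ^ 2 / 2|
      ≤ (C * d * logWeight ν y) ^ 3 * Real.exp (C * d * logWeight ν y) :=
    (abs_exp_sub_quadratic_le u).trans (mul_le_mul (pow_le_pow_left₀ (abs_nonneg _) (b.le y) 3)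
      (b.exp_abs_le y) (Real.exp_pos _).le (by positivity))
  have h2 : |u + ℓ| ≤ 2 * (C * d * logWeight ν y) :=
    (abs_add_le _ _).trans (by linarith [b.le y, b.lin_le y])
  have h3 := logWeight_pow_mul_exp_le (k := k) hν (j := 3) (b := C * d) (by norm_num)
      (by linarith) y
  have h4 : C * d ^ 2 * (2 * (C * d * logWeight ν y)) / 2
      ≤ C ^ 3 * d ^ 3 * (logWeight ν y ^ 3 * Real.exp (C * d * logWeight ν y)) := by
    have e1 : logWeight ν y ≤ logWeight ν y ^ 3 * Real.exp (C * d * logWeight ν y) := by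
      have : logWeight ν y ≤ logWeight ν y ^ 3 := by
        nlinarith [mul_nonneg (sub_nonneg.mpr hW) (sub_nonneg.mpr hW)]
      exact this.trans (le_mul_of_one_le_right (by positivity) he)
    have e2 : C ^ 2 ≤ C ^ 3 := pow_le_pow_right₀ hC (by norm_num)
    calc C * d ^ 2 * (2 * (C * d * logWeight ν y)) / 2 = C ^ 2 * d ^ 3 * logWeight ν y := by ring
      _ ≤ _ := by gcongr
  calc _ ≤ (C * d * logWeight ν y) ^ 3 * Real.exp (C * d * logWeight ν y)
        + C * d ^ 2 * (2 * (C * d * logWeight ν y)) / 2 := by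
        gcongr
        exact b.sub_le y
    _ ≤ (C * d * logWeight ν y) ^ 3 * Real.exp (C * d * logWeight ν y)
        + C ^ 3 * d ^ 3 * (logWeight ν y ^ 3 * Real.exp (C * d * logWeight ν y)) := by gcongr
    _ = 2 * C ^ 3 * d ^ 3 * (logWeight ν y ^ 3 * Real.exp (C * d * logWeight ν y)) := by ring
    _ ≤ 2 * C ^ 3 * d ^ 3 * (powConst ν * expWeight ν y) := by gcongr
    _ = _ := by ring

end Integrated

end

/-! ### Expansions at an arbitrary parameter -/

/-- The efficient score for tail weight at the parameter `θ`. -/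
def effScoreAt (θ : StudentParam k) (x : Fin k → ℝ) : ℝ :=
  effScore k θ.tail (mahalanobisSq θ x)

/-- `θ'` is within `d` of `θ` in the maximum norm, with symmetric scatter. -/
structure IsNear (d : ℝ) (θ θ' : StudentParam k) : Prop where
  nonneg : 0 ≤ d
  loc : ∀ i, |θ'.loc i - θ.loc i| ≤ d
  scatter : ∀ i j, |θ'.scatter i j - θ.scatter i j| ≤ d
  symm : θ'.scatter.IsSymm
  tail : |θ'.tail - θ.tail| ≤ d

lemma measurable_effScoreAt (θ : StudentParam k) : Measurable (effScoreAt θ) :=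
  (measurable_effScore k θ.tail).comp (continuous_mahalanobisSq θ).measurable

lemma effScoreAt_std {A S : Matrix (Fin k) (Fin k) ℝ} (hA : A.det ≠ 0) (hAS : A * Aᵀ = S)
    (b : Fin k → ℝ) (ν : ℝ) (y : Fin k → ℝ) :
    effScoreAt ⟨b, S, ν⟩ (b + A *ᵥ y) = effScore k ν (y ⬝ᵥ y) := by
  have h2 := mahalanobisSq_push hA b ⟨0, 1, ν⟩ y
  rw [push_std hAS, mahalanobisSq_std] at h2
  rw [effScoreAt, h2]

/-- Inverting the affine map changes entrywise distances by at most a factor depending on A. The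
tail weight is not moved, but is written as ν plus a displacement to match the expansions at the
standard parameter. -/
lemma exists_pull {A S : Matrix (Fin k) (Fin k) ℝ} (hA : A.det ≠ 0) (hAS : A * Aᵀ = S)
    (b : Fin k → ℝ) (ν : ℝ) :
    ∃ K : ℝ, 1 ≤ K ∧ ∀ (θ' : StudentParam k) (d : ℝ), IsNear d ⟨b, S, ν⟩ θ' →
      ∃ (m : Fin k → ℝ) (T : Matrix (Fin k) (Fin k) ℝ),
        IsSmall (K * d) m T (θ'.tail - ν) ∧ push A b ⟨m, 1 + T, ν + (θ'.tail - ν)⟩ = θ' := by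
  have hu : IsUnit A.det := isUnit_iff_ne_zero.mpr hA
  set B : ℝ := ∑ i, ∑ j, |A⁻¹ i j| with hB
  have hB0 : 0 ≤ B := by positivity
  have hBle : ∀ i j, |A⁻¹ i j| ≤ B := by
    intro i j
    have h1 := Finset.single_le_sum (f := fun i => ∑ j, |A⁻¹ i j|) (fun j _ => by positivity)
      (Finset.mem_univ i)
    have h2 := Finset.single_le_sum (f := fun j => |A⁻¹ i j|) (fun j _ => abs_nonneg _)
      (Finset.mem_univ j)
    exact h2.trans h1
  have hSs : S.IsSymm := by rw [← hAS]; exact Matrix.isSymm_mul_transpose_self A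
  -- The three summands pay for the tail, the location (one factor A⁻¹) and the scatter (two
  -- factors).
  refine ⟨1 + k ^ 2 * B + k ^ 2 * B ^ 2, by
    have : (0 : ℝ) ≤ k ^ 2 * B + k ^ 2 * B ^ 2 := by positivity
    linarith, fun θ' d hn => ?_⟩
  have hd0 := hn.nonneg
  have hp1 : (0 : ℝ) ≤ k ^ 2 * B := by positivity
  have hp2 : (0 : ℝ) ≤ k ^ 2 * B ^ 2 := by positivity
  have h1le : ∀ i j, |(1 : Matrix (Fin k) (Fin k) ℝ) i j| ≤ 1 := by
    intro i j; rw [Matrix.one_apply]; split_ifs <;> norm_num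
  refine ⟨A⁻¹ *ᵥ (θ'.loc - b), A⁻¹ * (θ'.scatter - S) * A⁻¹ᵀ,
    ⟨by positivity, fun i => ?_, fun i j => ?_, ?_, ?_⟩, ?_⟩
  · have h1 : (A⁻¹ *ᵥ (θ'.loc - b)) i
        = (fun j => A⁻¹ i j) ⬝ᵥ (1 : Matrix (Fin k) (Fin k) ℝ) *ᵥ (θ'.loc - b) := by
      rw [Matrix.one_mulVec]; rfl
    rw [h1]
    refine (abs_bilin_le hB0 zero_le_one (hBle i) h1le (fun j => hn.loc j)).trans ?_
    nlinarith
  · have h1 : (A⁻¹ * (θ'.scatter - S) * A⁻¹ᵀ) i j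
        = (fun l => A⁻¹ i l) ⬝ᵥ (θ'.scatter - S) *ᵥ (fun l => A⁻¹ j l) := by
      rw [Matrix.mul_assoc]; rfl
    rw [h1]
    refine (abs_bilin_le hB0 hd0 (hBle i) (fun i j => hn.scatter i j) (hBle j)).trans ?_
    nlinarith
  · rw [Matrix.IsSymm, Matrix.transpose_mul, Matrix.transpose_mul, Matrix.transpose_transpose,
      Matrix.transpose_sub, hn.symm.eq, hSs.eq, Matrix.mul_assoc]
  · refine hn.tail.trans ?_
    nlinarith
  · have h1 : A *ᵥ (A⁻¹ *ᵥ (θ'.loc - b)) = θ'.loc - b := by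
      rw [Matrix.mulVec_mulVec, Matrix.mul_nonsing_inv _ hu, Matrix.one_mulVec]
    have h2 : A * (1 + A⁻¹ * (θ'.scatter - S) * A⁻¹ᵀ) * Aᵀ = θ'.scatter := by
      have h3 : A⁻¹ᵀ * Aᵀ = 1 := by
        rw [← Matrix.transpose_mul, Matrix.mul_nonsing_inv _ hu, Matrix.transpose_one]
      have h4 : A * (A⁻¹ * (θ'.scatter - S) * A⁻¹ᵀ) = (θ'.scatter - S) * A⁻¹ᵀ := by
        rw [← Matrix.mul_assoc, ← Matrix.mul_assoc, Matrix.mul_nonsing_inv _ hu, Matrix.one_mul]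
      rw [Matrix.mul_add, Matrix.mul_one, h4, Matrix.add_mul, hAS, Matrix.mul_assoc, h3,
        Matrix.mul_one, add_sub_cancel]
    obtain ⟨l, s, ν'⟩ := θ'
    simp only [push, h1, h2, add_sub_cancel]

/-- Integrated expansions of the model at `θ`, uniformly over nearby parameters `θ'`. -/
structure Expansion (θ : StudentParam k) (C δ d : ℝ) (θ' : StudentParam k) : Prop where
  posDef : θ'.scatter.PosDef
  tail_pos : 0 < θ'.tail
  charFun_le : ∀ σ : ℝ, |σ| ≤ δ →
    ‖∫ x, Complex.exp ((σ * effScoreAt θ x : ℝ) * Complex.I) ∂(law θ')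
      - (1 + (σ : ℂ) * Complex.I * (((θ'.tail - θ.tail) * effVar k θ.tail : ℝ) : ℂ)
          - ((σ ^ 2 / 2 * effVar k θ.tail : ℝ) : ℂ))‖
      ≤ C * (|σ| * d ^ 2 + σ ^ 2 * d + |σ| ^ 3)
  integrable_sq : Integrable (fun x => (density θ' x / density θ x) ^ 2) (law θ)
  integral_sq_le : ∫ x, (density θ' x / density θ x) ^ 2 ∂(law θ) ≤ 1 + C * d ^ 2
  score_sub_le : θ'.tail = θ.tail → ∀ x, |effScoreAt θ' x - effScoreAt θ x| ≤ C * d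
  integral_score_sub_le : θ'.tail = θ.tail →
    |∫ x, (effScoreAt θ' x - effScoreAt θ x) ∂(law θ)| ≤ C * d ^ 2

lemma exists_affine_preimage {A : Matrix (Fin k) (Fin k) ℝ} (hA : A.det ≠ 0) (b x : Fin k → ℝ) :
    ∃ y, x = b + A *ᵥ y :=
  ⟨A⁻¹ *ᵥ (x - b), by
    rw [Matrix.mulVec_mulVec, Matrix.mul_nonsing_inv _ (isUnit_iff_ne_zero.mpr hA),
      Matrix.one_mulVec, add_sub_cancel]⟩

lemma density_ratio_push {A S : Matrix (Fin k) (Fin k) ℝ} (hA : A.det ≠ 0) (hAS : A * Aᵀ = S)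
    (b : Fin k → ℝ) {ν : ℝ} {m : Fin k → ℝ}
    {T : Matrix (Fin k) (Fin k) ℝ} {t : ℝ} (hT : (1 + T).PosDef) (y : Fin k → ℝ) :
    density (push A b ⟨m, 1 + T, ν + t⟩) (b + A *ᵥ y) / density ⟨b, S, ν⟩ (b + A *ᵥ y)
      = density ⟨m, 1 + T, ν + t⟩ y / density ⟨0, 1, ν⟩ y := by
  have h1 := density_push hA b (θ := ⟨0, 1, ν⟩) Matrix.PosDef.one y
  rw [push_std hAS] at h1
  rw [density_push hA b (θ := ⟨m, 1 + T, ν + t⟩) hT, h1,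
    mul_div_mul_left _ _ (inv_ne_zero (abs_ne_zero.mpr hA))]

/-- Transport of the integrated bounds: likelihood ratios and efficient scores at θ become those at
the standard parameter after y ↦ μ + A y, with d replaced by Kd. -/
theorem exists_expansion (hk : 1 ≤ k) {θ : StudentParam k} (hS : θ.scatter.PosDef)
    (hν : 0 < θ.tail) :
    ∃ C δ : ℝ, 0 < C ∧ 0 < δ ∧ ∀ (θ' : StudentParam k) (d : ℝ), d ≤ δ → IsNear d θ θ' →
      Expansion θ C δ d θ' := by
  obtain ⟨μ, S, ν⟩ := θ
  obtain ⟨A, hA, hAS⟩ := exists_mul_transpose_eq hS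
  obtain ⟨K, hK, hpull⟩ := exists_pull hA hAS μ ν
  obtain ⟨C, δ, hC, hδ, hδ1, hCδ, hCδ2, hg, hb⟩ := exists_bounds k hν
  simp only at hS hν
  set P := powConst ν * expWeightIntegral k ν with hP
  have hP0 : 0 ≤ P := mul_nonneg (powConst_nonneg ν) (expWeightIntegral_nonneg k ν)
  set B := 1 + (ν + k) / ν + |projCoef k ν| * (ν + k) with hB
  have hB0 : 0 ≤ B := by positivity
  -- The sum of the four constants needed below, so that one `Q` serves all bounds. The factor K²
  -- dominates 1 and K as well, since K ≥ 1.
  set Q := (2 * C ^ 3 * P + C ^ 2 * P + B * C + (2 * C ^ 3 + B * C ^ 2) * P) * K ^ 2 + 1 with hQ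
  have hK0 : 0 < K := by linarith
  have hmap : Measurable fun y : Fin k → ℝ => μ + A *ᵥ y := by fun_prop
  have hlaw := law_eq_map hA hAS μ ν
  refine ⟨Q, δ / K, by positivity, by positivity, fun θ' d hd hn => ?_⟩
  obtain ⟨m, T, hs, hpush⟩ := hpull θ' d hn
  have hKd : K * d ≤ δ := by rwa [le_div_iff₀' hK0] at hd
  have b := hb m T _ (K * d) hKd hs
  have hd0 := hn.nonneg
  have hCd : C * (K * d) ≤ ν / 32 := le_trans (by gcongr) hCδ
  have hCd2 : C * (K * d) ≤ 1 / 2 := le_trans (by gcongr) hCδ2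
  have hKK : K ≤ K ^ 2 := by nlinarith
  have h1K : 1 ≤ K ^ 2 := by nlinarith
  have hPD : θ'.scatter.PosDef := by
    have := posDef_push hA b.posDef
    rwa [← hpush]
  have htail : 0 < θ'.tail := by
    have := b.tail_pos
    rwa [add_sub_cancel] at this
  have hlaw' : law θ' = (law ⟨m, 1 + T, ν + (θ'.tail - ν)⟩).map fun y => μ + A *ᵥ y := by
    conv_lhs => rw [← hpush]
    exact law_push hA μ (θ := ⟨m, 1 + T, ν + (θ'.tail - ν)⟩) b.posDef
  have hratio : ∀ y, density θ' (μ + A *ᵥ y) / density ⟨μ, S, ν⟩ (μ + A *ᵥ y)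
      = Real.exp (logRatio ν m T (θ'.tail - ν) y) := by
    intro y
    rw [exp_logRatio hν b.posDef b.tail_pos]
    conv_lhs => rw [← hpush]
    exact density_ratio_push hA hAS μ b.posDef y
  have hrm : Measurable fun x => (density θ' x / density ⟨μ, S, ν⟩ x) ^ 2 :=
    ((measurable_density θ').div (measurable_density _)).pow_const 2
  have hscore : θ'.tail = ν → ∀ y, effScoreAt θ' (μ + A *ᵥ y)
      = effScore k ν (mahalanobisSq ⟨m, 1 + T, ν⟩ y) := by
    intro ht y
    rw [effScoreAt, ht]
    have h1 : mahalanobisSq θ' (μ + A *ᵥ y)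
        = mahalanobisSq ⟨m, 1 + T, ν + (θ'.tail - ν)⟩ y := by
      conv_lhs => rw [← hpush]
      exact mahalanobisSq_push hA μ _ y
    rw [h1]
    rfl
  have q1 : 2 * C ^ 3 * P * K ^ 2 ≤ Q := by
    have : 0 ≤ (C ^ 2 * P + B * C + (2 * C ^ 3 + B * C ^ 2) * P) * K ^ 2 := by positivity
    rw [hQ]; linarith
  have q2 : C ^ 2 * P * K ^ 2 ≤ Q := by
    have : 0 ≤ (2 * C ^ 3 * P + B * C + (2 * C ^ 3 + B * C ^ 2) * P) * K ^ 2 := by positivity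
    rw [hQ]; linarith
  have q3 : B * C * K ^ 2 ≤ Q := by
    have : 0 ≤ (2 * C ^ 3 * P + C ^ 2 * P + (2 * C ^ 3 + B * C ^ 2) * P) * K ^ 2 := by positivity
    rw [hQ]; linarith
  have q4 : (2 * C ^ 3 + B * C ^ 2) * P * K ^ 2 ≤ Q := by
    have : 0 ≤ (2 * C ^ 3 * P + C ^ 2 * P + B * C) * K ^ 2 := by positivity
    rw [hQ]; linarith
  refine ⟨hPD, htail, fun σ hσ => ?_, ?_, ?_, fun ht x => ?_, fun ht => ?_⟩
  · have hσ' : C * |σ| ≤ ν / 32 := by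
      refine le_trans ?_ hCδ
      gcongr
      exact hσ.trans (div_le_self hδ.le hK)
    have h1 := b.norm_charFun_sub_le hk hν hC hs.nonneg hCd hs.symm hg hσ'
    have hm : Measurable fun x =>
        Complex.exp ((σ * effScoreAt ⟨μ, S, ν⟩ x : ℝ) * Complex.I) :=
      Complex.measurable_exp.comp ((Complex.measurable_ofReal.comp
        ((measurable_effScoreAt _).const_mul σ)).mul_const _)
    rw [hlaw', integral_map hmap.aemeasurable hm.aestronglyMeasurable]
    simp only [effScoreAt_std hA hAS]
    refine h1.trans ?_
    calc _ = 2 * C ^ 3 * P * (|σ| * (K * d) ^ 2 + σ ^ 2 * (K * d) + |σ| ^ 3) := by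
          rw [hP]; ring
      _ ≤ 2 * C ^ 3 * P * (|σ| * (K ^ 2 * d ^ 2) + σ ^ 2 * (K ^ 2 * d) + K ^ 2 * |σ| ^ 3) := by
          have : |σ| ^ 3 ≤ K ^ 2 * |σ| ^ 3 := le_mul_of_one_le_left (by positivity) h1K
          rw [mul_pow]
          gcongr
      _ = 2 * C ^ 3 * P * K ^ 2 * (|σ| * d ^ 2 + σ ^ 2 * d + |σ| ^ 3) := by ring
      _ ≤ _ := by gcongr
  · rw [hlaw, integrable_map_measure hrm.aestronglyMeasurable hmap.aemeasurable]
    refine (b.integrable_exp_sq hν hCd).congr (ae_of_all _ fun y => ?_)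
    simp only [Function.comp, hratio]
  · rw [hlaw, integral_map hmap.aemeasurable hrm.aestronglyMeasurable]
    simp only [hratio]
    refine (b.integral_exp_sq_le hν hC hs.nonneg hCd).trans ?_
    calc _ = 1 + C ^ 2 * P * K ^ 2 * d ^ 2 := by rw [hP]; ring
      _ ≤ _ := by gcongr
  · obtain ⟨y, rfl⟩ := exists_affine_preimage hA μ x
    rw [hscore ht, effScoreAt_std hA hAS]
    have ht0 : θ'.tail - ν = 0 := sub_eq_zero.mpr ht
    rw [ht0] at b
    refine (b.abs_effScore_sub_le hν hCd2 y).trans ?_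
    calc B * (C * (K * d)) = B * C * K * d := by ring
      _ ≤ B * C * K ^ 2 * d := by gcongr
      _ ≤ _ := by gcongr
  · have hm : Measurable fun x => effScoreAt θ' x - effScoreAt ⟨μ, S, ν⟩ x :=
      (measurable_effScoreAt _).sub (measurable_effScoreAt _)
    rw [hlaw, integral_map hmap.aemeasurable hm.aestronglyMeasurable]
    simp only [hscore ht, effScoreAt_std hA hAS]
    have ht0 : θ'.tail - ν = 0 := sub_eq_zero.mpr ht
    rw [ht0] at b
    refine (b.abs_integral_effScore_sub_le hk hν hC hs.nonneg hCd hCd2 hs.symm hg).trans ?_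
    calc _ = (2 * C ^ 3 + B * C ^ 2) * P * K ^ 2 * d ^ 2 := by rw [hP]; ring
      _ ≤ _ := by gcongr

/-- The least favorable path through `θ`. -/
def leastFavorable (θ : StudentParam k) (a : ℝ) : StudentParam k :=
  ⟨θ.loc, (1 - projCoef k θ.tail * a) • θ.scatter, θ.tail + a⟩

/-- Moving the tail by a while rescaling the scatter by 1 - `projCoef` · a gives a one-dimensional
submodel whose score is a times the efficient score. Its log ratio has mean -a²·`effVar`/2 to third
order, which is the accuracy needed when n copies with a of order n^{-1/2} are added. -/
theorem exists_leastFavorable_expansion {θ : StudentParam k} (hS : θ.scatter.PosDef)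
    (hν : 0 < θ.tail) :
    ∃ C δ : ℝ, 0 < C ∧ 0 < δ ∧ ∀ a : ℝ, |a| ≤ δ →
      (leastFavorable θ a).scatter.PosDef ∧ 0 < (leastFavorable θ a).tail ∧
      (∀ x, |Real.log (density (leastFavorable θ a) x / density θ x) - a * effScoreAt θ x|
        ≤ C * |a| ^ 2) ∧
      |∫ x, Real.log (density (leastFavorable θ a) x / density θ x) ∂(law θ)
        + a ^ 2 * effVar k θ.tail / 2| ≤ C * |a| ^ 3 := by
  obtain ⟨μ, S, ν⟩ := θ
  obtain ⟨A, hA, hAS⟩ := exists_mul_transpose_eq hS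
  obtain ⟨C, δ, hC, hδ, hδ1, hCδ, hCδ2, hg, hb⟩ := exists_bounds k hν
  simp only at hS hν
  set P := powConst ν * expWeightIntegral k ν with hP
  have hP0 : 0 ≤ P := mul_nonneg (powConst_nonneg ν) (expWeightIntegral_nonneg k ν)
  set K := 1 + |projCoef k ν| with hK
  have hK1 : 1 ≤ K := by rw [hK]; linarith [abs_nonneg (projCoef k ν)]
  have hmap : Measurable fun y : Fin k → ℝ => μ + A *ᵥ y := by fun_prop
  have hlaw := law_eq_map hA hAS μ ν
  refine ⟨C * K ^ 2 + 2 * C ^ 3 * K ^ 3 * P, δ / K, by positivity, by positivity, fun a ha => ?_⟩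
  set T : Matrix (Fin k) (Fin k) ℝ := (-(projCoef k ν * a)) • 1 with hT
  have hs : IsSmall (K * |a|) (0 : Fin k → ℝ) T a := by
    refine ⟨by positivity, fun i => ?_, fun i j => ?_, Matrix.isSymm_one.smul _, ?_⟩
    · simp; positivity
    · have h1 : |(1 : Matrix (Fin k) (Fin k) ℝ) i j| ≤ 1 := by
        rw [Matrix.one_apply]; split_ifs <;> norm_num
      rw [hT, Matrix.smul_apply, smul_eq_mul, abs_mul, abs_neg, abs_mul]
      calc |projCoef k ν| * |a| * |(1 : Matrix (Fin k) (Fin k) ℝ) i j|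
          ≤ |projCoef k ν| * |a| * 1 := by gcongr
        _ ≤ K * |a| := by rw [hK]; nlinarith [abs_nonneg a]
    · exact le_mul_of_one_le_left (abs_nonneg a) hK1
  have hKd : K * |a| ≤ δ := by rwa [le_div_iff₀' (by positivity)] at ha
  have b := hb 0 T a _ hKd hs
  have hCd : C * (K * |a|) ≤ ν / 32 := le_trans (by gcongr) hCδ
  have hpush : push A μ ⟨0, 1 + T, ν + a⟩ = leastFavorable ⟨μ, S, ν⟩ a := by
    simp only [push, leastFavorable, Matrix.mulVec_zero, add_zero, hT, StudentParam.mk.injEq,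
      true_and, and_true]
    rw [Matrix.mul_add, Matrix.mul_one, Matrix.mul_smul, Matrix.mul_one, Matrix.add_mul,
      Matrix.smul_mul, hAS, sub_smul, one_smul, neg_smul, sub_eq_add_neg]
  have hratio : ∀ y, density (leastFavorable ⟨μ, S, ν⟩ a) (μ + A *ᵥ y)
      / density ⟨μ, S, ν⟩ (μ + A *ᵥ y) = Real.exp (logRatio ν 0 T a y) := by
    intro y
    rw [exp_logRatio hν b.posDef b.tail_pos, ← hpush]
    exact density_ratio_push hA hAS μ b.posDef y
  have hlm : Measurable fun x =>
      Real.log (density (leastFavorable ⟨μ, S, ν⟩ a) x / density ⟨μ, S, ν⟩ x) :=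
    ((measurable_density _).div (measurable_density _)).log
  refine ⟨?_, b.tail_pos, fun x => ?_, ?_⟩
  · rw [← hpush]; exact posDef_push hA b.posDef
  · obtain ⟨y, rfl⟩ := exists_affine_preimage hA μ x
    rw [hratio, effScoreAt_std hA hAS, Real.log_exp, ← linScore_leastFavorable ν a y]
    refine (b.sub_le y).trans ?_
    have : 0 ≤ 2 * C ^ 3 * K ^ 3 * P * |a| ^ 2 := by positivity
    linarith [show C * (K * |a|) ^ 2 = C * K ^ 2 * |a| ^ 2 by ring]
  · rw [hlaw, integral_map hmap.aemeasurable hlm.aestronglyMeasurable]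
    simp only [hratio, Real.log_exp]
    have h1 := b.abs_integral_logRatio_le hν hC hs.nonneg hCd hs.symm
    have h2 : ∫ y, linScore ν 0 T a y ^ 2 ∂(stdLaw k ν) = a ^ 2 * effVar k ν := by
      rw [effVar, ← integral_const_mul]
      refine integral_congr_ae (ae_of_all _ fun y => ?_)
      simp only [hT, linScore_leastFavorable]
      ring
    rw [h2] at h1
    refine h1.trans ?_
    have : 0 ≤ C * K ^ 2 * |a| ^ 3 := by positivity
    linarith [show 2 * C ^ 3 * (K * |a|) ^ 3 * powConst ν * expWeightIntegral k ν
      = 2 * C ^ 3 * K ^ 3 * P * |a| ^ 3 by rw [hP]; ring]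

lemma integral_effScoreAt {θ : StudentParam k} (hS : θ.scatter.PosDef) (hν : 0 < θ.tail) :
    ∫ x, effScoreAt θ x ∂(law θ) = 0 := by
  rw [← integral_effScore k hν, ← integral_comp_mahalanobisSq hS (measurable_effScore k θ.tail)]
  rfl

/-! ### Scores and the efficient central sequence -/

lemma IsSmall.smul {d : ℝ} {m : Fin k → ℝ} {T : Matrix (Fin k) (Fin k) ℝ} {t : ℝ}
    (h : IsSmall d m T t) (s : ℝ) : IsSmall (|s| * d) (s • m) (s • T) (s * t) := by
  have := h.nonneg
  refine ⟨by positivity, fun i => ?_, fun i j => ?_, h.symm.smul s, ?_⟩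
  · rw [Pi.smul_apply, smul_eq_mul, abs_mul]; gcongr; exact h.loc i
  · rw [Matrix.smul_apply, smul_eq_mul, abs_mul]; gcongr; exact h.scatter i j
  · rw [abs_mul]; gcongr; exact h.tail

/-- The quadratic remainder bound already gives differentiability, so the scores defined as
derivatives are identified with `linScore` without further calculus. -/
lemma hasDerivAt_logRatio {ν : ℝ} (hν : 0 < ν) (m : Fin k → ℝ) {T : Matrix (Fin k) (Fin k) ℝ}
    (hT : T.IsSymm) (t : ℝ) (y : Fin k → ℝ) :
    HasDerivAt (fun s : ℝ => logRatio ν (s • m) (s • T) (s * t) y) (linScore ν m T t y) 0 := by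
  obtain ⟨C, δ, hC, hδ, hb⟩ := exists_logRatio_bound k hν
  obtain ⟨D, hD⟩ := exists_isSmall m hT t
  have hD0 := hD.nonneg
  have hO : (fun s : ℝ => logRatio ν (s • m) (s • T) (s * t) y - s * linScore ν m T t y)
      =O[𝓝 0] fun s => ‖s - 0‖ ^ 2 := by
    refine Asymptotics.IsBigO.of_bound (C * D ^ 2) ?_
    have h1 : ∀ᶠ s : ℝ in 𝓝 0, |s| * D < δ := by
      have : Tendsto (fun s : ℝ => |s| * D) (𝓝 0) (𝓝 (|0| * D)) :=
        (continuous_abs.mul continuous_const).tendsto 0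
      rw [abs_zero, zero_mul] at this
      exact this.eventually_lt_const hδ
    filter_upwards [h1] with s hs
    have h2 := ((hb _ _ _ _ hs.le (hD.smul s)).2.2 y).1
    rw [linScore_smul] at h2
    simp only [sub_zero, Real.norm_eq_abs, sq_abs]
    refine h2.trans (le_of_eq ?_)
    rw [mul_pow, sq_abs, abs_of_nonneg (sq_nonneg s)]; ring
  have h2 := (hO.hasFDerivAt (by norm_num)).hasDerivAt.add
    ((hasDerivAt_id (0 : ℝ)).mul_const (linScore ν m T t y))
  refine (h2.congr_deriv (by simp)).congr_of_eventuallyEq (Eventually.of_forall fun s => ?_)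
  simp

lemma eventually_posDef_one_add_smul {T : Matrix (Fin k) (Fin k) ℝ} (hT : T.IsSymm) :
    ∀ᶠ s : ℝ in 𝓝 0, (1 + s • T).PosDef := by
  obtain ⟨D, hD⟩ := exists_isSmall (0 : Fin k → ℝ) hT 0
  have hD0 := hD.nonneg
  have h1 : ∀ᶠ s : ℝ in 𝓝 0, (k : ℝ) ^ 2 * (|s| * D) < 1 / 2 := by
    have : Tendsto (fun s : ℝ => (k : ℝ) ^ 2 * (|s| * D)) (𝓝 0) (𝓝 ((k : ℝ) ^ 2 * (|0| * D))) :=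
      (continuous_const.mul (continuous_abs.mul continuous_const)).tendsto 0
    rw [abs_zero, zero_mul, mul_zero] at this
    exact this.eventually_lt_const (by norm_num)
  filter_upwards [h1] with s hs
  exact posDef_one_add (hT.smul s) (by positivity) hs.le (hD.smul s).scatter

lemma hasDerivAt_log_density_push {A : Matrix (Fin k) (Fin k) ℝ} (hA : A.det ≠ 0)
    (b : Fin k → ℝ) {ν : ℝ} (hν : 0 < ν) {T : Matrix (Fin k) (Fin k) ℝ}
    (hT : T.IsSymm) (t : ℝ) (y : Fin k → ℝ) :
    HasDerivAt (fun s : ℝ => Real.log (density (push A b ⟨0, 1 + s • T, ν + s * t⟩) (b + A *ᵥ y)))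
      (linScore ν 0 T t y) 0 := by
  have h1 := hasDerivAt_logRatio hν 0 hT t y
  have h2 := h1.add_const (Real.log (density ⟨0, 1, ν⟩ y) + Real.log (|A.det|⁻¹))
  refine h2.congr_of_eventuallyEq ?_
  have h3 : ∀ᶠ s : ℝ in 𝓝 0, 0 < ν + s * t := by
    have : Tendsto (fun s : ℝ => ν + s * t) (𝓝 0) (𝓝 (ν + 0 * t)) :=
      (continuous_const.add (continuous_id.mul continuous_const)).tendsto 0
    rw [zero_mul, add_zero] at this
    exact this.eventually_const_lt hν
  filter_upwards [eventually_posDef_one_add_smul hT, h3] with s hs hs'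
  rw [density_push hA b (θ := ⟨0, 1 + s • T, ν + s * t⟩) hs,
    Real.log_mul (inv_ne_zero (abs_ne_zero.mpr hA))
      (density_pos (θ := ⟨0, 1 + s • T, ν + s * t⟩) hs hs' y).ne', logRatio, smul_zero]
  ring

/-! ### Half-vectorization coordinates and the scores in them -/

lemma vechBasis_isSymm (p : VechIdx k) : (vechBasis p).IsSymm := by
  ext i j
  simp only [vechBasis, Matrix.transpose_apply, Matrix.of_apply]
  simp only [or_comm]

lemma isSymm_conj {A T : Matrix (Fin k) (Fin k) ℝ} (hT : T.IsSymm) :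
    (A * T * Aᵀ).IsSymm := by
  rw [Matrix.IsSymm, Matrix.transpose_mul, Matrix.transpose_mul, Matrix.transpose_transpose,
    hT.eq, Matrix.mul_assoc]

lemma mul_conj_inv {A : Matrix (Fin k) (Fin k) ℝ} (hA : A.det ≠ 0)
    (E : Matrix (Fin k) (Fin k) ℝ) : A * (A⁻¹ * E * A⁻¹ᵀ) * Aᵀ = E := by
  have hu : IsUnit A.det := isUnit_iff_ne_zero.mpr hA
  have h3 : A⁻¹ᵀ * Aᵀ = 1 := by
    rw [← Matrix.transpose_mul, Matrix.mul_nonsing_inv _ hu, Matrix.transpose_one]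
  rw [Matrix.mul_assoc, Matrix.mul_assoc, Matrix.mul_assoc, h3, Matrix.mul_one,
    ← Matrix.mul_assoc, Matrix.mul_nonsing_inv _ hu, Matrix.one_mul]

/-- A perturbation E of S = A Aᵀ corresponds to the perturbation A⁻¹ E A⁻ᵀ of the identity. -/
lemma scoreScatter_affine {A S : Matrix (Fin k) (Fin k) ℝ} (hA : A.det ≠ 0) (hAS : A * Aᵀ = S)
    (b : Fin k → ℝ) {ν : ℝ} (hν : 0 < ν) (p : VechIdx k) (y : Fin k → ℝ) :
    scoreScatter ⟨b, S, ν⟩ p (b + A *ᵥ y)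
      = linScore ν 0 (A⁻¹ * vechBasis p * A⁻¹ᵀ) 0 y := by
  have h := hasDerivAt_log_density_push hA b hν (isSymm_conj (A := A⁻¹) (vechBasis_isSymm p)) 0 y
  rw [scoreScatter, ← h.deriv]
  congr 1
  funext s
  simp only [push, Matrix.mul_add, Matrix.add_mul, Matrix.mul_one, hAS, Matrix.mul_smul,
    Matrix.smul_mul, mul_conj_inv hA, Matrix.mulVec_zero, add_zero, mul_zero]

lemma scoreTail_affine {A S : Matrix (Fin k) (Fin k) ℝ} (hA : A.det ≠ 0) (hAS : A * Aᵀ = S)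
    (b : Fin k → ℝ) {ν : ℝ} (hν : 0 < ν) (y : Fin k → ℝ) :
    scoreTail ⟨b, S, ν⟩ (b + A *ᵥ y) = tailScore k ν (y ⬝ᵥ y) := by
  have h := hasDerivAt_log_density_push hA b hν (T := 0) Matrix.isSymm_zero 1 y
  rw [linScore_tail] at h
  have h2 : (fun s : ℝ => Real.log (density (push A b ⟨0, 1 + s • 0, ν + s * 1⟩) (b + A *ᵥ y)))
      = fun s => (fun v : ℝ => Real.log (density ⟨b, S, v⟩ (b + A *ᵥ y))) (ν + s) := by
    funext s
    simp only [push, smul_zero, add_zero, hAS, Matrix.mulVec_zero, mul_one]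
  rw [h2] at h
  have h3 := h.deriv
  rw [deriv_comp_const_add (fun v : ℝ => Real.log (density ⟨b, S, v⟩ (b + A *ᵥ y))), add_zero] at h3
  exact h3

lemma linScore_sum {ι : Type*} [Fintype ι] (ν : ℝ) (a : ι → ℝ)
    (T : ι → Matrix (Fin k) (Fin k) ℝ) (y : Fin k → ℝ) :
    ∑ p, a p * linScore ν 0 (T p) 0 y = linScore ν 0 (∑ p, a p • T p) 0 y := by
  simp only [linScore, zero_mul, zero_add, zero_dotProduct, zero_div, mul_zero, add_zero,
    Matrix.trace_sum, Matrix.trace_smul, Matrix.sum_mulVec, dotProduct_sum, Matrix.smul_mulVec,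
    dotProduct_smul, smul_eq_mul, mul_add, Finset.sum_add_distrib]
  congr 1
  · rw [← Finset.sum_neg_distrib, Finset.sum_div]
    exact Finset.sum_congr rfl fun p _ => by ring
  · rw [Finset.sum_div, Finset.mul_sum]
    exact Finset.sum_congr rfl fun p _ => by ring

lemma sum_smul_vechBasis_apply (a : VechIdx k → ℝ) (p : VechIdx k) :
    (∑ q, a q • vechBasis q) p.1.1 p.1.2 = a p := by
  rw [Matrix.sum_apply, Finset.sum_eq_single p]
  · simp [vechBasis]
  · intro q _ hqp
    rw [Matrix.smul_apply, vechBasis, Matrix.of_apply, if_neg, smul_zero]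
    -- In the transposed case both index pairs are ordered, which forces a diagonal position and
    -- hence q = p after all.
    rintro (h | h)
    · exact hqp (Subtype.ext h.symm)
    · have h1 := q.2
      rw [← h] at h1
      have h2 : p.1.1 = p.1.2 := le_antisymm p.2 h1
      refine hqp (Subtype.ext (h.symm.trans ?_))
      ext <;> simp [h2]
  · simp

lemma sum_vech_smul_vechBasis {S : Matrix (Fin k) (Fin k) ℝ} (hS : S.IsSymm) :
    ∑ q : VechIdx k, S q.1.1 q.1.2 • vechBasis q = S := by
  have h := fun p => sum_smul_vechBasis_apply (fun q : VechIdx k => S q.1.1 q.1.2) p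
  have hs : (∑ q : VechIdx k, S q.1.1 q.1.2 • vechBasis q).IsSymm := by
    rw [Matrix.IsSymm, Matrix.transpose_sum]
    exact Finset.sum_congr rfl fun q _ => by rw [Matrix.transpose_smul, (vechBasis_isSymm q).eq]
  ext i j
  rcases le_total i j with hij | hij
  · exact h ⟨(i, j), hij⟩
  · rw [← hs.apply, ← hS.apply]
    exact h ⟨(j, i), hij⟩

lemma eq_zero_of_quadForm_eq_zero {T : Matrix (Fin k) (Fin k) ℝ} (hT : T.IsSymm)
    (h : ∀ y : Fin k → ℝ, y ⬝ᵥ T *ᵥ y = 0) : T = 0 := by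
  ext i j
  have h1 := h (Pi.single i 1 + Pi.single j 1)
  have h2 := h (Pi.single i 1)
  have h3 := h (Pi.single j 1)
  simp only [Matrix.mulVec_add, add_dotProduct, dotProduct_add, Matrix.mulVec_single_one,
    single_one_dotProduct, Matrix.col_apply] at h1 h2 h3
  have h4 := hT.apply i j
  simp only [Matrix.zero_apply]
  linarith

/-- Evaluation at y = 0 gives tr T = 0; then the quadratic form of T vanishes everywhere. -/
lemma eq_zero_of_linScore_eq_zero {ν : ℝ} (hν : 0 < ν) {T : Matrix (Fin k) (Fin k) ℝ}
    (hT : T.IsSymm) (h : ∀ y, linScore ν 0 T 0 y = 0) : T = 0 := by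
  have h0 := h 0
  simp [linScore] at h0
  refine eq_zero_of_quadForm_eq_zero hT fun y => ?_
  have h1 := h y
  have := dotProduct_self_nonneg' y
  simp only [linScore, h0, zero_mul, zero_add, zero_dotProduct, zero_div, mul_zero, add_zero,
    neg_zero] at h1
  have h2 : ν + y ⬝ᵥ y ≠ 0 := by positivity
  have h3 : (ν + k) / 2 ≠ 0 := by positivity
  simpa [h2, h3] using h1

section

/-! ### Fisher information -/

/-- The scores are given by pointwise derivatives, with measurability known only after the change of
variable. The affine map is a measurable embedding, which carries measurability back. -/
lemma cov_affine {A S : Matrix (Fin k) (Fin k) ℝ} (hA : A.det ≠ 0) (hAS : A * Aᵀ = S)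
    (b : Fin k → ℝ) {ν : ℝ} (hν : 0 < ν) {X Y : (Fin k → ℝ) → ℝ} {X' Y' : (Fin k → ℝ) → ℝ}
    (hX : ∀ y, X (b + A *ᵥ y) = X' y) (hY : ∀ y, Y (b + A *ᵥ y) = Y' y)
    (hXm : MemLp X' 2 (stdLaw k ν)) (hYm : MemLp Y' 2 (stdLaw k ν))
    (hX0 : ∫ y, X' y ∂(stdLaw k ν) = 0) :
    cov[X, Y; law ⟨b, S, ν⟩] = ∫ y, X' y * Y' y ∂(stdLaw k ν) := by
  have := isProbabilityMeasure_stdLaw k hν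
  have hu : IsUnit A.det := isUnit_iff_ne_zero.mpr hA
  have hinv : ∀ y, A⁻¹ *ᵥ ((b + A *ᵥ y) - b) = y := fun y => by
    rw [add_sub_cancel_left, Matrix.mulVec_mulVec, Matrix.nonsing_inv_mul _ hu, Matrix.one_mulVec]
  have hmap : Measurable fun y : Fin k → ℝ => b + A *ᵥ y := by fun_prop
  have hemb : MeasurableEmbedding fun y : Fin k → ℝ => b + A *ᵥ y := by
    have hi : Measurable fun x : Fin k → ℝ => A⁻¹ *ᵥ (x - b) := by fun_prop
    exact MeasurableEmbedding.of_measurable_inverse hmap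
      (by
        have : Set.range (fun y : Fin k → ℝ => b + A *ᵥ y) = Set.univ :=
          Set.eq_univ_of_forall fun x => by
            obtain ⟨y, hy⟩ := exists_affine_preimage hA b x
            exact ⟨y, hy.symm⟩
        rw [this]; exact MeasurableSet.univ) hi hinv
  have hX' : X ∘ (fun y => b + A *ᵥ y) = X' := funext hX
  have hY' : Y ∘ (fun y => b + A *ᵥ y) = Y' := funext hY
  rw [law_eq_map hA hAS b ν, covariance_map (hemb.aestronglyMeasurable_map_iff.mpr
      (by rw [hX']; exact hXm.aestronglyMeasurable)) (hemb.aestronglyMeasurable_map_iff.mpr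
      (by rw [hY']; exact hYm.aestronglyMeasurable)) hmap.aemeasurable, hX', hY',
    covariance_eq_sub hXm hYm, hX0, zero_mul, sub_zero]
  rfl

section Info

variable {A S : Matrix (Fin k) (Fin k) ℝ} {ν : ℝ}

lemma info22_eq (hA : A.det ≠ 0) (hAS : A * Aᵀ = S) (b : Fin k → ℝ) (hν : 0 < ν)
    (p q : VechIdx k) : info22 ⟨b, S, ν⟩ p q
      = ∫ y, linScore ν 0 (A⁻¹ * vechBasis p * A⁻¹ᵀ) 0 y * linScore ν 0 (A⁻¹ * vechBasis q * A⁻¹ᵀ) 0 y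
          ∂(stdLaw k ν) :=
  have hs := fun p : VechIdx k => isSymm_conj (A := A⁻¹) (vechBasis_isSymm p)
  cov_affine hA hAS b hν (scoreScatter_affine hA hAS b hν p) (scoreScatter_affine hA hAS b hν q)
    (memLp_linScore hν 0 (hs p) 0) (memLp_linScore hν 0 (hs q) 0) (integral_linScore hν 0 (hs p) 0)

lemma info23_eq (hA : A.det ≠ 0) (hAS : A * Aᵀ = S) (b : Fin k → ℝ) (hν : 0 < ν)
    (p : VechIdx k) : info23 ⟨b, S, ν⟩ p
      = ∫ y, linScore ν 0 (A⁻¹ * vechBasis p * A⁻¹ᵀ) 0 y * tailScore k ν (y ⬝ᵥ y)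
          ∂(stdLaw k ν) :=
  have hs := fun p : VechIdx k => isSymm_conj (A := A⁻¹) (vechBasis_isSymm p)
  cov_affine hA hAS b hν (scoreScatter_affine hA hAS b hν p) (scoreTail_affine hA hAS b hν)
    (memLp_linScore hν 0 (hs p) 0) (memLp_tailScore k hν) (integral_linScore hν 0 (hs p) 0)

lemma info33_eq (hA : A.det ≠ 0) (hAS : A * Aᵀ = S) (b : Fin k → ℝ) (hν : 0 < ν) :
    info33 ⟨b, S, ν⟩ = ∫ y : Fin k → ℝ, tailScore k ν (y ⬝ᵥ y) * tailScore k ν (y ⬝ᵥ y)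
      ∂(stdLaw k ν) :=
  cov_affine hA hAS b hν (scoreTail_affine hA hAS b hν) (scoreTail_affine hA hAS b hν)
    (memLp_tailScore k hν) (memLp_tailScore k hν) (integral_tailScore hν)

lemma sum_smul_conj (a : VechIdx k → ℝ) :
    ∑ p, a p • (A⁻¹ * vechBasis p * A⁻¹ᵀ) = A⁻¹ * (∑ p, a p • vechBasis p) * A⁻¹ᵀ := by
  rw [Matrix.mul_sum, Matrix.sum_mul]
  exact Finset.sum_congr rfl fun p _ => by rw [Matrix.mul_smul, Matrix.smul_mul]

lemma info22_mulVec (hA : A.det ≠ 0) (hAS : A * Aᵀ = S) (b : Fin k → ℝ) (hν : 0 < ν)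
    (a : VechIdx k → ℝ) (p : VechIdx k) : (info22 ⟨b, S, ν⟩ *ᵥ a) p
      = ∫ y, linScore ν 0 (A⁻¹ * vechBasis p * A⁻¹ᵀ) 0 y
          * linScore ν 0 (A⁻¹ * (∑ q, a q • vechBasis q) * A⁻¹ᵀ) 0 y ∂(stdLaw k ν) := by
  have hs := fun p : VechIdx k => isSymm_conj (A := A⁻¹) (vechBasis_isSymm p)
  simp only [Matrix.mulVec, dotProduct, info22_eq hA hAS b hν]
  rw [← sum_smul_conj]
  simp only [← linScore_sum, Finset.mul_sum]
  rw [integral_finsetSum]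
  · refine Finset.sum_congr rfl fun q _ => ?_
    rw [← integral_mul_const]
    congr 1
    funext y
    ring
  · intro q _
    have i : Integrable (fun y => linScore ν 0 (A⁻¹ * vechBasis p * A⁻¹ᵀ) 0 y
        * linScore ν 0 (A⁻¹ * vechBasis q * A⁻¹ᵀ) 0 y) (stdLaw k ν) :=
      (memLp_linScore hν 0 (hs p) 0).integrable_mul (memLp_linScore hν 0 (hs q) 0)
    refine (i.const_mul (a q)).congr (ae_of_all _ fun y => ?_)
    simp only
    ring

lemma isSymm_sum_smul_vechBasis (a : VechIdx k → ℝ) : (∑ q, a q • vechBasis q).IsSymm := by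
  rw [Matrix.IsSymm, Matrix.transpose_sum]
  exact Finset.sum_congr rfl fun q _ => by rw [Matrix.transpose_smul, (vechBasis_isSymm q).eq]

/-- A kernel vector yields a scatter direction whose score has variance zero. That score vanishes
identically, so the direction is zero, and so are its coordinates. -/
lemma isUnit_det_info22 (hA : A.det ≠ 0) (hAS : A * Aᵀ = S) (b : Fin k → ℝ) (hν : 0 < ν) :
    IsUnit (info22 ⟨b, S, ν⟩).det := by
  rw [isUnit_iff_ne_zero]
  intro h0
  obtain ⟨a, ha, h⟩ := Matrix.exists_mulVec_eq_zero_iff.mpr h0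
  set T := A⁻¹ * (∑ q, a q • vechBasis q) * A⁻¹ᵀ with hT
  have hTs : T.IsSymm := isSymm_conj (isSymm_sum_smul_vechBasis a)
  have hs := fun p : VechIdx k => isSymm_conj (A := A⁻¹) (vechBasis_isSymm p)
  have h1 : ∫ y, linScore ν 0 T 0 y ^ 2 ∂(stdLaw k ν) = 0 := by
    have h2 : a ⬝ᵥ info22 ⟨b, S, ν⟩ *ᵥ a = 0 := by rw [h, dotProduct_zero]
    have hl : ∀ y, linScore ν 0 T 0 y
        = ∑ p, a p * linScore ν 0 (A⁻¹ * vechBasis p * A⁻¹ᵀ) 0 y := fun y => by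
      rw [hT, ← sum_smul_conj, ← linScore_sum]
    refine Eq.trans ?_ h2
    simp only [dotProduct, info22_mulVec hA hAS b hν, ← integral_const_mul, ← hT]
    rw [← integral_finsetSum]
    · congr 1
      funext y
      simp only [← mul_assoc]
      rw [← Finset.sum_mul, ← hl, sq]
    · intro p _
      have i : Integrable (fun y => linScore ν 0 (A⁻¹ * vechBasis p * A⁻¹ᵀ) 0 y
          * linScore ν 0 T 0 y) (stdLaw k ν) :=
        (memLp_linScore hν 0 (hs p) 0).integrable_mul (memLp_linScore hν 0 hTs 0)
      exact i.const_mul (a p)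
  have h3 := eq_zero_of_linScore_eq_zero hν hTs
    (eq_zero_of_integral_sq_eq_zero (θ := ⟨0, 1, ν⟩) Matrix.PosDef.one hν
      (continuous_linScore hν 0 T 0) (memLp_linScore hν 0 hTs 0).integrable_sq h1)
  have h4 : ∑ q, a q • vechBasis q = 0 := by
    rw [← mul_conj_inv hA (∑ q, a q • vechBasis q), ← hT, h3, Matrix.mul_zero, Matrix.zero_mul]
  refine ha (funext fun p => ?_)
  rw [← sum_smul_vechBasis_apply a p, h4]
  rfl

lemma isSymm_info22 (θ : StudentParam k) : (info22 θ).IsSymm := by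
  ext p q
  simp only [Matrix.transpose_apply, info22, Matrix.of_apply]
  exact covariance_comm _ _

lemma conj_inv_self (hA : A.det ≠ 0) (hAS : A * Aᵀ = S) : A⁻¹ * S * A⁻¹ᵀ = 1 := by
  have hu : IsUnit A.det := isUnit_iff_ne_zero.mpr hA
  rw [← hAS, ← Matrix.mul_assoc, Matrix.nonsing_inv_mul _ hu, Matrix.one_mul,
    ← Matrix.transpose_mul, Matrix.nonsing_inv_mul _ hu, Matrix.transpose_one]

/-- The coefficients of the projection of the tail score on the scatter scores. -/
def projVec (S : Matrix (Fin k) (Fin k) ℝ) (ν : ℝ) : VechIdx k → ℝ :=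
  fun p => projCoef k ν * S p.1.1 p.1.2

lemma sum_projVec (hS : S.IsSymm) :
    ∑ q, projVec S ν q • vechBasis q = projCoef k ν • S := by
  conv_rhs => rw [← sum_vech_smul_vechBasis hS]
  rw [Finset.smul_sum]
  exact Finset.sum_congr rfl fun q _ => by rw [projVec, smul_smul]

lemma linScore_projVec (hA : A.det ≠ 0) (hAS : A * Aᵀ = S) (y : Fin k → ℝ) :
    linScore ν 0 (A⁻¹ * (∑ q, projVec S ν q • vechBasis q) * A⁻¹ᵀ) 0 y
      = projCoef k ν * radScore k ν (y ⬝ᵥ y) := by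
  have hSs : S.IsSymm := by rw [← hAS]; exact Matrix.isSymm_mul_transpose_self A
  have h := linScore_smul ν (projCoef k ν) 0 (1 : Matrix (Fin k) (Fin k) ℝ) 0 y
  rw [sum_projVec hSs, Matrix.mul_smul, Matrix.smul_mul, conj_inv_self hA hAS, ← linScore_one, ← h,
    smul_zero, mul_zero]

/-- These are the normal equations of the projection. The coordinates `projCoef` · vech S represent
the direction S, which pulls back to T = 1 with the radial score; the residual is the efficient
score, orthogonal to all scatter scores. -/
lemma info22_mulVec_projVec (hk : 1 ≤ k) (hA : A.det ≠ 0) (hAS : A * Aᵀ = S) (b : Fin k → ℝ)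
    (hν : 0 < ν) : info22 ⟨b, S, ν⟩ *ᵥ projVec S ν = info23 ⟨b, S, ν⟩ := by
  funext p
  have hs := isSymm_conj (A := A⁻¹) (vechBasis_isSymm p)
  have hp := memLp_linScore hν 0 hs 0
  rw [info22_mulVec hA hAS b hν, info23_eq hA hAS b hν]
  simp only [linScore_projVec hA hAS]
  have i1 : Integrable (fun y => linScore ν 0 (A⁻¹ * vechBasis p * A⁻¹ᵀ) 0 y
      * tailScore k ν (y ⬝ᵥ y)) (stdLaw k ν) := hp.integrable_mul (memLp_tailScore k hν)
  have i2 : Integrable (fun y => effScore k ν (y ⬝ᵥ y)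
      * linScore ν 0 (A⁻¹ * vechBasis p * A⁻¹ᵀ) 0 y) (stdLaw k ν) :=
    (memLp_effScore k hν).integrable_mul hp
  have h := integral_effScore_mul_linScore hk hν 0 hs 0
  rw [zero_mul] at h
  refine Eq.trans ?_ ((integral_sub i1 i2).trans (by rw [h, sub_zero]))
  congr 1
  funext y
  rw [effScore]
  ring

lemma info23_dotProduct (hk : 1 ≤ k) (hA : A.det ≠ 0) (hAS : A * Aᵀ = S) (b : Fin k → ℝ)
    (hν : 0 < ν) (v : VechIdx k → ℝ) :
    info23 ⟨b, S, ν⟩ ⬝ᵥ ((info22 ⟨b, S, ν⟩)⁻¹ *ᵥ v) = projVec S ν ⬝ᵥ v := by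
  have hu := isUnit_det_info22 hA hAS b hν
  have hsym : (info22 ⟨b, S, ν⟩)⁻¹ᵀ = (info22 ⟨b, S, ν⟩)⁻¹ := by
    rw [Matrix.transpose_nonsing_inv, (isSymm_info22 _).eq]
  rw [Matrix.dotProduct_mulVec, ← Matrix.mulVec_transpose, hsym,
    ← info22_mulVec_projVec hk hA hAS b hν, Matrix.mulVec_mulVec, Matrix.nonsing_inv_mul _ hu,
    Matrix.one_mulVec]

end Info

/-- The efficient information is free of location and scatter, so the denominator of the test
statistic is not affected by estimation wherever the scatter estimate is positive definite. -/
theorem effInfo_eq (hk : 1 ≤ k) {θ : StudentParam k} (hS : θ.scatter.PosDef) (hν : 0 < θ.tail) :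
    effInfo θ = effVar k θ.tail := by
  obtain ⟨b, S, ν⟩ := θ
  obtain ⟨A, hA, hAS⟩ := exists_mul_transpose_eq hS
  have hs := fun p : VechIdx k => isSymm_conj (A := A⁻¹) (vechBasis_isSymm p)
  have h1 : projVec S ν ⬝ᵥ info23 ⟨b, S, ν⟩
      = ∫ y : Fin k → ℝ, projCoef k ν * radScore k ν (y ⬝ᵥ y) * tailScore k ν (y ⬝ᵥ y)
        ∂(stdLaw k ν) := by
    simp only [dotProduct, info23_eq hA hAS b hν, ← integral_const_mul]
    rw [← integral_finsetSum]
    · congr 1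
      funext y
      have h2 := linScore_projVec (ν := ν) hA hAS y
      simp only [dotProduct] at h2
      rw [← h2, ← sum_smul_conj, ← linScore_sum, Finset.sum_mul]
      exact Finset.sum_congr rfl fun p _ => by ring
    · intro p _
      have i : Integrable (fun y => linScore ν 0 (A⁻¹ * vechBasis p * A⁻¹ᵀ) 0 y
          * tailScore k ν (y ⬝ᵥ y)) (stdLaw k ν) :=
        (memLp_linScore hν 0 (hs p) 0).integrable_mul (memLp_tailScore k hν)
      exact i.const_mul _
  rw [effInfo, info23_dotProduct hk hA hAS b hν, h1, info33_eq hA hAS b hν,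
    ← integral_effScore_mul_tailScore hk hν]
  have i1 : Integrable (fun y : Fin k → ℝ => tailScore k ν (y ⬝ᵥ y) * tailScore k ν (y ⬝ᵥ y))
    (stdLaw k ν) := (memLp_tailScore k hν).integrable_mul (memLp_tailScore k hν)
  have i2 : Integrable (fun y : Fin k → ℝ =>
      projCoef k ν * radScore k ν (y ⬝ᵥ y) * tailScore k ν (y ⬝ᵥ y)) (stdLaw k ν) :=
    ((memLp_radScore k hν).const_mul _).integrable_mul (memLp_tailScore k hν)
  rw [← integral_sub i1 i2]
  congr 1
  funext y
  rw [effScore]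
  ring

theorem effCentral_eq (hk : 1 ≤ k) {θ : StudentParam k} (hS : θ.scatter.PosDef)
    (hν : 0 < θ.tail) {n : ℕ} (x : Sample k n) :
    effCentral θ x = (√(n : ℝ))⁻¹ * ∑ i, effScoreAt θ (x i) := by
  obtain ⟨b, S, ν⟩ := θ
  obtain ⟨A, hA, hAS⟩ := exists_mul_transpose_eq hS
  have h1 : ∀ z, scoreTail ⟨b, S, ν⟩ z - ∑ p, projVec S ν p * scoreScatter ⟨b, S, ν⟩ p z
      = effScoreAt ⟨b, S, ν⟩ z := by
    intro z
    obtain ⟨y, rfl⟩ := exists_affine_preimage hA b z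
    rw [effScoreAt_std hA hAS, scoreTail_affine hA hAS b hν, effScore,
      ← linScore_projVec (ν := ν) hA hAS y, ← sum_smul_conj, ← linScore_sum]
    simp only [scoreScatter_affine hA hAS b hν]
  rw [effCentral, info23_dotProduct hk hA hAS b hν, central3]
  simp only [central2, dotProduct, ← h1]
  rw [Finset.sum_sub_distrib, mul_sub, Finset.sum_comm]
  congr 1
  rw [Finset.mul_sum]
  refine Finset.sum_congr rfl fun p _ => ?_
  rw [← Finset.mul_sum]
  ring

end

section

/-! ### Measurability of the test statistic -/

lemma measurable_inv_apply (i j : Fin k) :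
    Measurable fun M : Fin k → Fin k → ℝ => (Matrix.of M)⁻¹ i j := by
  have hid : Continuous fun M : Fin k → Fin k → ℝ => Matrix.of M := continuous_id
  have h1 : Measurable fun M : Fin k → Fin k → ℝ => (Matrix.of M).det :=
    hid.matrix_det.measurable
  have h2 : Measurable fun M : Fin k → Fin k → ℝ => (Matrix.of M).adjugate i j :=
    (hid.matrix_adjugate.matrix_elem i j).measurable
  simp only [Matrix.inv_def, Ring.inverse_eq_inv', Matrix.smul_apply, smul_eq_mul]
  exact h1.inv.mul h2

/-- The positive definite matrices are the closed set of positive semidefinite ones minus the closed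
set of singular ones. -/
lemma measurableSet_posDef : MeasurableSet {M : Fin k → Fin k → ℝ | (Matrix.of M).PosDef} := by
  have hid : Continuous fun M : Fin k → Fin k → ℝ => Matrix.of M := continuous_id
  have h1 : IsClosed {M : Fin k → Fin k → ℝ | (Matrix.of M).PosSemidef} := by
    have : {M : Fin k → Fin k → ℝ | (Matrix.of M).PosSemidef}
        = {M | (Matrix.of M)ᵀ = Matrix.of M} ∩
          ⋂ x : Fin k → ℝ, {M | 0 ≤ x ⬝ᵥ (Matrix.of M) *ᵥ x} := by
      ext M
      simp only [Set.mem_ofPred_eq, Set.mem_inter_iff, Set.mem_iInter,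
        Matrix.posSemidef_iff_dotProduct_mulVec, Matrix.IsHermitian,
        Matrix.conjTranspose_eq_transpose_of_trivial, star_trivial]
    rw [this]
    refine (isClosed_eq hid.matrix_transpose hid).inter (isClosed_iInter fun x => ?_)
    exact isClosed_le continuous_const (continuous_const.dotProduct (hid.matrix_mulVec continuous_const))
  have h2 : IsClosed {M : Fin k → Fin k → ℝ | (Matrix.of M).det = 0} :=
    isClosed_eq hid.matrix_det continuous_const
  have h3 : {M : Fin k → Fin k → ℝ | (Matrix.of M).PosDef}
      = {M | (Matrix.of M).PosSemidef} \ {M | (Matrix.of M).det = 0} := by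
    ext M
    constructor
    · intro h
      exact ⟨h.posSemidef, h.det_pos.ne'⟩
    · rintro ⟨h, h'⟩
      exact h.posDef_iff_det_ne_zero.mpr h'
  rw [h3]
  exact h1.measurableSet.diff h2.measurableSet

variable {muHat : ∀ n, Sample k n → Fin k → ℝ} {sHat : ∀ n, Sample k n → Matrix (Fin k) (Fin k) ℝ}

lemma measurableSet_posDef_sHat (hest : IsEstimator muHat sHat) (n : ℕ) :
    MeasurableSet {x | (sHat n x).PosDef} := by
  have h : Measurable fun x : Sample k n => fun i j => sHat n x i j :=
    measurable_pi_lambda _ fun i => measurable_pi_lambda _ fun j => hest.measurable_scatter n i j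
  exact h measurableSet_posDef

lemma testStat_eq (hk : 1 ≤ k) {ν₀ : ℝ} (hν₀ : 0 < ν₀) {n : ℕ} {x : Sample k n}
    (h : (sHat n x).PosDef) : testStat ν₀ muHat sHat n x
      = (√(n : ℝ))⁻¹ * (∑ i, effScoreAt ⟨muHat n x, sHat n x, ν₀⟩ (x i)) / √(effVar k ν₀) := by
  rw [testStat, if_pos h, effCentral_eq hk h hν₀, effInfo_eq hk h hν₀]

lemma measurable_testStat (hk : 1 ≤ k) {ν₀ : ℝ} (hν₀ : 0 < ν₀) (hest : IsEstimator muHat sHat)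
    (n : ℕ) : Measurable (testStat ν₀ muHat sHat n) := by
  classical
  have h : Measurable fun x : Sample k n => fun i j => sHat n x i j :=
    measurable_pi_lambda _ fun i => measurable_pi_lambda _ fun j => hest.measurable_scatter n i j
  have hinv : ∀ i j, Measurable fun x : Sample k n => (sHat n x)⁻¹ i j :=
    fun i j => (measurable_inv_apply i j).comp h
  have hloc : ∀ i, Measurable fun x : Sample k n => muHat n x i := fun i =>
    (measurable_pi_apply i).comp (hest.measurable_loc n)
  have hq : ∀ l, Measurable fun x : Sample k n =>
      mahalanobisSq ⟨muHat n x, sHat n x, ν₀⟩ (x l) := by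
    intro l
    simp only [mahalanobisSq, dotProduct, Matrix.mulVec, Pi.sub_apply]
    have hc : ∀ i, Measurable fun x : Sample k n => x l i - muHat n x i := fun i =>
      Measurable.sub (f := fun x : Sample k n => x l i)
        ((measurable_pi_apply i).comp (measurable_pi_apply l)) (hloc i)
    exact Finset.measurable_sum _ fun i _ => (hc i).mul
      (Finset.measurable_sum _ fun j _ => (hinv i j).mul (hc j))
  have hT : Measurable fun x : Sample k n => (√(n : ℝ))⁻¹ *
      (∑ i, effScoreAt ⟨muHat n x, sHat n x, ν₀⟩ (x i)) / √(effVar k ν₀) :=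
    ((Finset.measurable_sum _ fun i _ =>
      (measurable_effScore k ν₀).comp (hq i)).const_mul _).div_const _
  have h2 : testStat ν₀ muHat sHat n = fun x => if (sHat n x).PosDef then
      (√(n : ℝ))⁻¹ * (∑ i, effScoreAt ⟨muHat n x, sHat n x, ν₀⟩ (x i)) / √(effVar k ν₀) else 0 := by
    funext x
    split_ifs with hx
    · exact testStat_eq hk hν₀ hx
    · rw [testStat, if_neg hx]
  rw [h2]
  exact Measurable.ite (measurableSet_posDef_sHat hest n) hT measurable_const

end

section

/-! ### Product measures -/

/-- Since log(1 + g) = g + O(|g|²) and N|g|² → 0, the exponent N log(1 + g) has the same limit as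
Ng. Varying exponents `N j` allow sample sizes along subsequences. -/
lemma tendsto_one_add_pow_exp {ι : Type*} {l : Filter ι} {N : ι → ℕ} (hN : Tendsto N l atTop)
    {g : ι → ℂ} {t : ℂ} (hg : Tendsto (fun j => (N j : ℂ) * g j) l (𝓝 t)) :
    Tendsto (fun j => (1 + g j) ^ N j) l (𝓝 (Complex.exp t)) := by
  have hinv : Tendsto (fun j => ((N j : ℂ))⁻¹) l (𝓝 0) :=
    tendsto_inv₀_cobounded.comp ((tendsto_natCast_atTop_cobounded (α := ℂ)).comp hN)
  have hne : ∀ᶠ j in l, (N j : ℂ) ≠ 0 := by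
    filter_upwards [hN.eventually_ne_atTop 0] with j hj
    exact_mod_cast hj
  have hg0 : Tendsto g l (𝓝 0) := by
    have := hg.mul hinv
    rw [mul_zero] at this
    refine this.congr' ?_
    filter_upwards [hne] with j hj
    field_simp
  have hlog : Tendsto (fun j => (N j : ℂ) * Complex.log (1 + g j)) l (𝓝 t) := by
    refine hg.congr_dist ?_
    have h1 : Tendsto (fun j => ‖(N j : ℂ) * g j‖ * ‖g j‖) l (𝓝 0) := by
      have := hg.norm.mul hg0.norm
      rwa [norm_zero, mul_zero] at this
    refine squeeze_zero' (Eventually.of_forall fun _ => dist_nonneg) ?_ h1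
    have h2 : ∀ᶠ j in l, ‖g j‖ < 1 / 2 := by
      have := hg0.norm
      rw [norm_zero] at this
      exact this.eventually_lt_const (by norm_num)
    filter_upwards [h2] with j hj
    rw [dist_comm, Complex.dist_eq, ← mul_sub, norm_mul, norm_mul, mul_assoc]
    gcongr
    refine (Complex.norm_log_one_add_sub_self_le (by linarith)).trans ?_
    have h3 : (1 - ‖g j‖)⁻¹ ≤ 2 := by
      rw [inv_le_comm₀ (by linarith) (by norm_num)]
      linarith
    calc ‖g j‖ ^ 2 * (1 - ‖g j‖)⁻¹ / 2 ≤ ‖g j‖ ^ 2 * 2 / 2 := by gcongr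
      _ = ‖g j‖ * ‖g j‖ := by ring
  refine ((Complex.continuous_exp.tendsto _).comp hlog).congr' ?_
  filter_upwards [hg0.eventually_ne (show (0 : ℂ) ≠ -1 by simp)] with j hj
  have h4 : 1 + g j ≠ 0 := fun h => hj (by linear_combination h)
  rw [Function.comp_apply, Complex.exp_nat_mul, Complex.exp_log h4]

lemma lintegral_pi_prod {ι : Type*} [Fintype ι] {Ω : ι → Type*} {mΩ : ∀ i, MeasurableSpace (Ω i)}
    {μ : ∀ i, Measure (Ω i)} [∀ i, IsProbabilityMeasure (μ i)] {f : ∀ i, Ω i → ℝ≥0∞}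
    (hf : ∀ i, Measurable (f i)) :
    ∫⁻ x, ∏ i, f i (x i) ∂(Measure.pi μ) = ∏ i, ∫⁻ y, f i y ∂(μ i) := by
  rw [lintegral_prod_eq_prod_lintegral_of_indepFun Finset.univ
    (fun i (x : ∀ i, Ω i) => f i (x i))
    (iIndepFun_pi fun i => (hf i).aemeasurable) fun i => (hf i).comp (measurable_pi_apply i)]
  refine Finset.prod_congr rfl fun i _ => ?_
  exact (measurePreserving_eval μ i).lintegral_comp (hf i)

lemma pi_withDensity {ι : Type*} [Fintype ι] {Ω : ι → Type*} {mΩ : ∀ i, MeasurableSpace (Ω i)}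
    {μ : ∀ i, Measure (Ω i)} [∀ i, IsProbabilityMeasure (μ i)] {f : ∀ i, Ω i → ℝ≥0∞}
    (hf : ∀ i, Measurable (f i)) [∀ i, SigmaFinite ((μ i).withDensity (f i))] :
    Measure.pi (fun i => (μ i).withDensity (f i))
      = (Measure.pi μ).withDensity fun x => ∏ i, f i (x i) := by
  refine Measure.pi_eq fun s hs => ?_
  rw [withDensity_apply _ (MeasurableSet.univ_pi hs), ← lintegral_indicator (MeasurableSet.univ_pi hs)]
  have h1 : ∀ x : ∀ i, Ω i, (Set.univ.pi s).indicator (fun x => ∏ i, f i (x i)) x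
      = ∏ i, (s i).indicator (f i) (x i) := by
    intro x
    by_cases hx : x ∈ Set.univ.pi s
    · rw [Set.indicator_of_mem hx]
      exact Finset.prod_congr rfl fun i _ => by rw [Set.indicator_of_mem (hx i trivial)]
    · rw [Set.indicator_of_notMem hx]
      rw [Set.mem_univ_pi] at hx
      push Not at hx
      obtain ⟨i, hi⟩ := hx
      exact (Finset.prod_eq_zero (Finset.mem_univ i) (Set.indicator_of_notMem hi _)).symm
  simp_rw [h1]
  rw [lintegral_pi_prod fun i => (hf i).indicator (hs i)]
  exact Finset.prod_congr rfl fun i _ => by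
    rw [lintegral_indicator (hs i), withDensity_apply _ (hs i)]

lemma isProbabilityMeasure_sampleLaw {θ : StudentParam k} (hS : θ.scatter.PosDef)
    (hν : 0 < θ.tail) (n : ℕ) : IsProbabilityMeasure (sampleLaw θ n) := by
  have := isProbabilityMeasure_law hS hν
  unfold sampleLaw
  infer_instance

/-- The likelihood ratio of `θ'` against `θ`. -/
def likelihoodRatio (θ θ' : StudentParam k) {n : ℕ} (x : Sample k n) : ℝ :=
  ∏ i, density θ' (x i) / density θ (x i)

lemma measurable_likelihoodRatio (θ θ' : StudentParam k) (n : ℕ) :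
    Measurable (likelihoodRatio θ θ' : Sample k n → ℝ) :=
  Finset.measurable_prod _ fun i _ =>
    ((measurable_density θ').div (measurable_density θ)).comp (measurable_pi_apply i)

section

variable {θ θ' : StudentParam k}

lemma likelihoodRatio_pos (hS : θ.scatter.PosDef) (hν : 0 < θ.tail)
    (hS' : θ'.scatter.PosDef) (hν' : 0 < θ'.tail) {n : ℕ} (x : Sample k n) : 0 < likelihoodRatio θ θ' x :=
  Finset.prod_pos fun _ _ => div_pos (density_pos hS' hν' _) (density_pos hS hν _)

lemma sampleLaw_eq_withDensity (hS : θ.scatter.PosDef) (hν : 0 < θ.tail)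
    (hS' : θ'.scatter.PosDef) (hν' : 0 < θ'.tail) (n : ℕ) : sampleLaw θ' n
    = (sampleLaw θ n).withDensity fun x => ENNReal.ofReal (likelihoodRatio θ θ' x) := by
  have := isProbabilityMeasure_law hS hν
  have := isProbabilityMeasure_law hS' hν'
  have h := law_eq_withDensity (θ' := θ') hS hν
  have hm : Measurable fun x => ENNReal.ofReal (density θ' x / density θ x) :=
    ((measurable_density θ').div (measurable_density θ)).ennreal_ofReal
  have hp : IsProbabilityMeasure ((law θ).withDensity
      fun x => ENNReal.ofReal (density θ' x / density θ x)) := by rw [← h]; infer_instance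
  rw [sampleLaw, sampleLaw, h, pi_withDensity fun _ : Fin n => hm]
  congr 1
  funext x
  rw [likelihoodRatio, ENNReal.ofReal_prod_of_nonneg fun i _ =>
    (div_pos (density_pos hS' hν' _) (density_pos hS hν _)).le]

/-- Cauchy–Schwarz for the likelihood ratio against the indicator of A; the second moment of a
product ratio is the n-th power of the one-observation moment. -/
lemma sampleLaw_le_of_integral_sq_le (hS : θ.scatter.PosDef) (hν : 0 < θ.tail)
    (hS' : θ'.scatter.PosDef) (hν' : 0 < θ'.tail) {B : ℝ} {n : ℕ}
    (hint : Integrable (fun x => (density θ' x / density θ x) ^ 2) (law θ))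
    (hB : ∫ x, (density θ' x / density θ x) ^ 2 ∂(law θ) ≤ B) {A : Set (Sample k n)}
    (hA : MeasurableSet A) :
    sampleLaw θ' n A ≤ ENNReal.ofReal (B ^ n) ^ (1 / 2 : ℝ) * sampleLaw θ n A ^ (1 / 2 : ℝ) := by
  have := isProbabilityMeasure_law hS hν
  have hr : ∀ x, 0 ≤ density θ' x / density θ x := fun x =>
    (div_pos (density_pos hS' hν' _) (density_pos hS hν _)).le
  have hm : Measurable fun x : Sample k n => ENNReal.ofReal (likelihoodRatio θ θ' x) :=
    (measurable_likelihoodRatio θ θ' n).ennreal_ofReal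
  have hB0 : 0 ≤ B := (integral_nonneg fun x => sq_nonneg _).trans hB
  rw [sampleLaw_eq_withDensity hS hν hS' hν', withDensity_apply _ hA, ← lintegral_indicator hA]
  have h1 : ∀ x : Sample k n, A.indicator (fun x => ENNReal.ofReal (likelihoodRatio θ θ' x)) x
      = ((fun x : Sample k n => ENNReal.ofReal (likelihoodRatio θ θ' x))
        * A.indicator (1 : Sample k n → ℝ≥0∞)) x := by
    intro x
    by_cases hx : x ∈ A <;> simp [hx]
  simp_rw [h1]
  refine (ENNReal.lintegral_mul_le_Lp_mul_Lq _ Real.HolderConjugate.two_two hm.aemeasurable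
    (measurable_one.indicator hA).aemeasurable).trans ?_
  gcongr
  · have h2 : ∀ x : Sample k n, ENNReal.ofReal (likelihoodRatio θ θ' x) ^ (2 : ℝ)
        = ∏ i, ENNReal.ofReal ((density θ' (x i) / density θ (x i)) ^ 2) := by
      intro x
      rw [ENNReal.rpow_two, ← ENNReal.ofReal_pow (likelihoodRatio_pos hS hν hS' hν' x).le,
        likelihoodRatio, ← Finset.prod_pow, ENNReal.ofReal_prod_of_nonneg fun i _ => sq_nonneg _]
    simp_rw [h2]
    rw [sampleLaw, lintegral_pi_prod (f := fun _ y => ENNReal.ofReal ((density θ' y / density θ y) ^ 2))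
      fun i => (((measurable_density θ').div (measurable_density θ)).pow_const 2).ennreal_ofReal,
      Finset.prod_const, Finset.card_univ, Fintype.card_fin,
      ← ofReal_integral_eq_lintegral_ofReal hint (ae_of_all _ fun x => sq_nonneg _),
      ENNReal.ofReal_pow hB0]
    gcongr
  · refine le_of_eq ?_
    have h3 : ∀ x : Sample k n, A.indicator (1 : Sample k n → ℝ≥0∞) x ^ (2 : ℝ)
        = A.indicator 1 x := by
      intro x
      by_cases hx : x ∈ A <;> simp [hx]
    simp_rw [h3]
    exact lintegral_indicator_one hA

end

/-- Variances add under independence, and the negative term -n(∫f)² is dropped. A sum is small in L²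
when f is small and its mean is smaller still. -/
lemma integral_sum_sq_le {Ω : Type*} [MeasurableSpace Ω] {P : Measure Ω} [IsProbabilityMeasure P]
    {f : Ω → ℝ} (hf : MemLp f 2 P) (n : ℕ) :
    Integrable (fun x : Fin n → Ω => (∑ i, f (x i)) ^ 2) (Measure.pi fun _ => P) ∧
    ∫ x : Fin n → Ω, (∑ i, f (x i)) ^ 2 ∂(Measure.pi fun _ => P)
      ≤ n * ∫ y, f y ^ 2 ∂P + (n * ∫ y, f y ∂P) ^ 2 := by
  have hL : ∀ i : Fin n, MemLp (fun x : Fin n → Ω => f (x i)) 2 (Measure.pi fun _ => P) := fun i =>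
    hf.comp_measurePreserving (measurePreserving_eval (fun _ => P) i)
  have hs : MemLp (∑ i, fun x : Fin n → Ω => f (x i)) 2 (Measure.pi fun _ => P) :=
    memLp_finsetSum' _ fun i _ => hL i
  have hfun : (∑ i, fun x : Fin n → Ω => f (x i)) = fun x => ∑ i, f (x i) := by
    funext x; simp
  have h1 := variance_sum_pi (ι := Fin n) (μ := fun _ => P) (X := fun _ => f) fun _ => hf
  rw [variance_eq_sub hs, hfun, Finset.sum_const, Finset.card_univ, Fintype.card_fin,
    nsmul_eq_mul, variance_eq_sub hf] at h1
  have h2 : ∫ x : Fin n → Ω, ∑ i, f (x i) ∂(Measure.pi fun _ => P) = n * ∫ y, f y ∂P := by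
    rw [integral_finsetSum _ fun i _ => (hL i).integrable one_le_two]
    simp_rw [integral_comp_eval (μ := fun _ : Fin n => P) hf.aestronglyMeasurable]
    simp
  rw [hfun] at hs
  refine ⟨hs.integrable_sq, ?_⟩
  simp only [Pi.pow_apply] at h1
  rw [h2] at h1
  have h3 : 0 ≤ (n : ℝ) * (∫ y, f y ∂P) ^ 2 := by positivity
  linarith [h1, mul_sub (n : ℝ) (∫ y, f y ^ 2 ∂P) ((∫ y, f y ∂P) ^ 2)]

lemma measure_abs_gt_le {Ω : Type*} [MeasurableSpace Ω] {P : Measure Ω} [IsFiniteMeasure P]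
    {f : Ω → ℝ} (hf : Integrable (fun x => f x ^ 2) P) {η : ℝ} (hη : 0 < η) :
    P {x | η < |f x|} ≤ ENNReal.ofReal ((∫ x, f x ^ 2 ∂P) / η ^ 2) := by
  have h1 := mul_meas_ge_le_integral_of_nonneg (ae_of_all P fun x => sq_nonneg (f x)) hf (η ^ 2)
  have h2 : {x | η < |f x|} ⊆ {x | η ^ 2 ≤ f x ^ 2} := by
    intro x hx
    have hx' : η < |f x| := hx
    show η ^ 2 ≤ f x ^ 2
    rw [← sq_abs (f x)]
    gcongr
  refine (measure_mono h2).trans ?_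
  rw [← ENNReal.ofReal_toReal (measure_ne_top P _)]
  refine ENNReal.ofReal_le_ofReal ?_
  rw [le_div_iff₀ (by positivity), mul_comm]
  exact h1

end

section

/-! ### Local sequences of parameters -/

/-- Parameters `θ' j` within `M / √(N j)` of `θ`, for sample sizes `N j → ∞`. -/
structure IsLocalSeq (θ : StudentParam k) (M : ℝ) (N : ℕ → ℕ) (θ' : ℕ → StudentParam k) :
    Prop where
  tendsto : Tendsto N atTop atTop
  posDef : ∀ j, (θ' j).scatter.PosDef
  tail_pos : ∀ j, 0 < (θ' j).tail
  near : ∀ᶠ j in atTop, IsNear (M / √(N j : ℝ)) θ (θ' j)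

lemma tendsto_inv_sqrt {N : ℕ → ℕ} (hN : Tendsto N atTop atTop) (c : ℝ) :
    Tendsto (fun j => c / √(N j : ℝ)) atTop (𝓝 0) :=
  (Real.tendsto_sqrt_atTop.comp (tendsto_natCast_atTop_atTop.comp hN)).const_div_atTop c

variable {θ : StudentParam k} {M : ℝ} {N : ℕ → ℕ} {θ' : ℕ → StudentParam k}

lemma IsLocalSeq.exists_expansion (h : IsLocalSeq θ M N θ') (hk : 1 ≤ k)
    (hS : θ.scatter.PosDef) (hν : 0 < θ.tail) :
    ∃ C δ : ℝ, 0 < C ∧ 0 < δ ∧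
      ∀ᶠ j in atTop, 1 ≤ N j ∧ Expansion θ C δ (M / √(N j : ℝ)) (θ' j) := by
  obtain ⟨C, δ, hC, hδ, he⟩ := StudentT.exists_expansion hk hS hν
  refine ⟨C, δ, hC, hδ, ?_⟩
  filter_upwards [h.near, h.tendsto.eventually_ge_atTop 1,
    (tendsto_inv_sqrt h.tendsto M).eventually_le_const hδ] with j h1 h2 h3
  exact ⟨h2, he _ _ h3 h1⟩

lemma one_add_div_pow_le {c : ℝ} (hc : 0 ≤ c) (n : ℕ) : (1 + c / n) ^ n ≤ Real.exp c := by
  rcases Nat.eq_zero_or_pos n with rfl | hn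
  · simpa using hc
  have hn' : (n : ℝ) ≠ 0 := by positivity
  calc (1 + c / n) ^ n ≤ Real.exp (c / n) ^ n := by
        gcongr
        rw [add_comm]
        exact Real.add_one_le_exp _
    _ = Real.exp c := by rw [← Real.exp_nat_mul]; congr 1; field_simp

/-- Local sequences of product laws are contiguous to the central one. -/
theorem IsLocalSeq.contiguous (h : IsLocalSeq θ M N θ') (hk : 1 ≤ k)
    (hS : θ.scatter.PosDef) (hν : 0 < θ.tail) {A : ∀ j, Set (Sample k (N j))}
    (hA : ∀ j, MeasurableSet (A j))
    (h0 : Tendsto (fun j => sampleLaw θ (N j) (A j)) atTop (𝓝 0)) :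
    Tendsto (fun j => sampleLaw (θ' j) (N j) (A j)) atTop (𝓝 0) := by
  obtain ⟨C, δ, hC, hδ, he⟩ := h.exists_expansion hk hS hν
  set K : ℝ≥0∞ := ENNReal.ofReal (Real.exp (C * M ^ 2)) ^ (1 / 2 : ℝ) with hK
  have hKt : K ≠ ∞ := ENNReal.rpow_ne_top_of_nonneg (by norm_num) ENNReal.ofReal_ne_top
  have h1 : Tendsto (fun j => K * sampleLaw θ (N j) (A j) ^ (1 / 2 : ℝ)) atTop (𝓝 0) := by
    have h2 := ((ENNReal.continuous_rpow_const (y := (1 / 2 : ℝ))).tendsto 0).comp h0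
    rw [ENNReal.zero_rpow_of_pos (by norm_num)] at h2
    have h3 := ENNReal.Tendsto.const_mul h2 (Or.inr hKt)
    rwa [mul_zero] at h3
  refine tendsto_of_tendsto_of_tendsto_of_le_of_le' tendsto_const_nhds h1
    (Eventually.of_forall fun _ => zero_le) ?_
  filter_upwards [he] with j hj
  have e := hj.2
  refine (sampleLaw_le_of_integral_sq_le hS hν e.posDef e.tail_pos e.integrable_sq
    e.integral_sq_le (hA j)).trans ?_
  gcongr
  -- At distance M n^{-1/2} the second moment is at most (1 + CM²/n)ⁿ ≤ exp(CM²), whatever n is.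
  have h4 : C * (M / √(N j : ℝ)) ^ 2 = C * M ^ 2 / N j := by
    rw [div_pow, Real.sq_sqrt (by positivity)]; ring
  rw [h4, hK]
  gcongr
  exact one_add_div_pow_le (by positivity) _

/-- The efficient central sequence as a normalized sum of efficient scores. -/
def scoreSum (θ : StudentParam k) {n : ℕ} (x : Sample k n) : ℝ :=
  (√(n : ℝ))⁻¹ * ∑ i, effScoreAt θ (x i)

lemma measurable_scoreSum (θ : StudentParam k) (n : ℕ) :
    Measurable (scoreSum θ : Sample k n → ℝ) :=
  (Finset.measurable_sum _ fun i _ =>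
    (measurable_effScoreAt θ).comp (measurable_pi_apply i)).const_mul _

lemma integral_cexp_scoreSum {θ'' : StudentParam k} (hS : θ''.scatter.PosDef)
    (hν : 0 < θ''.tail) (n : ℕ) (s : ℝ) :
    ∫ x : Sample k n, Complex.exp ((s * scoreSum θ x : ℝ) * Complex.I) ∂(sampleLaw θ'' n)
      = (∫ x, Complex.exp ((s / √(n : ℝ) * effScoreAt θ x : ℝ) * Complex.I) ∂(law θ'')) ^ n := by
  have := isProbabilityMeasure_law hS hν
  have h1 : ∀ x : Sample k n, Complex.exp ((s * scoreSum θ x : ℝ) * Complex.I)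
      = ∏ i, Complex.exp ((s / √(n : ℝ) * effScoreAt θ (x i) : ℝ) * Complex.I) := by
    intro x
    rw [← Complex.exp_sum, ← Finset.sum_mul, ← Complex.ofReal_sum, ← Finset.mul_sum, scoreSum]
    congr 3
    ring
  simp_rw [h1]
  have h2 := integral_fintype_prod_eq_pow (ι := Fin n) (μ := law θ'')
    fun y => Complex.exp ((s / √(n : ℝ) * effScoreAt θ y : ℝ) * Complex.I)
  rwa [Fintype.card_fin] at h2

/-- A central limit theorem for triangular arrays: each factor is expanded at frequency s/√n under
the moving law. Location and scatter may vary arbitrarily within the ball; only the rescaled tail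
displacement has to converge. -/
theorem IsLocalSeq.tendsto_charFun_scoreSum (h : IsLocalSeq θ M N θ') (hk : 1 ≤ k)
    (hS : θ.scatter.PosDef) (hν : 0 < θ.tail) {t : ℝ}
    (ht : Tendsto (fun j => √(N j : ℝ) * ((θ' j).tail - θ.tail)) atTop (𝓝 t)) (s : ℝ) :
    Tendsto (fun j => ∫ x : Sample k (N j),
        Complex.exp ((s * scoreSum θ x : ℝ) * Complex.I) ∂(sampleLaw (θ' j) (N j)))
      atTop (𝓝 (Complex.exp (((s * t * effVar k θ.tail : ℝ) : ℂ) * Complex.I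
        - ((s ^ 2 * effVar k θ.tail / 2 : ℝ) : ℂ)))) := by
  obtain ⟨C, δ, hC, hδ, he⟩ := h.exists_expansion hk hS hν
  set G := effVar k θ.tail with hG
  set a : ℕ → ℂ := fun j =>
    ∫ x, Complex.exp ((s / √(N j : ℝ) * effScoreAt θ x : ℝ) * Complex.I) ∂(law (θ' j)) with ha
  simp only [fun j => integral_cexp_scoreSum (θ := θ) (h.posDef j) (h.tail_pos j) (N j) s]
  have hfun : ∀ j, a j ^ N j = (1 + (a j - 1)) ^ N j := fun j => by rw [add_sub_cancel]
  change Tendsto (fun j => a j ^ N j) _ _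
  simp only [hfun]
  refine tendsto_one_add_pow_exp h.tendsto ?_
  have hw : Tendsto (fun j => ((s * (√(N j : ℝ) * ((θ' j).tail - θ.tail)) * G : ℝ) : ℂ) * Complex.I
      - ((s ^ 2 * G / 2 : ℝ) : ℂ)) atTop
      (𝓝 (((s * t * G : ℝ) : ℂ) * Complex.I - ((s ^ 2 * G / 2 : ℝ) : ℂ))) :=
    (((Complex.continuous_ofReal.tendsto _).comp
      ((ht.const_mul s).mul_const G)).mul_const _).sub_const _
  refine hw.congr_dist ?_
  refine squeeze_zero' (Eventually.of_forall fun _ => dist_nonneg) ?_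
    -- With σ = s/√n and d = M/√n each remainder term is of order n^{-3/2}, so n copies contribute
    -- O(n^{-1/2}).
    (tendsto_inv_sqrt h.tendsto (C * (|s| * M ^ 2 + s ^ 2 * |M| + |s| ^ 3)))
  filter_upwards [he, (tendsto_inv_sqrt h.tendsto |s|).eventually_le_const hδ, h.near]
    with j hj hj' hj''
  obtain ⟨hn, e⟩ := hj
  set r := √(N j : ℝ) with hr
  have hr0 : 0 < r := Real.sqrt_pos.mpr (by exact_mod_cast hn)
  have hrr : (N j : ℝ) = r ^ 2 := (Real.sq_sqrt (by positivity)).symm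
  have h1 := e.charFun_le (s / r) (by rwa [abs_div, abs_of_pos hr0])
  have hM : 0 ≤ M := by
    have := hj''.nonneg
    rwa [le_div_iff₀ hr0, zero_mul] at this
  have hrc : (r : ℂ) ≠ 0 := by exact_mod_cast hr0.ne'
  have h2 : (N j : ℂ) = (r : ℂ) ^ 2 := by exact_mod_cast congrArg (fun x : ℝ => (x : ℂ)) hrr
  rw [dist_comm, Complex.dist_eq]
  have h3 : (N j : ℂ) * (a j - 1) - (((s * (r * ((θ' j).tail - θ.tail)) * G : ℝ) : ℂ) * Complex.I
      - ((s ^ 2 * G / 2 : ℝ) : ℂ)) = (N j : ℂ) * (a j - (1 + ((s / r : ℝ) : ℂ) * Complex.I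
        * (((θ' j).tail - θ.tail) * G : ℝ) - (((s / r) ^ 2 / 2 * G : ℝ) : ℂ))) := by
    rw [h2]
    push_cast
    field_simp
    ring
  rw [h3, norm_mul, Complex.norm_natCast, abs_of_nonneg hM]
  refine (mul_le_mul_of_nonneg_left h1 (by positivity)).trans (le_of_eq ?_)
  rw [hrr, abs_div, abs_of_pos hr0]
  field_simp

/-! ### Substituting the estimator -/

/-- Each summand changes by O(n^{-1/2}) with mean O(1/n), so variance and squared mean of the
normalized sum are both O(1/n). No drift term appears, thanks to the orthogonality to the nuisance
scores. -/
lemma integral_scoreSum_sub_sq_le {v : StudentParam k} (hS : θ.scatter.PosDef) (hν : 0 < θ.tail)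
    {C δ : ℝ} (hC : 0 < C) {n : ℕ} (hn : 1 ≤ n) (e : Expansion θ C δ (M / √(n : ℝ)) v)
    (hv : v.tail = θ.tail) :
    Integrable (fun x : Sample k n => (scoreSum v x - scoreSum θ x) ^ 2) (sampleLaw θ n) ∧
    ∫ x : Sample k n, (scoreSum v x - scoreSum θ x) ^ 2 ∂(sampleLaw θ n)
      ≤ C ^ 2 * (M ^ 2 + M ^ 4) / n := by
  have := isProbabilityMeasure_law hS hν
  set f : (Fin k → ℝ) → ℝ := fun x => effScoreAt v x - effScoreAt θ x with hf
  have hfm : Measurable f := (measurable_effScoreAt v).sub (measurable_effScoreAt θ)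
  have hfb : ∀ x, |f x| ≤ C * (M / √(n : ℝ)) := e.score_sub_le hv
  have hL : MemLp f 2 (law θ) :=
    MemLp.of_bound hfm.aestronglyMeasurable _ (ae_of_all _ hfb)
  obtain ⟨h1, h2⟩ := integral_sum_sq_le hL n
  have hn0 : (0 : ℝ) < n := by exact_mod_cast hn
  have hsq : (√(n : ℝ)) ^ 2 = n := Real.sq_sqrt hn0.le
  have h3 : ∀ x : Sample k n, (scoreSum v x - scoreSum θ x) ^ 2
      = (n : ℝ)⁻¹ * (∑ i, f (x i)) ^ 2 := by
    intro x
    rw [scoreSum, scoreSum, ← mul_sub, ← Finset.sum_sub_distrib, mul_pow, inv_pow, hsq]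
  simp_rw [h3]
  refine ⟨h1.const_mul _, ?_⟩
  rw [integral_const_mul]
  have h4 : ∫ x, f x ^ 2 ∂(law θ) ≤ (C * (M / √(n : ℝ))) ^ 2 := by
    refine (integral_mono hL.integrable_sq
      (integrable_const ((C * (M / √(n : ℝ))) ^ 2)) fun x => ?_).trans_eq (by simp)
    rw [← sq_abs]
    exact pow_le_pow_left₀ (abs_nonneg _) (hfb x) 2
  have h5 : (n * ∫ x, f x ∂(law θ)) ^ 2 ≤ (n * (C * (M / √(n : ℝ)) ^ 2)) ^ 2 := by
    rw [← sq_abs, abs_mul, abs_of_pos hn0]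
    gcongr
    exact e.integral_score_sub_le hv
  rw [mul_pow, div_pow, hsq] at h4
  rw [div_pow, hsq] at h5
  calc (n : ℝ)⁻¹ * ∫ x : Sample k n, (∑ i, f (x i)) ^ 2 ∂(sampleLaw θ n)
      ≤ (n : ℝ)⁻¹ * (n * (C ^ 2 * (M ^ 2 / n)) + (n * (C * (M ^ 2 / n))) ^ 2) := by
        refine mul_le_mul_of_nonneg_left (h2.trans ?_) (by positivity)
        gcongr
    _ = C ^ 2 * (M ^ 2 + M ^ 4) / n := by field_simp

lemma InBall.mono {n : ℕ} {M M' : ℝ} (h : M ≤ M') {μ μ' : Fin k → ℝ}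
    {S S' : Matrix (Fin k) (Fin k) ℝ} (hb : InBall n M μ S μ' S') : InBall n M' μ S μ' S' :=
  ⟨fun i => (hb.1 i).trans h, fun i j => (hb.2 i j).trans h⟩

lemma InBall.isNear {n : ℕ} (hn : 1 ≤ n) {M : ℝ} (hM : 0 ≤ M) {μ μ' : Fin k → ℝ}
    {S S' : Matrix (Fin k) (Fin k) ℝ} (hb : InBall n M μ S μ' S') (hS' : S'.IsSymm) {ν ν' : ℝ}
    (hν : √(n : ℝ) * |ν' - ν| ≤ M) : IsNear (M / √(n : ℝ)) ⟨μ, S, ν⟩ ⟨μ', S', ν'⟩ := by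
  have hn0 : 0 < √(n : ℝ) := Real.sqrt_pos.mpr (by exact_mod_cast hn)
  refine ⟨by positivity, fun i => ?_, fun i j => ?_, hS', ?_⟩ <;>
    rw [le_div_iff₀' hn0]
  exacts [hb.1 i, hb.2 i j, hν]

variable {muHat : ∀ n, Sample k n → Fin k → ℝ} {sHat : ∀ n, Sample k n → Matrix (Fin k) (Fin k) ℝ}

/-- Up to small probability the estimate lies in a ball of radius M n^{-1/2}, where it has at most
N₀ possible values. For each fixed value Chebyshev gives probability O(1/n), so a union bound
suffices and no uniformity over the ball is needed. -/
theorem tendsto_testStat_sub (hk : 1 ≤ k) {ν₀ : ℝ} (hν₀ : 0 < ν₀) (hest : IsEstimator muHat sHat)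
    (hroot : RootNConsistent ν₀ muHat sHat) (hdisc : LocallyDiscrete muHat sHat)
    (μ : Fin k → ℝ) {S : Matrix (Fin k) (Fin k) ℝ} (hS : S.PosDef) {η : ℝ} (hη : 0 < η) :
    Tendsto (fun n => sampleLaw ⟨μ, S, ν₀⟩ n {x | η < |testStat ν₀ muHat sHat n x
      - scoreSum ⟨μ, S, ν₀⟩ x / √(effVar k ν₀)|}) atTop (𝓝 0) := by
  set θ : StudentParam k := ⟨μ, S, ν₀⟩ with hθ
  have hG : 0 < √(effVar k ν₀) := Real.sqrt_pos.mpr (effVar_pos hk hν₀)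
  set g := √(effVar k ν₀) with hg
  rw [ENNReal.tendsto_nhds_zero]
  intro ε hε
  obtain ⟨ε', hε', hε'2⟩ : ∃ ε' : ℝ, 0 < ε' ∧ ENNReal.ofReal ε' + ENNReal.ofReal ε' ≤ ε := by
    rcases eq_or_ne ε ∞ with rfl | hε2
    · exact ⟨1, one_pos, le_top⟩
    · refine ⟨ε.toReal / 2, by have := ENNReal.toReal_pos hε.ne' hε2; positivity, ?_⟩
      rw [← ENNReal.ofReal_add (by positivity) (by positivity), add_halves,
        ENNReal.ofReal_toReal hε2]
  obtain ⟨M₀, hM₀⟩ := hroot μ S hS ε' hε'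
  -- Consistency gives no sign for the radius, while the local expansion needs a nonnegative one.
  set M := max M₀ 0 with hM
  have hM0 : 0 ≤ M := le_max_right _ _
  obtain ⟨N₀, hN₀⟩ := hdisc μ S hS M
  obtain ⟨C, δ, hC, hδ, he⟩ := StudentT.exists_expansion hk (θ := θ) hS hν₀
  set K := C ^ 2 * (M ^ 2 + M ^ 4) / (η * g) ^ 2 with hK
  have hsmall : ∀ᶠ n : ℕ in atTop, (N₀ : ℝ) * (K / n) ≤ ε' := by
    have h1 : Tendsto (fun n : ℕ => (N₀ : ℝ) * (K / n)) atTop (𝓝 ((N₀ : ℝ) * 0)) :=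
      (tendsto_const_div_atTop_nhds_zero_nat K).const_mul _
    rw [mul_zero] at h1
    exact h1.eventually_le_const hε'
  filter_upwards [hM₀, hN₀, hsmall, eventually_ge_atTop 1,
    (tendsto_inv_sqrt tendsto_id M).eventually_le_const hδ] with n h1 h2 h3 hn h4
  have := isProbabilityMeasure_sampleLaw (θ := θ) hS hν₀ n
  set F := {v ∈ Set.range fun x => (muHat n x, sHat n x) | InBall n M μ S v.1 v.2} with hF
  have hFf : F.Finite := Set.finite_of_encard_le_coe h2
  have hFc : hFf.toFinset.card ≤ N₀ := by
    rw [hFf.encard_eq_coe_toFinset_card] at h2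
    exact_mod_cast h2
  have hexp : ∀ v ∈ F, Expansion θ C δ (M / √(n : ℝ)) ⟨v.1, v.2, ν₀⟩ := by
    rintro v ⟨⟨x, rfl⟩, hb⟩
    refine he _ _ h4 (hb.isNear hn hM0 (hest.symm n x) ?_)
    simpa using hM0
  have hcover : {x | η < |testStat ν₀ muHat sHat n x - scoreSum θ x / g|} ⊆
      {x | ¬ InBall n M₀ μ S (muHat n x) (sHat n x)} ∪ ⋃ v ∈ hFf.toFinset,
        {x : Sample k n | η * g < |scoreSum ⟨v.1, v.2, ν₀⟩ x - scoreSum θ x|} := by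
    intro x hx
    by_cases hb : InBall n M₀ μ S (muHat n x) (sHat n x)
    · right
      have hv : (muHat n x, sHat n x) ∈ F := ⟨⟨x, rfl⟩, hb.mono (le_max_left _ _)⟩
      have hx' : η < |testStat ν₀ muHat sHat n x - scoreSum θ x / g| := hx
      rw [testStat_eq hk hν₀ (hexp _ hv).posDef, ← hg] at hx'
      simp only [Set.mem_iUnion]
      refine ⟨(muHat n x, sHat n x), hFf.mem_toFinset.mpr hv, ?_⟩
      change η * g < |scoreSum ⟨muHat n x, sHat n x, ν₀⟩ x - scoreSum θ x|
      change η < |scoreSum ⟨muHat n x, sHat n x, ν₀⟩ x / g - scoreSum θ x / g| at hx'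
      rwa [← sub_div, abs_div, abs_of_pos hG, lt_div_iff₀ hG] at hx'
    · exact Or.inl hb
  have hterm : ∀ v ∈ hFf.toFinset, sampleLaw θ n
      {x : Sample k n | η * g < |scoreSum ⟨v.1, v.2, ν₀⟩ x - scoreSum θ x|}
      ≤ ENNReal.ofReal (K / n) := by
    intro v hv
    obtain ⟨i1, i2⟩ := integral_scoreSum_sub_sq_le (θ := θ) hS hν₀ hC hn
      (hexp v (hFf.mem_toFinset.mp hv)) rfl
    refine (measure_abs_gt_le i1 (by positivity)).trans (ENNReal.ofReal_le_ofReal ?_)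
    calc _ ≤ C ^ 2 * (M ^ 2 + M ^ 4) / n / (η * g) ^ 2 := by gcongr
      _ = K / n := by rw [hK, div_right_comm]
  calc _ ≤ _ := measure_mono hcover
    _ ≤ _ := measure_union_le _ _
    _ ≤ ENNReal.ofReal ε' + ENNReal.ofReal ε' := by
        gcongr
        refine (measure_biUnion_finset_le _ _).trans ((Finset.sum_le_sum hterm).trans ?_)
        rw [Finset.sum_const, nsmul_eq_mul]
        calc (hFf.toFinset.card : ℝ≥0∞) * ENNReal.ofReal (K / n)
            ≤ (N₀ : ℝ≥0∞) * ENNReal.ofReal (K / n) := by gcongr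
          _ = ENNReal.ofReal (N₀ * (K / n)) := by
              rw [ENNReal.ofReal_mul (by positivity), ENNReal.ofReal_natCast]
          _ ≤ ENNReal.ofReal ε' := ENNReal.ofReal_le_ofReal h3
    _ ≤ ε := hε'2

end

section

/-! ### Limit laws -/

lemma integrable_cexp_mul_I {Ω : Type*} [MeasurableSpace Ω] {P : Measure Ω} [IsFiniteMeasure P]
    {X : Ω → ℝ} (hX : Measurable X) : Integrable (fun ω => Complex.exp ((X ω : ℂ) * Complex.I)) P :=
  Integrable.of_bound ((Complex.measurable_exp.comp
    ((Complex.measurable_ofReal.comp hX).mul_const _)).aestronglyMeasurable) 1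
    (ae_of_all _ fun _ => (Complex.norm_exp_ofReal_mul_I _).le)

lemma norm_cexp_sub_cexp_le (a b : ℝ) :
    ‖Complex.exp ((a : ℂ) * Complex.I) - Complex.exp ((b : ℂ) * Complex.I)‖ ≤ |a - b| := by
  have h : Complex.exp ((a : ℂ) * Complex.I) - Complex.exp ((b : ℂ) * Complex.I)
      = Complex.exp ((b : ℂ) * Complex.I) * (Complex.exp (Complex.I * ((a - b : ℝ) : ℂ)) - 1) := by
    rw [mul_sub, ← Complex.exp_add, mul_one]
    congr 2
    push_cast
    ring
  rw [h, norm_mul, Complex.norm_exp_ofReal_mul_I, one_mul]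
  exact Real.norm_exp_I_mul_ofReal_sub_one_le

lemma norm_integral_cexp_sub_le {Ω : Type*} [MeasurableSpace Ω] {P : Measure Ω}
    [IsProbabilityMeasure P] {X Y : Ω → ℝ} (hX : Measurable X) (hY : Measurable Y) (s : ℝ) {η : ℝ}
    (hη : 0 ≤ η) :
    ‖∫ ω, Complex.exp ((s * X ω : ℝ) * Complex.I) ∂P
      - ∫ ω, Complex.exp ((s * Y ω : ℝ) * Complex.I) ∂P‖
      ≤ |s| * η + 2 * P.real {ω | η < |X ω - Y ω|} := by
  have hA : MeasurableSet {ω | η < |X ω - Y ω|} :=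
    measurableSet_lt measurable_const (hX.sub hY).abs
  rw [← integral_sub (integrable_cexp_mul_I (hX.const_mul s)) (integrable_cexp_mul_I (hY.const_mul s))]
  have hb : ∀ ω, ‖Complex.exp ((s * X ω : ℝ) * Complex.I)
      - Complex.exp ((s * Y ω : ℝ) * Complex.I)‖
      ≤ |s| * η + {ω | η < |X ω - Y ω|}.indicator (fun _ => (2 : ℝ)) ω := by
    intro ω
    by_cases h : η < |X ω - Y ω|
    · rw [Set.indicator_of_mem (show ω ∈ {ω | η < |X ω - Y ω|} from h)]
      have h1 := norm_sub_le (Complex.exp ((s * X ω : ℝ) * Complex.I))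
        (Complex.exp ((s * Y ω : ℝ) * Complex.I))
      rw [Complex.norm_exp_ofReal_mul_I, Complex.norm_exp_ofReal_mul_I] at h1
      have h2 : 0 ≤ |s| * η := by positivity
      linarith
    · rw [Set.indicator_of_notMem (show ω ∉ {ω | η < |X ω - Y ω|} from h), add_zero]
      refine (norm_cexp_sub_cexp_le _ _).trans ?_
      rw [← mul_sub, abs_mul]
      gcongr
      exact not_lt.mp h
  have hi : Integrable ({ω | η < |X ω - Y ω|}.indicator fun _ => (2 : ℝ)) P :=
    (integrable_const _).indicator hA
  refine (norm_integral_le_integral_norm _).trans ((integral_mono_of_nonneg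
    (ae_of_all _ fun _ => norm_nonneg _) ((integrable_const _).add hi) (ae_of_all _ hb)).trans ?_)
  rw [integral_add' (integrable_const _) hi, integral_indicator_const _ hA]
  simp [mul_comm]

lemma charFun_map_real {Ω : Type*} [MeasurableSpace Ω] {P : Measure Ω} {X : Ω → ℝ}
    (hX : Measurable X) (s : ℝ) :
    charFun (P.map X) s = ∫ ω, Complex.exp ((s * X ω : ℝ) * Complex.I) ∂P := by
  rw [charFun_apply_real, integral_map hX.aemeasurable]
  · simp only [Complex.ofReal_mul]
  · exact (by fun_prop : Continuous fun x : ℝ =>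
      Complex.exp ((s : ℂ) * x * Complex.I)).aestronglyMeasurable

variable {θ : StudentParam k} {M : ℝ} {N : ℕ → ℕ} {θ' : ℕ → StudentParam k}
  {muHat : ∀ n, Sample k n → Fin k → ℝ} {sHat : ∀ n, Sample k n → Matrix (Fin k) (Fin k) ℝ}

/-- The replacement of the statistic by the score sum is known under the null only; contiguity
extends it to the moving laws, where the score sum has its own limit. -/
theorem IsLocalSeq.tendsto_charFun_testStat (hk : 1 ≤ k) {ν₀ : ℝ} (hν₀ : 0 < ν₀)
    (hest : IsEstimator muHat sHat)
    (hroot : RootNConsistent ν₀ muHat sHat) (hdisc : LocallyDiscrete muHat sHat)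
    {μ : Fin k → ℝ} {S : Matrix (Fin k) (Fin k) ℝ} (hS : S.PosDef)
    (h : IsLocalSeq ⟨μ, S, ν₀⟩ M N θ') {t : ℝ}
    (ht : Tendsto (fun j => √(N j : ℝ) * ((θ' j).tail - ν₀)) atTop (𝓝 t)) (s : ℝ) :
    Tendsto (fun j => charFun ((sampleLaw (θ' j) (N j)).map (testStat ν₀ muHat sHat (N j))) s)
      atTop (𝓝 (charFun (gaussianReal (t * √(effVar k ν₀)) 1) s)) := by
  set θ : StudentParam k := ⟨μ, S, ν₀⟩ with hθ
  have hG : 0 < effVar k ν₀ := effVar_pos hk hν₀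
  set g := √(effVar k ν₀) with hg
  have hg0 : 0 < g := Real.sqrt_pos.mpr hG
  have hgg : effVar k ν₀ = g ^ 2 := (Real.sq_sqrt hG.le).symm
  have hQ := measurable_testStat hk hν₀ hest
  simp only [charFun_map_real (hQ _), charFun_gaussianReal]
  have h1 := h.tendsto_charFun_scoreSum hk (θ := θ) hS hν₀ ht (s / g)
  have h2 : Complex.exp (((s / g * t * effVar k θ.tail : ℝ) : ℂ) * Complex.I
        - (((s / g) ^ 2 * effVar k θ.tail / 2 : ℝ) : ℂ))
      = Complex.exp ((s : ℂ) * ((t * g : ℝ) : ℂ) * Complex.I - ((1 : NNReal) : ℂ) * (s : ℂ) ^ 2 / 2) := by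
    have hgc : (g : ℂ) ≠ 0 := by exact_mod_cast hg0.ne'
    have : effVar k θ.tail = g ^ 2 := hgg
    rw [this]
    congr 1
    push_cast
    field_simp
  rw [h2] at h1
  refine h1.congr_dist ?_
  rw [Metric.tendsto_nhds]
  intro ε hε
  -- Deviations up to `η` cost at most ε/3, and the exceptional event, of probability below ε/6,
  -- counts twice.
  set η := ε / (3 * (|s| + 1)) with hη
  have hη0 : 0 < η := by positivity
  have hA : ∀ n, MeasurableSet {x : Sample k n | η < |testStat ν₀ muHat sHat n x - scoreSum θ x / g|} :=
    fun n => measurableSet_lt measurable_const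
      ((hQ n).sub ((measurable_scoreSum θ n).div_const g)).abs
  have h3 := h.contiguous hk (θ := θ) hS hν₀ (fun j => hA (N j))
    ((tendsto_testStat_sub hk hν₀ hest hroot hdisc μ hS hη0).comp h.tendsto)
  have h4 : ∀ᶠ j in atTop, sampleLaw (θ' j) (N j)
      {x | η < |testStat ν₀ muHat sHat (N j) x - scoreSum θ x / g|} < ENNReal.ofReal (ε / 6) :=
    h3.eventually_lt_const (by simpa using hε)
  filter_upwards [h4] with j hj
  have := isProbabilityMeasure_sampleLaw (h.posDef j) (h.tail_pos j) (N j)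
  have h5 := norm_integral_cexp_sub_le (P := sampleLaw (θ' j) (N j)) (hQ (N j))
    ((measurable_scoreSum θ (N j)).div_const g) s hη0.le
  have h6 : (sampleLaw (θ' j) (N j)).real
      {x | η < |testStat ν₀ muHat sHat (N j) x - scoreSum θ x / g|} < ε / 6 := by
    rw [measureReal_def]
    exact (ENNReal.lt_ofReal_iff_toReal_lt (measure_ne_top _ _)).mp hj
  have h7 : |s| * η ≤ ε / 3 := by
    rw [hη, mul_div_assoc', div_le_div_iff₀ (by positivity) (by norm_num)]
    nlinarith [abs_nonneg s]
  rw [Real.dist_eq, sub_zero, abs_of_nonneg dist_nonneg, dist_comm, Complex.dist_eq]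
  have h8 : ∀ x : Sample k (N j), s * (scoreSum θ x / g) = s / g * scoreSum θ x := fun x => by ring
  simp only [h8] at h5
  linarith

theorem IsLocalSeq.tendsto_testStat (hk : 1 ≤ k) {ν₀ : ℝ} (hν₀ : 0 < ν₀)
    (hest : IsEstimator muHat sHat)
    (hroot : RootNConsistent ν₀ muHat sHat) (hdisc : LocallyDiscrete muHat sHat)
    {μ : Fin k → ℝ} {S : Matrix (Fin k) (Fin k) ℝ} (hS : S.PosDef)
    (h : IsLocalSeq ⟨μ, S, ν₀⟩ M N θ') {t : ℝ}
    (ht : Tendsto (fun j => √(N j : ℝ) * ((θ' j).tail - ν₀)) atTop (𝓝 t))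
    {P : ℕ → ProbabilityMeasure ℝ}
    (hP : ∀ j, (P j : Measure ℝ) = (sampleLaw (θ' j) (N j)).map (testStat ν₀ muHat sHat (N j))) :
    Tendsto P atTop (𝓝 ⟨gaussianReal (t * √(effVar k ν₀)) 1, inferInstance⟩) := by
  refine ProbabilityMeasure.tendsto_of_tendsto_charFun fun s => ?_
  simp only [hP]
  exact h.tendsto_charFun_testStat hk hν₀ hest hroot hdisc hS ht s

lemma isSymm_of_posDef {S : Matrix (Fin k) (Fin k) ℝ} (hS : S.PosDef) : S.IsSymm := by
  have := hS.isHermitian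
  rwa [Matrix.IsHermitian, Matrix.conjTranspose_eq_transpose_of_trivial] at this

lemma isLocalSeq_const (hS : θ.scatter.PosDef) (hν : 0 < θ.tail) (hM : 0 ≤ M)
    (hN : Tendsto N atTop atTop) : IsLocalSeq θ M N fun _ => θ where
  tendsto := hN
  posDef _ := hS
  tail_pos _ := hν
  near := Eventually.of_forall fun j => by
    have h : 0 ≤ M / √(N j : ℝ) := by positivity
    exact ⟨h, fun i => by simpa using h, fun i j => by simpa using h, isSymm_of_posDef hS,
      by simpa using h⟩

theorem asympNormal_testStat (hk : 1 ≤ k) {ν₀ : ℝ} (hν₀ : 0 < ν₀)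
    (hest : IsEstimator muHat sHat) (hroot : RootNConsistent ν₀ muHat sHat)
    (hdisc : LocallyDiscrete muHat sHat) (μ : Fin k → ℝ) {S : Matrix (Fin k) (Fin k) ℝ}
    (hS : S.PosDef) {τ : ℕ → ℝ} {t : ℝ} (hpos : ∀ n : ℕ, 0 < ν₀ + (√(n : ℝ))⁻¹ * τ n)
    (ht : Tendsto τ atTop (𝓝 t)) :
    AsympNormal (testStat ν₀ muHat sHat) (fun n => sampleLaw ⟨μ, S, ν₀ + (√(n : ℝ))⁻¹ * τ n⟩ n)
      (t * √(effInfo ⟨μ, S, ν₀⟩)) := by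
  have hQ := measurable_testStat hk hν₀ hest
  have hprob : ∀ n : ℕ, IsProbabilityMeasure (sampleLaw ⟨μ, S, ν₀ + (√(n : ℝ))⁻¹ * τ n⟩ n) :=
    fun n => isProbabilityMeasure_sampleLaw hS (hpos n) n
  refine ⟨hprob, fun n => (hQ n).aemeasurable, measurable_id.aemeasurable, ?_⟩
  obtain ⟨B, hB⟩ : ∃ B, ∀ᶠ n in atTop, |τ n| ≤ B :=
    ⟨|t| + 1, (ht.abs.eventually_lt_const (lt_add_one _)).mono fun _ h => h.le⟩
  have hloc : IsLocalSeq ⟨μ, S, ν₀⟩ B id fun n => ⟨μ, S, ν₀ + (√(n : ℝ))⁻¹ * τ n⟩ := by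
    refine ⟨tendsto_id, fun _ => hS, hpos, ?_⟩
    filter_upwards [hB] with n hn
    have h0 : 0 ≤ B / √(id n : ℝ) := div_nonneg ((abs_nonneg _).trans hn) (Real.sqrt_nonneg _)
    refine ⟨h0, fun i => by simpa using h0, fun i j => by simpa using h0,
      isSymm_of_posDef hS, ?_⟩
    rw [add_sub_cancel_left, abs_mul, abs_inv, abs_of_nonneg (Real.sqrt_nonneg _), inv_mul_eq_div]
    exact div_le_div_of_nonneg_right hn (Real.sqrt_nonneg _)
  have ht' : Tendsto (fun n : ℕ => √(id n : ℝ) * (ν₀ + (√(n : ℝ))⁻¹ * τ n - ν₀)) atTop (𝓝 t) := by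
    refine ht.congr' ?_
    filter_upwards [eventually_ge_atTop 1] with n hn
    have : 0 < √(n : ℝ) := Real.sqrt_pos.mpr (by exact_mod_cast hn)
    rw [add_sub_cancel_left, id, mul_inv_cancel_left₀ this.ne']
  have h := hloc.tendsto_testStat hk hν₀ hest hroot hdisc hS ht' (P := fun n =>
    ⟨(sampleLaw ⟨μ, S, ν₀ + (√(n : ℝ))⁻¹ * τ n⟩ n).map (testStat ν₀ muHat sHat n),
      Measure.isProbabilityMeasure_map (hQ n).aemeasurable⟩) fun _ => rfl
  have he : (⟨(gaussianReal (t * √(effInfo ⟨μ, S, ν₀⟩)) 1).map id,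
      Measure.isProbabilityMeasure_map measurable_id.aemeasurable⟩ : ProbabilityMeasure ℝ)
      = ⟨gaussianReal (t * √(effVar k ν₀)) 1, inferInstance⟩ := by
    apply Subtype.ext
    simp only [Measure.map_id]
    rw [effInfo_eq hk hS hν₀]
  rw [he]
  exact h

end

/-! ### Normal quantiles and the power of the two-sided normal test -/

lemma continuous_cdf {μ : Measure ℝ} [IsProbabilityMeasure μ] (h : ∀ x, μ {x} = 0) :
    Continuous (cdf μ) := by
  rw [continuous_iff_continuousAt]
  intro x
  rw [(monotone_cdf μ).continuousAt_iff_leftLim_eq_rightLim, StieltjesFunction.rightLim_eq]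
  have h1 := (cdf μ).measure_singleton x
  rw [measure_cdf, h, eq_comm, ENNReal.ofReal_eq_zero, sub_nonpos] at h1
  exact le_antisymm ((monotone_cdf μ).leftLim_le le_rfl) h1

lemma gaussianReal_singleton (m x : ℝ) : gaussianReal m 1 {x} = 0 := by
  have := nullSingletonClass_gaussianReal (μ := m) (v := 1) one_ne_zero
  exact measure_singleton x

lemma gaussianReal_Ioi (t : ℝ) :
    gaussianReal 0 1 (Set.Ioi t) = ENNReal.ofReal (1 - cdf (gaussianReal 0 1) t) := by
  rw [← Set.compl_Iic, prob_compl_eq_one_sub measurableSet_Iic, ← ofReal_cdf,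
    ENNReal.ofReal_sub _ (cdf_nonneg _ _), ENNReal.ofReal_one]

lemma gaussianReal_Iio_neg (t : ℝ) :
    gaussianReal 0 1 (Set.Iio (-t)) = gaussianReal 0 1 (Set.Ioi t) := by
  have h : (gaussianReal 0 1).map (fun x => -x) = gaussianReal 0 1 := by
    rw [gaussianReal_map_neg, neg_zero]
  conv_rhs => rw [← h, Measure.map_apply measurable_neg measurableSet_Ioi]
  congr 1
  ext x
  simp only [Set.mem_Iio, Set.mem_preimage, Set.mem_Ioi]
  exact lt_neg

/-- The distribution function is continuous, so the level 1 - p is attained and the infimum belongs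
to the closed set defining it. -/
lemma gaussianReal_Ioi_upperQuantile {p : ℝ} (hp : p ∈ Set.Ioo (0 : ℝ) 1) :
    gaussianReal 0 1 (Set.Ioi (upperQuantile p)) = ENNReal.ofReal p := by
  set F := cdf (gaussianReal 0 1) with hF
  have hc : Continuous F := continuous_cdf (gaussianReal_singleton 0)
  have hS : {t : ℝ | gaussianReal 0 1 (Set.Ioi t) ≤ ENNReal.ofReal p} = {t | 1 - p ≤ F t} := by
    ext t
    change gaussianReal 0 1 (Set.Ioi t) ≤ ENNReal.ofReal p ↔ 1 - p ≤ F t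
    rw [gaussianReal_Ioi, ENNReal.ofReal_le_ofReal_iff hp.1.le]
    constructor <;> intro h <;> linarith
  obtain ⟨a, ha⟩ := ((tendsto_cdf_atBot (gaussianReal 0 1)).eventually_lt_const
    (show (0 : ℝ) < 1 - p by linarith [hp.2])).exists
  obtain ⟨b, hb⟩ := ((tendsto_cdf_atTop (gaussianReal 0 1)).eventually_const_lt
    (show 1 - p < 1 by linarith [hp.1])).exists
  obtain ⟨t₀, ht₀⟩ := mem_range_of_exists_le_of_exists_ge hc ⟨a, ha.le⟩ ⟨b, hb.le⟩
  have hbdd : BddBelow {t | 1 - p ≤ F t} := ⟨a, fun t ht => by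
    by_contra h
    have h1 : F t ≤ F a := monotone_cdf _ (not_le.mp h).le
    have h2 : 1 - p ≤ F t := ht
    linarith⟩
  have hmem : sInf {t | 1 - p ≤ F t} ∈ {t | 1 - p ≤ F t} :=
    (isClosed_le continuous_const hc).csInf_mem ⟨t₀, ht₀.ge⟩ hbdd
  have hle : sInf {t | 1 - p ≤ F t} ≤ t₀ := csInf_le hbdd ht₀.ge
  have h3 : F (sInf {t | 1 - p ≤ F t}) = 1 - p :=
    le_antisymm ((monotone_cdf _ hle).trans_eq ht₀) hmem
  rw [upperQuantile, hS, gaussianReal_Ioi, ← hF, h3, sub_sub_cancel]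

lemma upperQuantile_pos {p : ℝ} (hp : p ∈ Set.Ioo (0 : ℝ) (1 / 2)) : 0 < upperQuantile p := by
  by_contra h
  have h1 := gaussianReal_Ioi_upperQuantile (p := p) ⟨hp.1, by linarith [hp.2]⟩
  have h2 : gaussianReal 0 1 (Set.Ioi 0) ≤ ENNReal.ofReal p := by
    rw [← h1]
    exact measure_mono (Set.Ioi_subset_Ioi (not_lt.mp h))
  have h3 := gaussianReal_Iio_neg 0
  rw [neg_zero] at h3
  have h4 : (1 : ℝ≥0∞) ≤ gaussianReal 0 1 (Set.Iio 0) + gaussianReal 0 1 {0}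
      + gaussianReal 0 1 (Set.Ioi 0) := by
    rw [← measure_univ (μ := gaussianReal 0 1)]
    refine le_trans (measure_mono ?_) ((measure_union_le _ _).trans
      (add_le_add_left (measure_union_le _ _) _))
    intro x _
    rcases lt_trichotomy x 0 with h | h | h <;> simp [h]
  rw [h3, gaussianReal_singleton, add_zero] at h4
  have h5 : (1 : ℝ≥0∞) ≤ ENNReal.ofReal (p + p) := by
    rw [ENNReal.ofReal_add hp.1.le hp.1.le]
    exact h4.trans (add_le_add h2 h2)
  rw [← ENNReal.ofReal_one, ENNReal.ofReal_le_ofReal_iff (by linarith [hp.1])] at h5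
  linarith [hp.2]

/-- The probability that a normal variable with mean `m` and unit variance lies in `[-z, z]`. -/
def acceptProb (z m : ℝ) : ℝ := ∫ x in (m - z)..(m + z), gaussianPDFReal 0 1 x

lemma gaussianPDFReal_one (m x : ℝ) :
    gaussianPDFReal m 1 x = (√(2 * Real.pi))⁻¹ * Real.exp (-(x - m) ^ 2 / 2) := by
  simp [gaussianPDFReal_def]

lemma continuous_gaussianPDFReal_one (m : ℝ) : Continuous (gaussianPDFReal m 1) := by
  have : gaussianPDFReal m 1 = fun x => (√(2 * Real.pi))⁻¹ * Real.exp (-(x - m) ^ 2 / 2) :=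
    funext (gaussianPDFReal_one m)
  rw [this]
  fun_prop

lemma integral_gaussianPDFReal_eq_acceptProb (z m : ℝ) :
    ∫ x in (-z)..z, gaussianPDFReal m 1 x = acceptProb z m := by
  have h : ∀ x, gaussianPDFReal m 1 x = gaussianPDFReal 0 1 (m - x) := fun x => by
    rw [gaussianPDFReal_one, gaussianPDFReal_one]; congr 2; ring
  simp_rw [h]
  rw [intervalIntegral.integral_comp_sub_left, acceptProb, sub_neg_eq_add]

lemma acceptProb_neg (z m : ℝ) : acceptProb z (-m) = acceptProb z m := by
  rw [acceptProb, acceptProb]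
  have h : ∀ x, gaussianPDFReal 0 1 x = gaussianPDFReal 0 1 (-x) := fun x => by
    rw [gaussianPDFReal_one, gaussianPDFReal_one]; congr 2; ring
  rw [intervalIntegral.integral_congr fun x _ => h x,
    intervalIntegral.integral_comp_neg (gaussianPDFReal 0 1)]
  congr 1 <;> ring

lemma gaussianReal_Icc {z : ℝ} (hz : 0 ≤ z) (m : ℝ) :
    gaussianReal m 1 (Set.Icc (-z) z) = ENNReal.ofReal (acceptProb z m) := by
  rw [gaussianReal_apply_eq_integral m one_ne_zero, integral_Icc_eq_integral_Ioc,
    ← intervalIntegral.integral_of_le (by linarith), integral_gaussianPDFReal_eq_acceptProb]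

lemma acceptProb_nonneg {z : ℝ} (hz : 0 ≤ z) (m : ℝ) : 0 ≤ acceptProb z m :=
  intervalIntegral.integral_nonneg (by linarith) fun x _ => gaussianPDFReal_nonneg 0 1 x

lemma gaussianReal_abs_gt {z : ℝ} (hz : 0 ≤ z) (m : ℝ) :
    gaussianReal m 1 {y | z < |y|} = ENNReal.ofReal (1 - acceptProb z m) := by
  have h : {y : ℝ | z < |y|} = (Set.Icc (-z) z)ᶜ := by
    ext y
    change z < |y| ↔ ¬ (-z ≤ y ∧ y ≤ z)
    rw [← abs_le, not_le]
  rw [h, prob_compl_eq_one_sub measurableSet_Icc, gaussianReal_Icc hz,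
    ENNReal.ofReal_sub _ (acceptProb_nonneg hz m), ENNReal.ofReal_one]

lemma hasDerivAt_acceptProb (z m : ℝ) : HasDerivAt (acceptProb z)
    (gaussianPDFReal 0 1 (m + z) - gaussianPDFReal 0 1 (m - z)) m := by
  have hc := continuous_gaussianPDFReal_one 0
  have hI : ∀ y, HasDerivAt (fun u => ∫ x in (0 : ℝ)..u, gaussianPDFReal 0 1 x)
    (gaussianPDFReal 0 1 y) y := fun y => (hc.integral_hasStrictDerivAt 0 y).hasDerivAt
  have h1 := ((hI (m + z)).comp_add_const m z).sub ((hI (m - z)).comp_sub_const m z)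
  refine h1.congr_of_eventuallyEq (Eventually.of_forall fun u => ?_)
  exact (intervalIntegral.integral_interval_sub_left (hc.intervalIntegrable _ _)
    (hc.intervalIntegrable _ _)).symm

lemma continuous_acceptProb (z : ℝ) : Continuous (acceptProb z) :=
  continuous_iff_continuousAt.mpr fun m => (hasDerivAt_acceptProb z m).continuousAt

/-- The derivative is the difference of the normal density at m + z and m - z, and m + z is farther
from 0 when m ≥ 0. With the symmetry in m, the power of the two-sided normal test increases in |m|.
-/
lemma antitoneOn_acceptProb {z : ℝ} (hz : 0 ≤ z) : AntitoneOn (acceptProb z) (Set.Ici 0) := by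
  refine antitoneOn_of_deriv_nonpos (convex_Ici 0) (continuous_acceptProb z).continuousOn
    (fun m _ => (hasDerivAt_acceptProb z m).differentiableAt.differentiableWithinAt)
    fun m hm => ?_
  rw [interior_Ici, Set.mem_Ioi] at hm
  rw [(hasDerivAt_acceptProb z m).deriv, sub_nonpos, gaussianPDFReal_one, gaussianPDFReal_one]
  refine mul_le_mul_of_nonneg_left (Real.exp_le_exp.mpr ?_) (by positivity)
  have : 0 ≤ m * z := mul_nonneg hm.le hz
  nlinarith

lemma acceptProb_le_of_abs_le {z : ℝ} (hz : 0 ≤ z) {m m' : ℝ} (h : |m| ≤ |m'|) :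
    acceptProb z m' ≤ acceptProb z m := by
  have habs : ∀ m, acceptProb z m = acceptProb z |m| := fun m => by
    rcases abs_choice m with h | h <;> rw [h]
    rw [acceptProb_neg]
  rw [habs m, habs m']
  exact antitoneOn_acceptProb hz (abs_nonneg m) (abs_nonneg m') h

lemma acceptProb_upperQuantile {α : ℝ} (hα : α ∈ Set.Ioo (0 : ℝ) 1) :
    acceptProb (upperQuantile (α / 2)) 0 = 1 - α := by
  set z := upperQuantile (α / 2) with hz
  have hz0 : 0 < z := upperQuantile_pos ⟨by linarith [hα.1], by linarith [hα.2]⟩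
  have h1 : gaussianReal 0 1 (Set.Ioi z) = ENNReal.ofReal (α / 2) :=
    gaussianReal_Ioi_upperQuantile ⟨by linarith [hα.1], by linarith [hα.2]⟩
  have h2 : gaussianReal 0 1 {y | z < |y|} = ENNReal.ofReal α := by
    have h3 : {y : ℝ | z < |y|} = Set.Ioi z ∪ Set.Iio (-z) := by
      ext y
      change z < |y| ↔ z < y ∨ y < -z
      rw [lt_abs, lt_neg]
    have hd : Disjoint (Set.Ioi z) (Set.Iio (-z)) := by
      rw [Set.disjoint_left]
      intro y hy hy'
      have h4 : z < y := hy
      have h5 : y < -z := hy'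
      linarith
    rw [h3, measure_union hd measurableSet_Iio, gaussianReal_Iio_neg, h1,
      ← ENNReal.ofReal_add (by linarith [hα.1]) (by linarith [hα.1]), add_halves]
  have h6 : gaussianReal 0 1 (Set.Icc (-z) z) = ENNReal.ofReal (1 - α) := by
    have h7 : Set.Icc (-z) z = {y : ℝ | z < |y|}ᶜ := by
      ext y
      change (-z ≤ y ∧ y ≤ z) ↔ ¬ (z < |y|)
      rw [← abs_le, not_lt]
    have hm : MeasurableSet {y : ℝ | z < |y|} := measurableSet_lt measurable_const measurable_id.abs
    rw [h7, prob_compl_eq_one_sub hm, h2,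
      ENNReal.ofReal_sub _ hα.1.le, ENNReal.ofReal_one]
  rw [gaussianReal_Icc hz0.le] at h6
  exact (ENNReal.ofReal_eq_ofReal_iff (acceptProb_nonneg hz0.le 0) (by linarith [hα.2])).mp h6

section

/-! ### Asymptotic power of the two-sided test -/

variable {muHat : ∀ n, Sample k n → Fin k → ℝ} {sHat : ∀ n, Sample k n → Matrix (Fin k) (Fin k) ℝ}

lemma measurable_twoSidedTest (hk : 1 ≤ k) {ν₀ : ℝ} (hν₀ : 0 < ν₀) (hest : IsEstimator muHat sHat)
    (α : ℝ) (n : ℕ) : Measurable (twoSidedTest ν₀ α muHat sHat n) := by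
  classical
  have h : MeasurableSet {x : Sample k n | upperQuantile (α / 2) < |testStat ν₀ muHat sHat n x|} :=
    measurableSet_lt measurable_const (measurable_testStat hk hν₀ hest n).abs
  exact Measurable.ite h measurable_const measurable_const

lemma twoSidedTest_mem_Icc (ν₀ α : ℝ) (n : ℕ) (x : Sample k n) :
    twoSidedTest ν₀ α muHat sHat n x ∈ Set.Icc (0 : ℝ) 1 := by
  unfold twoSidedTest
  split_ifs <;> simp

lemma power_twoSidedTest (hk : 1 ≤ k) {ν₀ : ℝ} (hν₀ : 0 < ν₀) (hest : IsEstimator muHat sHat)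
    (α : ℝ) (n : ℕ) (P : Measure (Sample k n)) :
    power (twoSidedTest ν₀ α muHat sHat n) P
      = P.map (testStat ν₀ muHat sHat n) {y | upperQuantile (α / 2) < |y|} := by
  have hQ := measurable_testStat hk hν₀ hest n
  have hm : MeasurableSet {y : ℝ | upperQuantile (α / 2) < |y|} :=
    measurableSet_lt measurable_const measurable_id.abs
  rw [Measure.map_apply hQ hm, ← lintegral_indicator_one (hQ hm), power]
  congr 1
  funext x
  by_cases h : upperQuantile (α / 2) < |testStat ν₀ muHat sHat n x|
  · rw [Set.indicator_of_mem (show x ∈ testStat ν₀ muHat sHat n ⁻¹' {y | upperQuantile (α / 2) < |y|} from h), twoSidedTest,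
      if_pos h]
    simp
  · rw [Set.indicator_of_notMem (show x ∉ testStat ν₀ muHat sHat n ⁻¹' {y | upperQuantile (α / 2) < |y|} from h), twoSidedTest,
      if_neg h]
    simp

/-- The boundary of the rejection region consists of ±z, a null set for the limit, so convergence in
distribution passes to rejection probabilities. -/
theorem IsLocalSeq.tendsto_power (hk : 1 ≤ k) {ν₀ : ℝ} (hν₀ : 0 < ν₀)
    (hest : IsEstimator muHat sHat) (hroot : RootNConsistent ν₀ muHat sHat)
    (hdisc : LocallyDiscrete muHat sHat) {α : ℝ} (hα : α ∈ Set.Ioo (0 : ℝ) 1)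
    {μ : Fin k → ℝ} {S : Matrix (Fin k) (Fin k) ℝ} (hS : S.PosDef) {M : ℝ} {N : ℕ → ℕ}
    {θ' : ℕ → StudentParam k} (h : IsLocalSeq ⟨μ, S, ν₀⟩ M N θ') {t : ℝ}
    (ht : Tendsto (fun j => √(N j : ℝ) * ((θ' j).tail - ν₀)) atTop (𝓝 t)) :
    Tendsto (fun j => power (twoSidedTest ν₀ α muHat sHat (N j)) (sampleLaw (θ' j) (N j))) atTop
      (𝓝 (ENNReal.ofReal (1 - acceptProb (upperQuantile (α / 2)) (t * √(effVar k ν₀))))) := by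
  set z := upperQuantile (α / 2) with hz
  have hz0 : 0 < z := upperQuantile_pos ⟨by linarith [hα.1], by linarith [hα.2]⟩
  have hprob : ∀ j, IsProbabilityMeasure (sampleLaw (θ' j) (N j)) := fun j =>
    isProbabilityMeasure_sampleLaw (h.posDef j) (h.tail_pos j) (N j)
  have h1 := h.tendsto_testStat hk hν₀ hest hroot hdisc hS ht (P := fun j =>
    ⟨(sampleLaw (θ' j) (N j)).map (testStat ν₀ muHat sHat (N j)),
      Measure.isProbabilityMeasure_map (measurable_testStat hk hν₀ hest (N j)).aemeasurable⟩)
    fun _ => rfl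
  have hfr : gaussianReal (t * √(effVar k ν₀)) 1 (frontier {y : ℝ | z < |y|}) = 0 := by
    refine measure_mono_null (frontier_lt_subset_eq continuous_const continuous_abs)
      (measure_mono_null (t := {z} ∪ {-z}) (fun y hy => ?_)
        (measure_union_null (gaussianReal_singleton _ _) (gaussianReal_singleton _ _)))
    have hy' : z = |y| := hy
    exact (eq_or_eq_neg_of_abs_eq hy'.symm).imp id id
  have h2 := ProbabilityMeasure.tendsto_measure_of_null_frontier_of_tendsto' h1 hfr
  simp only [power_twoSidedTest hk hν₀ hest]
  rw [← gaussianReal_abs_gt hz0.le]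
  exact h2

theorem tendsto_power_null (hk : 1 ≤ k) {ν₀ : ℝ} (hν₀ : 0 < ν₀)
    (hest : IsEstimator muHat sHat) (hroot : RootNConsistent ν₀ muHat sHat)
    (hdisc : LocallyDiscrete muHat sHat) {α : ℝ} (hα : α ∈ Set.Ioo (0 : ℝ) 1)
    {θ : StudentParam k} (hθ : θ ∈ nullHyp k ν₀) :
    Tendsto (fun n => power (twoSidedTest ν₀ α muHat sHat n) (sampleLaw θ n)) atTop
      (𝓝 (ENNReal.ofReal α)) := by
  obtain ⟨μ, S, ν⟩ := θ
  obtain ⟨hS, rfl⟩ : S.PosDef ∧ ν = ν₀ := hθ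
  have h := (isLocalSeq_const (θ := ⟨μ, S, ν⟩) hS hν₀ le_rfl tendsto_id).tendsto_power hk hν₀ hest
    hroot hdisc hα hS (t := 0) (by simp)
  rw [zero_mul, acceptProb_upperQuantile hα, sub_sub_cancel] at h
  exact h

lemma abs_sqrt_mul (n : ℕ) (u : ℝ) : |√(n : ℝ) * u| = √(n : ℝ) * |u| := by
  rw [abs_mul, abs_of_nonneg (Real.sqrt_nonneg _)]

/-- If the bound failed, alternatives with too small power would exist along a subsequence. Their
rescaled tail displacements stay in [-M, M], so a further subsequence converges to some t with |t| ≥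
c, and the limiting power at t is at least that at c. The bound does not depend on M. -/
theorem le_liminf_power (hk : 1 ≤ k) {ν₀ : ℝ} (hν₀ : 0 < ν₀)
    (hest : IsEstimator muHat sHat) (hroot : RootNConsistent ν₀ muHat sHat)
    (hdisc : LocallyDiscrete muHat sHat) {α : ℝ} (hα : α ∈ Set.Ioo (0 : ℝ) 1)
    {θ : StudentParam k} (hθ : θ ∈ nullHyp k ν₀) {c : ℝ} (hc : 0 ≤ c) (M : ℝ) :
    ENNReal.ofReal (1 - acceptProb (upperQuantile (α / 2)) (c * √(effVar k ν₀)))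
      ≤ liminf (fun n => ⨅ θ' ∈ localAlt θ c M n,
          power (twoSidedTest ν₀ α muHat sHat n) (sampleLaw θ' n)) atTop := by
  obtain ⟨μ, S, ν⟩ := θ
  obtain ⟨hS, rfl⟩ : S.PosDef ∧ ν = ν₀ := hθ
  set z := upperQuantile (α / 2) with hz
  have hz0 : 0 < z := upperQuantile_pos ⟨by linarith [hα.1], by linarith [hα.2]⟩
  set g := √(effVar k ν) with hg
  by_contra hlt
  rw [not_le] at hlt
  obtain ⟨b, hb1, hb2⟩ := exists_between hlt
  have hfreq := frequently_lt_of_liminf_lt (by isBoundedDefault) hb1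
  obtain ⟨φ, hφ, hφlt⟩ := extraction_of_frequently_atTop hfreq
  have hex : ∀ j, ∃ θ' ∈ localAlt (⟨μ, S, ν⟩ : StudentParam k) c M (φ j),
      power (twoSidedTest ν α muHat sHat (φ j)) (sampleLaw θ' (φ j)) < b := by
    intro j
    have h := hφlt j
    simp only [iInf_lt_iff, exists_prop] at h
    exact h
  choose θ' hmem hpow using hex
  have hbd : ∀ j, √(φ j : ℝ) * ((θ' j).tail - ν) ∈ Set.Icc (-M) M := fun j => by
    rw [Set.mem_Icc, ← abs_le, abs_sqrt_mul]
    exact (hmem j).2.2.2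
  obtain ⟨t, -, ψ, hψ, ht⟩ := isCompact_Icc.tendsto_subseq hbd
  have hM : 0 ≤ M := by
    have h1 := (hbd 0).1.trans (hbd 0).2
    linarith
  have hN : Tendsto (φ ∘ ψ) atTop atTop := hφ.tendsto_atTop.comp hψ.tendsto_atTop
  have hloc : IsLocalSeq ⟨μ, S, ν⟩ M (φ ∘ ψ) (θ' ∘ ψ) := by
    refine ⟨hN, fun j => (hmem (ψ j)).1.1, fun j => (hmem (ψ j)).1.2.1, ?_⟩
    filter_upwards [hN.eventually_ge_atTop 1] with j hj
    have h1 := hmem (ψ j)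
    exact h1.2.1.isNear hj hM (isSymm_of_posDef h1.1.1) h1.2.2.2
  have h2 := hloc.tendsto_power hk hν₀ hest hroot hdisc hα hS ht
  have hct : c ≤ |t| := by
    refine ge_of_tendsto ht.abs (Eventually.of_forall fun j => ?_)
    rw [Function.comp_apply, abs_sqrt_mul]
    exact (hmem (ψ j)).2.2.1
  have h3 : ENNReal.ofReal (1 - acceptProb z (t * g)) ≤ b :=
    le_of_tendsto h2 (Eventually.of_forall fun j => (hpow (ψ j)).le)
  have h4 : acceptProb z (t * g) ≤ acceptProb z (c * g) := by
    refine acceptProb_le_of_abs_le hz0.le ?_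
    rw [abs_mul, abs_mul, abs_of_nonneg hc]
    gcongr
  have h5 : ENNReal.ofReal (1 - acceptProb z (c * g)) ≤ ENNReal.ofReal (1 - acceptProb z (t * g)) :=
    ENNReal.ofReal_le_ofReal (by linarith)
  exact absurd (h5.trans h3) (not_le.mpr hb2)

end

/-! ### Log-likelihood ratios along the least favorable path -/

lemma integrable_effScoreAt {θ : StudentParam k} (hS : θ.scatter.PosDef) (hν : 0 < θ.tail) :
    Integrable (effScoreAt θ) (law θ) := by
  obtain ⟨μ, S, ν⟩ := θ
  obtain ⟨A, hA, hAS⟩ := exists_mul_transpose_eq hS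
  have := isProbabilityMeasure_stdLaw k hν
  have hmap : Measurable fun y : Fin k → ℝ => μ + A *ᵥ y := by fun_prop
  rw [law_eq_map hA hAS μ ν, integrable_map_measure (measurable_effScoreAt _).aestronglyMeasurable
    hmap.aemeasurable]
  have h : effScoreAt ⟨μ, S, ν⟩ ∘ (fun y : Fin k → ℝ => μ + A *ᵥ y)
      = fun y => effScore k ν (y ⬝ᵥ y) := funext fun y => effScoreAt_std hA hAS μ ν y
  rw [h]
  exact (memLp_effScore k hν).integrable one_le_two

/-- Local asymptotic normality along the least favorable path, in L² under the null: the
log-likelihood ratio is quadratic in c with the efficient central sequence as linear coefficient. -/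
lemma exists_log_likelihoodRatio_bound {θ : StudentParam k} (hS : θ.scatter.PosDef)
    (hν : 0 < θ.tail) (c : ℝ) : ∃ K : ℝ, ∀ᶠ n : ℕ in atTop,
      (leastFavorable θ (c / √(n : ℝ))).scatter.PosDef ∧
      0 < (leastFavorable θ (c / √(n : ℝ))).tail ∧
      Integrable (fun x : Sample k n => (Real.log (likelihoodRatio θ (leastFavorable θ (c / √(n : ℝ))) x)
        - (c * scoreSum θ x - c ^ 2 * effVar k θ.tail / 2)) ^ 2) (sampleLaw θ n) ∧
      ∫ x : Sample k n, (Real.log (likelihoodRatio θ (leastFavorable θ (c / √(n : ℝ))) x)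
        - (c * scoreSum θ x - c ^ 2 * effVar k θ.tail / 2)) ^ 2 ∂(sampleLaw θ n) ≤ K / n := by
  have := isProbabilityMeasure_law hS hν
  obtain ⟨C, δ, hC, hδ, h⟩ := exists_leastFavorable_expansion hS hν
  set G := effVar k θ.tail with hG
  have hG0 : 0 ≤ G := integral_nonneg fun y => sq_nonneg _
  refine ⟨(C + G / 2) ^ 2 * c ^ 4 + C ^ 2 * c ^ 6, ?_⟩
  filter_upwards [(tendsto_inv_sqrt tendsto_id |c|).eventually_le_const hδ,
    eventually_ge_atTop 1] with n hn hn1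
  have hn0 : (0 : ℝ) < n := by exact_mod_cast hn1
  set r := √(n : ℝ) with hr
  have hr0 : 0 < r := Real.sqrt_pos.mpr hn0
  have hrr : (n : ℝ) = r ^ 2 := (Real.sq_sqrt hn0.le).symm
  set a := c / r with ha
  obtain ⟨hPD, htail, hb, hi⟩ := h a (by rw [ha, abs_div, abs_of_pos hr0]; exact hn)
  set ℓ : (Fin k → ℝ) → ℝ := fun y => Real.log (density (leastFavorable θ a) y / density θ y) with hℓ
  -- The remainder of one observation: O(a²) pointwise and O(|a|³) in mean. The sum then has second
  -- moment of order n a⁴ + n² a⁶, which is O(1/n) for a = c/√n.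
  set f : (Fin k → ℝ) → ℝ := fun y => ℓ y - a * effScoreAt θ y + a ^ 2 * G / 2 with hf
  have hℓm : Measurable ℓ := ((measurable_density _).div (measurable_density _)).log
  have hfm : Measurable f := (hℓm.sub ((measurable_effScoreAt θ).const_mul a)).add_const _
  have hfb : ∀ y, |f y| ≤ (C + G / 2) * a ^ 2 := by
    intro y
    have h1 := hb y
    rw [sq_abs] at h1
    refine (abs_add_le _ _).trans ?_
    rw [abs_of_nonneg (show 0 ≤ a ^ 2 * G / 2 by positivity)]
    linarith
  have hL : MemLp f 2 (law θ) := MemLp.of_bound hfm.aestronglyMeasurable _ (ae_of_all _ hfb)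
  have hfi : Integrable f (law θ) := hL.integrable one_le_two
  have hei := (integrable_effScoreAt hS hν).const_mul a
  have hℓi : Integrable ℓ (law θ) := by
    refine ((hfi.add hei).sub (integrable_const (a ^ 2 * G / 2))).congr (ae_of_all _ fun y => ?_)
    simp only [hf, Pi.add_apply, Pi.sub_apply]
    ring
  have hfint : ∫ y, f y ∂(law θ) = ∫ y, ℓ y ∂(law θ) + a ^ 2 * G / 2 := by
    have i1 : Integrable (fun y => ℓ y - a * effScoreAt θ y) (law θ) := hℓi.sub hei
    simp only [hf]
    rw [integral_add i1 (integrable_const _), integral_sub hℓi hei, integral_const_mul,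
      integral_effScoreAt hS hν]
    simp
  rw [← hfint] at hi
  obtain ⟨h1, h2⟩ := integral_sum_sq_le hL n
  have hX : ∀ x : Sample k n, Real.log (likelihoodRatio θ (leastFavorable θ a) x)
      - (c * scoreSum θ x - c ^ 2 * G / 2) = ∑ i, f (x i) := by
    intro x
    rw [likelihoodRatio, Real.log_prod fun i _ =>
      (div_pos (density_pos hPD htail _) (density_pos hS hν _)).ne']
    have e1 : ∑ i, f (x i) = ∑ i, ℓ (x i) - a * ∑ i, effScoreAt θ (x i) + n * (a ^ 2 * G / 2) := by
      simp only [hf, Finset.sum_add_distrib, Finset.sum_sub_distrib, ← Finset.mul_sum,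
        Finset.sum_const, Finset.card_univ, Fintype.card_fin, nsmul_eq_mul]
    have e2 : n * (a ^ 2 * G / 2) = c ^ 2 * G / 2 := by
      rw [hrr, ha]; field_simp
    have e3 : c * scoreSum θ x = a * ∑ i, effScoreAt θ (x i) := by
      rw [scoreSum, ← hr, ha]; ring
    rw [e1, e2, e3]
    ring
  simp_rw [hX]
  refine ⟨hPD, htail, h1, ?_⟩
  have h4 : ∫ y, f y ^ 2 ∂(law θ) ≤ ((C + G / 2) * a ^ 2) ^ 2 := by
    refine (integral_mono hL.integrable_sq
      (integrable_const (((C + G / 2) * a ^ 2) ^ 2)) fun y => ?_).trans_eq (by simp)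
    rw [← sq_abs]
    exact pow_le_pow_left₀ (abs_nonneg _) (hfb y) 2
  have h5 : (n * ∫ y, f y ∂(law θ)) ^ 2 ≤ (n * (C * |a| ^ 3)) ^ 2 := by
    rw [← sq_abs, abs_mul, abs_of_pos hn0]
    gcongr
  have h6 : (n * (C * |a| ^ 3)) ^ 2 = n ^ 2 * C ^ 2 * a ^ 6 := by
    rw [← Even.pow_abs (⟨3, rfl⟩ : Even 6) a]; ring
  calc ∫ x : Sample k n, (∑ i, f (x i)) ^ 2 ∂(sampleLaw θ n)
      ≤ n * ((C + G / 2) * a ^ 2) ^ 2 + n ^ 2 * C ^ 2 * a ^ 6 := by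
        rw [← h6]
        refine h2.trans ?_
        gcongr
    _ = ((C + G / 2) ^ 2 * c ^ 4 + C ^ 2 * c ^ 6) / n := by
        rw [hrr, ha]
        field_simp

/-! ### A bound on the power of arbitrary tests -/

/-- The function is κ-Lipschitz because its slope eˣ/2 is at most κ wherever the truncation is
inactive. -/
lemma abs_min_exp_sub_le {κ : ℝ} (hκ : 0 ≤ κ) (a b : ℝ) :
    |min (Real.exp a / 2) κ - min (Real.exp b / 2) κ| ≤ κ * |a - b| := by
  wlog h : b ≤ a generalizing a b
  · rw [abs_sub_comm, abs_sub_comm a b]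
    exact this b a (not_le.mp h).le
  have hm : min (Real.exp b / 2) κ ≤ min (Real.exp a / 2) κ :=
    min_le_min_right _ (by linarith [Real.exp_le_exp.mpr h])
  rw [abs_of_nonneg (sub_nonneg.mpr hm), abs_of_nonneg (sub_nonneg.mpr h)]
  have he1 : Real.exp (b - a) ≤ 1 := Real.exp_le_one_iff.mpr (by linarith)
  have h1 : min (Real.exp a / 2) κ * Real.exp (b - a) ≤ min (Real.exp b / 2) κ := by
    refine le_min ?_ ?_
    · calc min (Real.exp a / 2) κ * Real.exp (b - a) ≤ Real.exp a / 2 * Real.exp (b - a) := by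
            gcongr; exact min_le_left _ _
        _ = Real.exp b / 2 := by
            rw [div_mul_eq_mul_div, ← Real.exp_add, add_sub_cancel]
    · calc min (Real.exp a / 2) κ * Real.exp (b - a) ≤ κ * 1 := by
            gcongr; exact min_le_right _ _
        _ = κ := mul_one κ
  have h2 : 1 - Real.exp (b - a) ≤ a - b := by linarith [Real.add_one_le_exp (b - a)]
  have h3 : 0 ≤ min (Real.exp a / 2) κ := le_min (by positivity) hκ
  calc min (Real.exp a / 2) κ - min (Real.exp b / 2) κ
      ≤ min (Real.exp a / 2) κ * (1 - Real.exp (b - a)) := by linarith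
    _ ≤ κ * (1 - Real.exp (b - a)) :=
        mul_le_mul_of_nonneg_right (min_le_right _ _) (by linarith)
    _ ≤ κ * (a - b) := by gcongr

/-- The positive part of `κ` minus the average of two likelihood ratios, in terms of their
logarithms. -/
def deficit (κ a b : ℝ) : ℝ := max (κ - (Real.exp a + Real.exp b) / 2) 0

/-- Once one half-ratio exceeds κ the positive part is zero with or without truncation. The
truncated form is Lipschitz in the log ratios, so an approximation of the logarithms in L¹ is enough
and no uniform integrability of the ratios is needed. -/
lemma deficit_eq {κ : ℝ} (hκ : 0 ≤ κ) (a b : ℝ) :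
    deficit κ a b = max (κ - min (Real.exp a / 2) κ - min (Real.exp b / 2) κ) 0 := by
  have ha := Real.exp_pos a
  have hb := Real.exp_pos b
  rw [deficit]
  rcases le_total (Real.exp a / 2) κ with h1 | h1 <;> rcases le_total (Real.exp b / 2) κ with h2 | h2
  · rw [min_eq_left h1, min_eq_left h2]; congr 1; ring
  · rw [min_eq_left h1, min_eq_right h2, max_eq_right (by linarith), max_eq_right (by linarith)]
  · rw [min_eq_right h1, min_eq_left h2, max_eq_right (by linarith), max_eq_right (by linarith)]
  · rw [min_eq_right h1, min_eq_right h2, max_eq_right (by linarith), max_eq_right (by linarith)]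

lemma abs_deficit_sub_le {κ : ℝ} (hκ : 0 ≤ κ) (a b a' b' : ℝ) :
    |deficit κ a b - deficit κ a' b'| ≤ κ * |a - a'| + κ * |b - b'| := by
  rw [deficit_eq hκ, deficit_eq hκ]
  refine (abs_max_sub_max_le_abs _ _ _).trans ?_
  have h1 := abs_min_exp_sub_le hκ a a'
  have h2 := abs_min_exp_sub_le hκ b b'
  have h3 : κ - min (Real.exp a / 2) κ - min (Real.exp b / 2) κ
      - (κ - min (Real.exp a' / 2) κ - min (Real.exp b' / 2) κ)
      = -(min (Real.exp a / 2) κ - min (Real.exp a' / 2) κ)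
        + -(min (Real.exp b / 2) κ - min (Real.exp b' / 2) κ) := by ring
  rw [h3]
  refine (abs_add_le _ _).trans ?_
  rw [abs_neg, abs_neg]
  exact add_le_add h1 h2

lemma deficit_nonneg (κ a b : ℝ) : 0 ≤ deficit κ a b := le_max_right _ _

lemma deficit_le {κ : ℝ} (hκ : 0 ≤ κ) (a b : ℝ) : deficit κ a b ≤ κ :=
  max_le (by linarith [Real.exp_pos a, Real.exp_pos b]) hκ

lemma continuous_deficit (κ : ℝ) : Continuous fun p : ℝ × ℝ => deficit κ p.1 p.2 := by
  unfold deficit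
  fun_prop

/-- Weak duality for the Neyman–Pearson problem with multiplier κ: with L the average of the two
ratios, Lψ ≤ κψ + L - κ + (κ - L)⁺ for every test ψ. -/
lemma integral_mul_add_integral_mul_le {Ω : Type*} [MeasurableSpace Ω] {P : Measure Ω}
    [IsProbabilityMeasure P] {L₁ L₂ ψ : Ω → ℝ} (hL₁ : Integrable L₁ P) (hL₂ : Integrable L₂ P)
    (h₁ : ∫ ω, L₁ ω ∂P = 1) (h₂ : ∫ ω, L₂ ω ∂P = 1) (hψ : Measurable ψ)
    (hψ01 : ∀ ω, ψ ω ∈ Set.Icc (0 : ℝ) 1) (κ : ℝ) :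
    ∫ ω, L₁ ω * ψ ω ∂P + ∫ ω, L₂ ω * ψ ω ∂P
      ≤ 2 * (κ * ∫ ω, ψ ω ∂P + 1 - κ + ∫ ω, max (κ - (L₁ ω + L₂ ω) / 2) 0 ∂P) := by
  have hψb : ∀ ω, ‖ψ ω‖ ≤ 1 := fun ω => by
    rw [Real.norm_eq_abs, abs_of_nonneg (hψ01 ω).1]; exact (hψ01 ω).2
  have hψi : Integrable ψ P := Integrable.of_bound hψ.aestronglyMeasurable 1 (ae_of_all _ hψb)
  have i1 : Integrable (fun ω => L₁ ω * ψ ω) P :=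
    hL₁.mul_bdd (c := 1) hψ.aestronglyMeasurable (ae_of_all _ hψb)
  have i2 : Integrable (fun ω => L₂ ω * ψ ω) P :=
    hL₂.mul_bdd (c := 1) hψ.aestronglyMeasurable (ae_of_all _ hψb)
  have i3 : Integrable (fun ω => (L₁ ω + L₂ ω) / 2) P := (hL₁.add hL₂).div_const 2
  have i4 : Integrable (fun ω => max (κ - (L₁ ω + L₂ ω) / 2) 0) P :=
    ((integrable_const κ).sub i3).pos_part
  have i5 : Integrable (fun ω => κ * ψ ω) P := hψi.const_mul κ
  have i6 : Integrable (fun ω => κ * ψ ω + (L₁ ω + L₂ ω) / 2) P := i5.add i3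
  have i7 : Integrable (fun ω => κ * ψ ω + (L₁ ω + L₂ ω) / 2 - κ) P := i6.sub (integrable_const κ)
  have i8 : Integrable (fun ω => κ * ψ ω + (L₁ ω + L₂ ω) / 2 - κ
      + max (κ - (L₁ ω + L₂ ω) / 2) 0) P := i7.add i4
  have hpt : ∀ ω, L₁ ω * ψ ω + L₂ ω * ψ ω ≤ 2 * (κ * ψ ω + (L₁ ω + L₂ ω) / 2 - κ
      + max (κ - (L₁ ω + L₂ ω) / 2) 0) := by
    intro ω
    obtain ⟨h0, h1⟩ := hψ01 ω
    set u := κ - (L₁ ω + L₂ ω) / 2 with hu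
    have hsum : L₁ ω + L₂ ω = 2 * (κ - u) := by rw [hu]; ring
    -- The duality inequality itself; it uses only that 1 - ψ lies in [0, 1].
    have h3 : u * (1 - ψ ω) ≤ max u 0 := by
      rcases le_total u 0 with h | h
      · rw [max_eq_right h]; exact mul_nonpos_of_nonpos_of_nonneg h (by linarith)
      · rw [max_eq_left h]; exact mul_le_of_le_one_right h (by linarith)
    rw [← add_mul, hsum]
    linarith [h3, mul_sub u 1 (ψ ω), sub_mul κ u (ψ ω), mul_assoc 2 (κ - u) (ψ ω)]
  rw [← integral_add i1 i2]
  refine (integral_mono (i1.add i2) (i8.const_mul 2) hpt).trans (le_of_eq ?_)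
  rw [integral_const_mul, integral_add i7 i4, integral_sub i6 (integrable_const κ),
    integral_add i5 i3, integral_const_mul, integral_div, integral_add hL₁ hL₂, h₁, h₂]
  simp

section

/-! ### Local asymptotic maximinity -/

section

variable {θ θ' : StudentParam k}

lemma integrable_likelihoodRatio (hS : θ.scatter.PosDef) (hν : 0 < θ.tail)
    (hS' : θ'.scatter.PosDef) (hν' : 0 < θ'.tail) (n : ℕ) :
    Integrable (likelihoodRatio θ θ' : Sample k n → ℝ) (sampleLaw θ n) ∧
      ∫ x : Sample k n, likelihoodRatio θ θ' x ∂(sampleLaw θ n) = 1 := by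
  have hp := isProbabilityMeasure_sampleLaw hS' hν' n
  have h0 : 0 ≤ᵐ[sampleLaw θ n] (likelihoodRatio θ θ' : Sample k n → ℝ) :=
    ae_of_all _ fun x => (likelihoodRatio_pos hS hν hS' hν' x).le
  have h1 : ∫⁻ x : Sample k n, ENNReal.ofReal (likelihoodRatio θ θ' x) ∂(sampleLaw θ n) = 1 := by
    have h2 := measure_univ (μ := sampleLaw θ' n)
    rwa [sampleLaw_eq_withDensity hS hν hS' hν' n, withDensity_apply _ MeasurableSet.univ,
      Measure.restrict_univ] at h2
  have hm := (measurable_likelihoodRatio θ θ' n).aestronglyMeasurable (μ := sampleLaw θ n)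
  refine ⟨⟨hm, ?_⟩, ?_⟩
  · rw [hasFiniteIntegral_iff_ofReal h0, h1]
    exact ENNReal.one_lt_top
  · rw [integral_eq_lintegral_of_nonneg_ae h0 hm, h1, ENNReal.toReal_one]

lemma power_eq_integral (hS : θ.scatter.PosDef) (hν : 0 < θ.tail)
    (hS' : θ'.scatter.PosDef) (hν' : 0 < θ'.tail) {n : ℕ} {ψ : Sample k n → ℝ} (hψ : Measurable ψ)
    (hψ01 : ∀ x, ψ x ∈ Set.Icc (0 : ℝ) 1) : power ψ (sampleLaw θ' n)
      = ENNReal.ofReal (∫ x, likelihoodRatio θ θ' x * ψ x ∂(sampleLaw θ n)) := by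
  have hL0 := fun x : Sample k n => (likelihoodRatio_pos hS hν hS' hν' x).le
  have hi : Integrable (fun x => likelihoodRatio θ θ' x * ψ x) (sampleLaw θ n) :=
    (integrable_likelihoodRatio hS hν hS' hν' n).1.mul_bdd (c := 1) hψ.aestronglyMeasurable
      (ae_of_all _ fun x => by
        rw [Real.norm_eq_abs, abs_of_nonneg (hψ01 x).1]; exact (hψ01 x).2)
  rw [ofReal_integral_eq_lintegral_ofReal hi
    (ae_of_all _ fun x => mul_nonneg (hL0 x) (hψ01 x).1), power,
    sampleLaw_eq_withDensity hS hν hS' hν' n,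
    lintegral_withDensity_eq_lintegral_mul _ (measurable_likelihoodRatio θ θ' n).ennreal_ofReal
      hψ.ennreal_ofReal]
  refine lintegral_congr fun x => ?_
  rw [Pi.mul_apply, ENNReal.ofReal_mul (hL0 x)]

lemma power_toReal (hS : θ.scatter.PosDef) (hν : 0 < θ.tail) {n : ℕ} {ψ : Sample k n → ℝ}
    (hψ : Measurable ψ) (hψ01 : ∀ x, ψ x ∈ Set.Icc (0 : ℝ) 1) :
    power ψ (sampleLaw θ n) = ENNReal.ofReal (∫ x, ψ x ∂(sampleLaw θ n)) := by
  have := isProbabilityMeasure_sampleLaw hS hν n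
  have hi : Integrable ψ (sampleLaw θ n) := Integrable.of_bound hψ.aestronglyMeasurable 1
    (ae_of_all _ fun x => by rw [Real.norm_eq_abs, abs_of_nonneg (hψ01 x).1]; exact (hψ01 x).2)
  rw [power, ofReal_integral_eq_lintegral_ofReal hi (ae_of_all _ fun x => (hψ01 x).1)]

lemma tendsto_integral_scoreSum (hk : 1 ≤ k) (hS : θ.scatter.PosDef) (hν : 0 < θ.tail)
    {F : ℝ → ℝ} (hF : Continuous F) {B : ℝ} (hB : ∀ x, |F x| ≤ B) :
    Tendsto (fun n => ∫ x : Sample k n, F (scoreSum θ x / √(effVar k θ.tail)) ∂(sampleLaw θ n))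
      atTop (𝓝 (∫ w, F w ∂(gaussianReal 0 1))) := by
  have hG : 0 < effVar k θ.tail := effVar_pos hk hν
  set g := √(effVar k θ.tail) with hg
  have hg0 : 0 < g := Real.sqrt_pos.mpr hG
  have hgg : effVar k θ.tail = g ^ 2 := (Real.sq_sqrt hG.le).symm
  have hm : ∀ n, Measurable fun x : Sample k n => scoreSum θ x / g := fun n =>
    (measurable_scoreSum θ n).div_const g
  have hprob : ∀ n, IsProbabilityMeasure (sampleLaw θ n) := isProbabilityMeasure_sampleLaw hS hν
  have hw : Tendsto (β := ProbabilityMeasure ℝ) (fun n =>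
      ⟨(sampleLaw θ n).map fun x => scoreSum θ x / g,
        Measure.isProbabilityMeasure_map (hm n).aemeasurable⟩) atTop
      (𝓝 ⟨gaussianReal 0 1, inferInstance⟩) := by
    refine ProbabilityMeasure.tendsto_of_tendsto_charFun fun s => ?_
    have h1 := (isLocalSeq_const (θ := θ) hS hν le_rfl tendsto_id).tendsto_charFun_scoreSum hk hS hν
      (t := 0) (by simp) (s / g)
    simp only [ProbabilityMeasure.coe_mk, charFun_map_real (hm _), charFun_gaussianReal]
    have h2 : ∀ (n : ℕ) (x : Sample k n), s * (scoreSum θ x / g) = s / g * scoreSum θ x :=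
      fun n x => by ring
    simp only [h2]
    have hgc : (g : ℂ) ≠ 0 := by exact_mod_cast hg0.ne'
    have h3 : Complex.exp (((s / g * 0 * effVar k θ.tail : ℝ) : ℂ) * Complex.I
          - (((s / g) ^ 2 * effVar k θ.tail / 2 : ℝ) : ℂ))
        = Complex.exp ((s : ℂ) * ((0 : ℝ) : ℂ) * Complex.I
          - ((1 : NNReal) : ℂ) * (s : ℂ) ^ 2 / 2) := by
      rw [hgg]
      congr 1
      push_cast
      field_simp
      simp
    rw [h3] at h1
    exact h1
  have h3 := ProbabilityMeasure.tendsto_iff_forall_integral_tendsto.mp hw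
    (BoundedContinuousFunction.ofNormedAddCommGroup F hF B hB)
  simp only [ProbabilityMeasure.coe_mk, BoundedContinuousFunction.coe_ofNormedAddCommGroup] at h3
  refine h3.congr fun n => ?_
  rw [integral_map (hm n).aemeasurable hF.aestronglyMeasurable]

end

/-- With r = √n this converts the second-moment bound K/n into the first-moment bound (K + 1)/√n. -/
lemma abs_le_mul_sq_add {r : ℝ} (hr : 0 < r) (x : ℝ) : |x| ≤ r * x ^ 2 + 1 / r := by
  rw [← sq_abs x]
  have h1 := sq_nonneg (r * |x| - 1)
  have h2 : r * |x| ^ 2 + 1 / r - |x| = ((r * |x| - 1) ^ 2 + r * |x|) / r := by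
    field_simp; ring
  have h3 : 0 ≤ ((r * |x| - 1) ^ 2 + r * |x|) / r := by positivity
  linarith

/-- The deficit of the two-point mixture against `κ` in the limiting normal experiment. -/
def limitDeficit (κ m w : ℝ) : ℝ := deficit κ (m * w - m ^ 2 / 2) (-m * w - m ^ 2 / 2)

lemma abs_limitDeficit_le {κ : ℝ} (hκ : 0 ≤ κ) (m w : ℝ) : |limitDeficit κ m w| ≤ κ := by
  rw [limitDeficit, abs_of_nonneg (deficit_nonneg _ _ _)]
  exact deficit_le hκ _ _

lemma continuous_limitDeficit (κ m : ℝ) : Continuous (limitDeficit κ m) :=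
  (continuous_deficit κ).comp (by fun_prop : Continuous fun w : ℝ =>
    ((m * w - m ^ 2 / 2, -m * w - m ^ 2 / 2) : ℝ × ℝ))

/-- Both log ratios are replaced by their quadratic expansions in the same score sum, at a cost
O(n^{-1/2}) by the Lipschitz property. What remains is a bounded continuous function of an
asymptotically normal statistic. -/
theorem tendsto_integral_deficit (hk : 1 ≤ k) {θ : StudentParam k} (hS : θ.scatter.PosDef)
    (hν : 0 < θ.tail) (c : ℝ) {κ : ℝ} (hκ : 0 ≤ κ) :
    Tendsto (fun n : ℕ => ∫ x : Sample k n, max (κ - (likelihoodRatio θ (leastFavorable θ (c / √(n : ℝ))) x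
        + likelihoodRatio θ (leastFavorable θ (-c / √(n : ℝ))) x) / 2) 0 ∂(sampleLaw θ n)) atTop
      (𝓝 (∫ w, limitDeficit κ (c * √(effVar k θ.tail)) w ∂(gaussianReal 0 1))) := by
  have hG : 0 < effVar k θ.tail := effVar_pos hk hν
  set g := √(effVar k θ.tail) with hg
  have hg0 : 0 < g := Real.sqrt_pos.mpr hG
  have hgg : effVar k θ.tail = g ^ 2 := (Real.sq_sqrt hG.le).symm
  have h1 := tendsto_integral_scoreSum hk hS hν (continuous_limitDeficit κ (c * g)) (B := κ)
    (abs_limitDeficit_le hκ _)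
  rw [← hg] at h1
  refine h1.congr_dist ?_
  obtain ⟨K₁, hK₁⟩ := exists_log_likelihoodRatio_bound hS hν c
  obtain ⟨K₂, hK₂⟩ := exists_log_likelihoodRatio_bound hS hν (-c)
  refine squeeze_zero' (Eventually.of_forall fun _ => dist_nonneg) ?_
    (tendsto_inv_sqrt tendsto_id (κ * (K₁ + 1) + κ * (K₂ + 1)))
  filter_upwards [hK₁, hK₂, eventually_ge_atTop 1] with n hn₁ hn₂ hn
  have := isProbabilityMeasure_sampleLaw hS hν n
  obtain ⟨hp₁, ht₁, hi₁, hb₁⟩ := hn₁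
  obtain ⟨hp₂, ht₂, hi₂, hb₂⟩ := hn₂
  have hn0 : (0 : ℝ) < n := by exact_mod_cast hn
  set r := √(n : ℝ) with hr
  have hr0 : 0 < r := Real.sqrt_pos.mpr hn0
  have hrr : (n : ℝ) = r ^ 2 := (Real.sq_sqrt hn0.le).symm
  set L₁ : Sample k n → ℝ := likelihoodRatio θ (leastFavorable θ (c / r)) with hL₁
  set L₂ : Sample k n → ℝ := likelihoodRatio θ (leastFavorable θ (-c / r)) with hL₂
  set X₁ : Sample k n → ℝ := fun x =>
    Real.log (L₁ x) - (c * scoreSum θ x - c ^ 2 * effVar k θ.tail / 2) with hX₁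
  set X₂ : Sample k n → ℝ := fun x =>
    Real.log (L₂ x) - (-c * scoreSum θ x - (-c) ^ 2 * effVar k θ.tail / 2) with hX₂
  have hm₁ := measurable_likelihoodRatio θ (leastFavorable θ (c / r)) n
  have hm₂ := measurable_likelihoodRatio θ (leastFavorable θ (-c / r)) n
  have hd : ∀ x, max (κ - (L₁ x + L₂ x) / 2) 0 = deficit κ (Real.log (L₁ x)) (Real.log (L₂ x)) := by
    intro x
    rw [deficit, Real.exp_log (likelihoodRatio_pos hS hν hp₁ ht₁ x),
      Real.exp_log (likelihoodRatio_pos hS hν hp₂ ht₂ x)]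
  have hpt : ∀ x, |limitDeficit κ (c * g) (scoreSum θ x / g) - max (κ - (L₁ x + L₂ x) / 2) 0|
      ≤ κ * |X₁ x| + κ * |X₂ x| := by
    intro x
    have e1 : c * g * (scoreSum θ x / g) = c * scoreSum θ x := by field_simp
    have e2 : -(c * g) * (scoreSum θ x / g) = -c * scoreSum θ x := by field_simp
    rw [hd, abs_sub_comm, limitDeficit, e1, e2]
    refine (abs_deficit_sub_le hκ _ _ _ _).trans (le_of_eq ?_)
    rw [hX₁, hX₂, hgg, mul_pow, neg_sq]
  have hia : ∀ {X : Sample k n → ℝ} {K : ℝ}, Integrable (fun x => X x ^ 2) (sampleLaw θ n) →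
      ∫ x, X x ^ 2 ∂(sampleLaw θ n) ≤ K / n → Measurable X →
      Integrable (fun x => |X x|) (sampleLaw θ n) ∧ ∫ x, |X x| ∂(sampleLaw θ n) ≤ (K + 1) / r := by
    intro X K hi hK hm
    have i1 : Integrable (fun x => r * X x ^ 2 + 1 / r) (sampleLaw θ n) :=
      (hi.const_mul r).add (integrable_const _)
    have i2 : Integrable (fun x => |X x|) (sampleLaw θ n) := by
      refine i1.mono' hm.abs.aestronglyMeasurable (ae_of_all _ fun x => ?_)
      rw [Real.norm_eq_abs, abs_abs]
      exact abs_le_mul_sq_add hr0 _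
    refine ⟨i2, (integral_mono i2 i1 fun x => abs_le_mul_sq_add hr0 _).trans ?_⟩
    rw [integral_add (hi.const_mul r) (integrable_const _), integral_const_mul]
    simp only [integral_const, probReal_univ, one_smul]
    calc r * ∫ x, X x ^ 2 ∂(sampleLaw θ n) + 1 / r ≤ r * (K / n) + 1 / r := by gcongr
      _ = (K + 1) / r := by rw [hrr]; field_simp
  have hs := measurable_scoreSum θ n
  obtain ⟨j₁, b₁⟩ := hia hi₁ hb₁ (hm₁.log.sub ((hs.const_mul c).sub_const _))
  obtain ⟨j₂, b₂⟩ := hia hi₂ hb₂ (hm₂.log.sub ((hs.const_mul (-c)).sub_const _))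
  have k1 : Integrable (fun x => limitDeficit κ (c * g) (scoreSum θ x / g)) (sampleLaw θ n) := by
    refine Integrable.of_bound (((continuous_limitDeficit κ (c * g)).measurable.comp
      (hs.div_const g)).aestronglyMeasurable) κ (ae_of_all _ fun x => ?_)
    exact abs_limitDeficit_le hκ _ _
  have k2 : Integrable (fun x => max (κ - (L₁ x + L₂ x) / 2) 0) (sampleLaw θ n) := by
    refine Integrable.of_bound (((measurable_const.sub ((hm₁.add hm₂).div_const 2)).max
      measurable_const).aestronglyMeasurable) κ (ae_of_all _ fun x => ?_)
    change ‖max (κ - (L₁ x + L₂ x) / 2) 0‖ ≤ κ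
    rw [hd, Real.norm_eq_abs, abs_of_nonneg (deficit_nonneg _ _ _)]
    exact deficit_le hκ _ _
  rw [Real.dist_eq, ← integral_sub k1 k2]
  refine (abs_integral_le_integral_abs).trans ((integral_mono (k1.sub k2).abs
    ((j₁.const_mul κ).add (j₂.const_mul κ)) hpt).trans ?_)
  rw [integral_add' (j₁.const_mul κ) (j₂.const_mul κ), integral_const_mul, integral_const_mul]
  calc κ * ∫ x, |X₁ x| ∂(sampleLaw θ n) + κ * ∫ x, |X₂ x| ∂(sampleLaw θ n)
      ≤ κ * ((K₁ + 1) / r) + κ * ((K₂ + 1) / r) := by gcongr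
    _ = _ := by rw [id, ← hr]; ring

lemma exp_mul_gaussianPDFReal (m w : ℝ) :
    gaussianPDFReal 0 1 w * Real.exp (m * w - m ^ 2 / 2) = gaussianPDFReal m 1 w := by
  rw [gaussianPDFReal_one, gaussianPDFReal_one, mul_assoc, ← Real.exp_add]
  congr 2
  ring

/-- The critical value of the limiting two-point mixture test. -/
def critValue (m z : ℝ) : ℝ := (Real.exp (m * z - m ^ 2 / 2) + Real.exp (-m * z - m ^ 2 / 2)) / 2

lemma critValue_eq (m z : ℝ) : critValue m z = Real.exp (-(m ^ 2 / 2)) * Real.cosh (m * z) := by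
  rw [critValue, Real.cosh_eq, sub_eq_add_neg, sub_eq_add_neg, Real.exp_add, Real.exp_add, neg_mul]
  ring

/-- The symmetric mixture ratio is a multiple of cosh(mw), increasing in |w|. Its Neyman–Pearson
tests are therefore exactly the two-sided ones, with the same z for every m. -/
lemma critValue_le_iff {m : ℝ} (hm : 0 < m) {z : ℝ} (hz : 0 ≤ z) (w : ℝ) :
    critValue m w ≤ critValue m z ↔ |w| ≤ z := by
  rw [critValue_eq, critValue_eq, mul_le_mul_iff_right₀ (Real.exp_pos _), Real.cosh_le_cosh,
    abs_mul, abs_mul, abs_of_nonneg hz, mul_le_mul_iff_right₀ (abs_pos.mpr hm.ne')]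

/-- The positive part is supported on [-z, z], where multiplication by the normal density turns the
two exponentials into normal densities shifted by ±m. -/
lemma integral_limitDeficit {m : ℝ} (hm : 0 < m) {z : ℝ} (hz : 0 ≤ z) :
    ∫ w, limitDeficit (critValue m z) m w ∂(gaussianReal 0 1)
      = critValue m z * acceptProb z 0 - acceptProb z m := by
  set κ := critValue m z with hκ
  have hc := continuous_gaussianPDFReal_one
  have h1 : ∀ w, gaussianPDFReal 0 1 w • limitDeficit κ m w = (Set.Icc (-z) z).indicator (fun w =>
      κ * gaussianPDFReal 0 1 w - (gaussianPDFReal m 1 w + gaussianPDFReal (-m) 1 w) / 2) w := by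
    intro w
    have hdef : limitDeficit κ m w = max (κ - critValue m w) 0 := rfl
    by_cases hw : |w| ≤ z
    · rw [Set.indicator_of_mem (show w ∈ Set.Icc (-z) z from abs_le.mp hw), hdef,
        max_eq_left (sub_nonneg.mpr ((critValue_le_iff hm hz w).mpr hw)), smul_eq_mul,
        show critValue m w = (Real.exp (m * w - m ^ 2 / 2) + Real.exp (-m * w - m ^ 2 / 2)) / 2
          from rfl, ← exp_mul_gaussianPDFReal m, ← exp_mul_gaussianPDFReal (-m), neg_sq]
      ring
    · rw [Set.indicator_of_notMem (show w ∉ Set.Icc (-z) z from fun h => hw (abs_le.mpr h)), hdef,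
        max_eq_right (sub_nonpos.mpr (le_of_not_ge fun h => hw ((critValue_le_iff hm hz w).mp h))),
        smul_zero]
  rw [integral_gaussianReal_eq_integral_smul one_ne_zero]
  simp_rw [h1]
  rw [integral_indicator measurableSet_Icc, integral_Icc_eq_integral_Ioc,
    ← intervalIntegral.integral_of_le (by linarith)]
  have hi : ∀ m, IntervalIntegrable (gaussianPDFReal m 1) volume (-z) z := fun m =>
    (hc m).intervalIntegrable _ _
  rw [intervalIntegral.integral_sub ((hi 0).const_mul κ) (((hi m).add (hi (-m))).div_const 2),
    intervalIntegral.integral_const_mul, intervalIntegral.integral_div,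
    intervalIntegral.integral_add (hi m) (hi (-m)), integral_gaussianPDFReal_eq_acceptProb,
    integral_gaussianPDFReal_eq_acceptProb, integral_gaussianPDFReal_eq_acceptProb, acceptProb_neg]
  ring

end

/-! ### Two-point alternatives and the bound for all tests -/

lemma exists_leastFavorable_mem_localAlt {θ : StudentParam k} (hS : θ.scatter.PosDef)
    (hν : 0 < θ.tail) {c c' : ℝ} (hc : c ≤ |c'|) (hc' : c' ≠ 0) : ∃ M₀ : ℝ, ∀ M, M₀ ≤ M →
      ∀ᶠ n : ℕ in atTop, leastFavorable θ (c' / √(n : ℝ)) ∈ localAlt θ c M n := by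
  obtain ⟨C, δ, hC, hδ, h⟩ := exists_leastFavorable_expansion hS hν
  set B := ∑ i, ∑ j, |θ.scatter i j| with hB
  have hBle : ∀ i j, |θ.scatter i j| ≤ B := by
    intro i j
    have h1 := Finset.single_le_sum (f := fun i => ∑ j, |θ.scatter i j|) (fun j _ => by positivity)
      (Finset.mem_univ i)
    have h2 := Finset.single_le_sum (f := fun j => |θ.scatter i j|) (fun j _ => abs_nonneg _)
      (Finset.mem_univ j)
    exact h2.trans h1
  have hB0 : 0 ≤ B := by positivity
  have hp : 0 ≤ |projCoef k θ.tail| * |c'| * B := by positivity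
  -- The radius has to cover the rescaling of the scatter as well as the tail displacement |c'|; the
  -- location does not move.
  refine ⟨|projCoef k θ.tail| * |c'| * B + |c'|, fun M hM => ?_⟩
  filter_upwards [(tendsto_inv_sqrt tendsto_id |c'|).eventually_le_const hδ,
    eventually_ge_atTop 1] with n hn hn1
  have hr0 : 0 < √(n : ℝ) := Real.sqrt_pos.mpr (by exact_mod_cast hn1)
  set r := √(n : ℝ) with hr
  obtain ⟨hPD, htail, -, -⟩ := h (c' / r) (by rw [abs_div, abs_of_pos hr0]; exact hn)
  have htd : r * |(leastFavorable θ (c' / r)).tail - θ.tail| = |c'| := by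
    rw [leastFavorable, add_sub_cancel_left, abs_div, abs_of_pos hr0]
    field_simp
  refine ⟨⟨hPD, htail, ?_⟩, ⟨fun i => ?_, fun i j => ?_⟩, ?_, ?_⟩
  · simp [leastFavorable, hc', hr0.ne']
  · simp only [leastFavorable, sub_self, abs_zero, mul_zero]
    linarith [abs_nonneg c']
  · have e : (leastFavorable θ (c' / r)).scatter i j - θ.scatter i j
        = -(projCoef k θ.tail * (c' / r) * θ.scatter i j) := by
      simp only [leastFavorable, Matrix.smul_apply, smul_eq_mul]
      ring
    rw [e, abs_neg, abs_mul, abs_mul, abs_div, abs_of_pos hr0]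
    calc r * (|projCoef k θ.tail| * (|c'| / r) * |θ.scatter i j|)
        = |projCoef k θ.tail| * |c'| * |θ.scatter i j| := by field_simp
      _ ≤ |projCoef k θ.tail| * |c'| * B := by gcongr; exact hBle i j
      _ ≤ M := by linarith [abs_nonneg c']
  · rw [← hr, htd]; exact hc
  · rw [← hr, htd]; linarith

/-- The infimum over local alternatives is at most the smaller of the powers at ±c' n^{-1/2} on the
least favorable path, hence at most their average, to which duality applies. -/
theorem limsup_power_le (hk : 1 ≤ k) {ν₀ : ℝ} (hν₀ : 0 < ν₀) {α : ℝ} (hα : α ∈ Set.Ioo (0 : ℝ) 1)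
    {θ : StudentParam k} (hθ : θ ∈ nullHyp k ν₀) {ψ : ∀ n, Sample k n → ℝ}
    (hψ : HasAsympLevel ν₀ α ψ) {c c' : ℝ} (hc : 0 ≤ c) (hcc' : c < c') :
    ∃ M : ℝ, limsup (fun n => ⨅ θ' ∈ localAlt θ c M n, power (ψ n) (sampleLaw θ' n)) atTop
      ≤ ENNReal.ofReal (1 - acceptProb (upperQuantile (α / 2)) (c' * √(effVar k ν₀))) := by
  have hS : θ.scatter.PosDef := hθ.1
  have htail : θ.tail = ν₀ := hθ.2
  have hν : 0 < θ.tail := htail ▸ hν₀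
  set z := upperQuantile (α / 2) with hz
  have hz0 : 0 < z := upperQuantile_pos ⟨by linarith [hα.1], by linarith [hα.2]⟩
  set m := c' * √(effVar k ν₀) with hm
  have hc'0 : 0 < c' := hc.trans_lt hcc'
  have hm0 : 0 < m := mul_pos hc'0 (Real.sqrt_pos.mpr (effVar_pos hk hν₀))
  -- The multiplier is the limiting mixture ratio at |w| = z, so the bound equals the power of the
  -- two-sided normal test of size α.
  set κ := critValue m z with hκ
  have hκ0 : 0 < κ := by rw [hκ, critValue]; positivity
  obtain ⟨M₁, hM₁⟩ := exists_leastFavorable_mem_localAlt hS hν (c := c) (c' := c')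
    (by rw [abs_of_pos hc'0]; exact hcc'.le) hc'0.ne'
  obtain ⟨M₂, hM₂⟩ := exists_leastFavorable_mem_localAlt hS hν (c := c) (c' := -c')
    (by rw [abs_neg, abs_of_pos hc'0]; exact hcc'.le) (neg_ne_zero.mpr hc'0.ne')
  have hD := tendsto_integral_deficit hk hS hν c' hκ0.le
  rw [htail, ← hm, integral_limitDeficit hm0 hz0.le, ← hκ, acceptProb_upperQuantile hα] at hD
  refine ⟨max M₁ M₂, ?_⟩
  have hε : ∀ ε : ℝ, 0 < ε →
      limsup (fun n => ⨅ θ' ∈ localAlt θ c (max M₁ M₂) n, power (ψ n) (sampleLaw θ' n)) atTop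
        ≤ ENNReal.ofReal (1 - acceptProb z m + (κ + 1) * ε) := by
    intro ε hε
    have hlev : ∀ᶠ n in atTop, power (ψ n) (sampleLaw θ n) < ENNReal.ofReal (α + ε) := by
      refine eventually_lt_of_limsup_lt ((hψ.level θ hθ).trans_lt ?_)
      exact (ENNReal.ofReal_lt_ofReal_iff (by linarith [hα.1])).mpr (by linarith)
    have hDe : ∀ᶠ n : ℕ in atTop, ∫ x : Sample k n,
        max (κ - (likelihoodRatio θ (leastFavorable θ (c' / √(n : ℝ))) x
          + likelihoodRatio θ (leastFavorable θ (-c' / √(n : ℝ))) x) / 2) 0 ∂(sampleLaw θ n)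
          < κ * (1 - α) - acceptProb z m + ε :=
      hD.eventually_lt_const (by linarith)
    refine limsup_le_of_le (by isBoundedDefault) ?_
    filter_upwards [hlev, hDe, hM₁ _ (le_max_left M₁ M₂), hM₂ _ (le_max_right M₁ M₂)]
      with n h1 h2 h3 h4
    have := isProbabilityMeasure_sampleLaw hS hν n
    have hψm := hψ.measurable n
    have hψ01 := hψ.mem_Icc n
    obtain ⟨i₁, e₁⟩ := integrable_likelihoodRatio hS hν h3.1.1 h3.1.2.1 n
    obtain ⟨i₂, e₂⟩ := integrable_likelihoodRatio hS hν h4.1.1 h4.1.2.1 n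
    have h5 := integral_mul_add_integral_mul_le i₁ i₂ e₁ e₂ hψm hψ01 κ
    have h6 : ∫ x, ψ n x ∂(sampleLaw θ n) ≤ α + ε := by
      rw [power_toReal hS hν hψm hψ01] at h1
      exact ((ENNReal.ofReal_lt_ofReal_iff (by linarith [hα.1])).mp h1).le
    have hn₁ : ∀ {θ' : StudentParam k}, θ' ∈ localAlt θ c (max M₁ M₂) n →
        0 ≤ ∫ x, likelihoodRatio θ θ' x * ψ n x ∂(sampleLaw θ n) := fun h =>
      integral_nonneg fun x => mul_nonneg (likelihoodRatio_pos hS hν h.1.1 h.1.2.1 x).le (hψ01 x).1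
    set p₁ := ∫ x, likelihoodRatio θ (leastFavorable θ (c' / √(n : ℝ))) x * ψ n x ∂(sampleLaw θ n)
      with hp₁
    set p₂ := ∫ x, likelihoodRatio θ (leastFavorable θ (-c' / √(n : ℝ))) x * ψ n x ∂(sampleLaw θ n)
      with hp₂
    have h7 : κ * ∫ x, ψ n x ∂(sampleLaw θ n) ≤ κ * (α + ε) := by gcongr
    -- The average power is at most κ(α + ε) + 1 - κ + κ(1 - α) - `acceptProb z m` + ε, in which the
    -- terms in κ without ε cancel.
    have hmin : min p₁ p₂ ≤ 1 - acceptProb z m + (κ + 1) * ε := by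
      have := min_le_left p₁ p₂
      have := min_le_right p₁ p₂
      linarith
    refine le_trans ?_ (ENNReal.ofReal_le_ofReal hmin)
    rcases min_choice p₁ p₂ with h | h <;> rw [h]
    · rw [hp₁, ← power_eq_integral hS hν h3.1.1 h3.1.2.1 hψm hψ01]
      exact iInf₂_le _ h3
    · rw [hp₂, ← power_eq_integral hS hν h4.1.1 h4.1.2.1 hψm hψ01]
      exact iInf₂_le _ h4
  have hlim : Tendsto (fun ε : ℝ => ENNReal.ofReal (1 - acceptProb z m + (κ + 1) * ε)) (𝓝[>] 0)
      (𝓝 (ENNReal.ofReal (1 - acceptProb z m))) := by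
    have h1 : Continuous fun ε : ℝ => ENNReal.ofReal (1 - acceptProb z m + (κ + 1) * ε) :=
      ENNReal.continuous_ofReal.comp (by fun_prop)
    have h2 := h1.tendsto 0
    rw [mul_zero, add_zero] at h2
    exact h2.mono_left nhdsWithin_le_nhds
  exact ge_of_tendsto hlim (eventually_mem_nhdsWithin.mono fun ε h => hε ε h)

/-- The two-point argument needs c' > 0, and the radius M depends on c'. Continuity in c' as c'
decreases to c also covers c = 0, where the bound is α. -/
theorem iInf_limsup_power_le (hk : 1 ≤ k) {ν₀ : ℝ} (hν₀ : 0 < ν₀) {α : ℝ}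
    (hα : α ∈ Set.Ioo (0 : ℝ) 1) {θ : StudentParam k} (hθ : θ ∈ nullHyp k ν₀)
    {ψ : ∀ n, Sample k n → ℝ} (hψ : HasAsympLevel ν₀ α ψ) {c : ℝ} (hc : 0 ≤ c) :
    ⨅ M : ℝ, limsup (fun n => ⨅ θ' ∈ localAlt θ c M n, power (ψ n) (sampleLaw θ' n)) atTop
      ≤ ENNReal.ofReal (1 - acceptProb (upperQuantile (α / 2)) (c * √(effVar k ν₀))) := by
  have hlim : Tendsto (fun c' : ℝ => ENNReal.ofReal
      (1 - acceptProb (upperQuantile (α / 2)) (c' * √(effVar k ν₀)))) (𝓝[>] c)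
      (𝓝 (ENNReal.ofReal (1 - acceptProb (upperQuantile (α / 2)) (c * √(effVar k ν₀))))) := by
    have h1 : Continuous fun c' : ℝ => ENNReal.ofReal
        (1 - acceptProb (upperQuantile (α / 2)) (c' * √(effVar k ν₀))) :=
      ENNReal.continuous_ofReal.comp (continuous_const.sub
        ((continuous_acceptProb _).comp (continuous_id.mul continuous_const)))
    exact (h1.tendsto c).mono_left nhdsWithin_le_nhds
  refine ge_of_tendsto hlim (eventually_mem_nhdsWithin.mono fun c' h => ?_)
  obtain ⟨M, hM⟩ := limsup_power_le hk hν₀ hα hθ hψ hc h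
  exact (iInf_le _ M).trans hM

theorem locallyAsympMaximin_twoSidedTest (hk : 1 ≤ k) {ν₀ : ℝ} (hν₀ : 0 < ν₀)
    {muHat : ∀ n, Sample k n → Fin k → ℝ} {sHat : ∀ n, Sample k n → Matrix (Fin k) (Fin k) ℝ}
    (hest : IsEstimator muHat sHat) (hroot : RootNConsistent ν₀ muHat sHat)
    (hdisc : LocallyDiscrete muHat sHat) {α : ℝ} (hα : α ∈ Set.Ioo (0 : ℝ) 1) :
    LocallyAsympMaximin ν₀ α (twoSidedTest ν₀ α muHat sHat) where
  level :=
    { measurable := measurable_twoSidedTest hk hν₀ hest α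
      mem_Icc := twoSidedTest_mem_Icc ν₀ α
      level := fun _ hθ => (tendsto_power_null hk hν₀ hest hroot hdisc hα hθ).limsup_eq.le }
  maximin _ hθ _ hc := iSup₂_le fun _ hψ => (iInf_limsup_power_le hk hν₀ hα hθ hψ hc).trans
    (le_iInf fun M => le_liminf_power hk hν₀ hest hroot hdisc hα hθ hc M)

end

end StudentT

/-! ### The main theorem -/

open StudentT in
theorem theorem2 (k : ℕ) (hk : 1 ≤ k) (ν₀ : ℝ) (hν₀ : 0 < ν₀) (α : ℝ) (hα : α ∈ Set.Ioo (0 : ℝ) 1)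
    (muHat : ∀ n, Sample k n → Fin k → ℝ)
    (sHat : ∀ n, Sample k n → Matrix (Fin k) (Fin k) ℝ)
    (hest : IsEstimator muHat sHat)
    (hroot : RootNConsistent ν₀ muHat sHat)
    (hdisc : LocallyDiscrete muHat sHat) :
    (∀ (μ : Fin k → ℝ) (S : Matrix (Fin k) (Fin k) ℝ), S.PosDef →
      AsympNormal (testStat ν₀ muHat sHat) (sampleLaw ⟨μ, S, ν₀⟩) 0) ∧
    (∀ (μ : Fin k → ℝ) (S : Matrix (Fin k) (Fin k) ℝ), S.PosDef →
      ∀ (τ : ℕ → ℝ) (τ₃ : ℝ), (∀ n : ℕ, 0 < ν₀ + (√(n : ℝ))⁻¹ * τ n) → Tendsto τ atTop (𝓝 τ₃) →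
        AsympNormal (testStat ν₀ muHat sHat)
          (fun n => sampleLaw ⟨μ, S, ν₀ + (√(n : ℝ))⁻¹ * τ n⟩ n)
          (τ₃ * √(effInfo ⟨μ, S, ν₀⟩))) ∧
    (∀ θ ∈ nullHyp k ν₀,
      Tendsto (fun n => power (twoSidedTest ν₀ α muHat sHat n) (sampleLaw θ n)) atTop
        (𝓝 (ENNReal.ofReal α))) ∧
    LocallyAsympMaximin ν₀ α (twoSidedTest ν₀ α muHat sHat) := by
  refine ⟨fun μ S hS => ?_, fun μ S hS τ τ₃ hpos hτ =>
    asympNormal_testStat hk hν₀ hest hroot hdisc μ hS hpos hτ,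
    fun θ hθ => tendsto_power_null hk hν₀ hest hroot hdisc hα hθ,
    locallyAsympMaximin_twoSidedTest hk hν₀ hest hroot hdisc hα⟩
  have h := asympNormal_testStat hk hν₀ hest hroot hdisc μ hS (τ := fun _ => 0) (t := 0)
    (fun n => by simpa using hν₀) tendsto_const_nhds
  simpa only [mul_zero, add_zero, zero_mul] using h
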